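/- Let $(M^4,g,J)$ be a Kähler manifold of real dimension four: $g$ is a smooth Riemannian metric, $J$ a smooth almost complex structure with $\langle JX,JY\rangle=\langle X,Y\rangle$, and the Kähler form $\overline\omega(X,Y)=\langle JX,Y\rangle$ is parallel for the Levi-Civita connection $\overline\nabla$ of $g$. Let $\Sigma$ be a smooth surface with an orientation given by a nowhere vanishing two-form $d\mu$, and let $F:\Sigma\times[0,T)\to M$ be a smooth mean curvature flow, i.e. every $F_t=F(\cdot,t)$ is an immersion and $\frac{dF}{dt}(x,t)=H(x,t)$, where $H$ is the mean curvature vector of $F_t$, the trace with respect to $g_t=F_t^*g$ of the second fundamental form $A(X,Y)=(\overline\nabla_XY)^N$. Let $\omega_t=F_t^*\overline\omega$, let $*_t$ be the Hodge star operator on $\Sigma$ of the metric $g_t$ and the orientation $d\mu$, and put $\eta=*_t\omega_t$. Then, for every $t\in[0,T)$, $\eta$ is a smooth function on $\Sigma$, and at every $p\in\Sigma$ \[ \frac{d}{dt}\eta=\Delta\eta+\eta\sum_{k=1}^{2}\left[(h_{31k}-h_{42k})^2+(h_{32k}+h_{41k})^2\right]+(1-\eta^2)\,\mathrm{Ric}(Je_1,e_2)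 \] (one-sided derivative at $t=0$), where $\Delta$ is the Laplace–Beltrami operator of $g_t$, $\mathrm{Ric}$ is the Ricci tensor of $M$ (positive on round spheres), $\{e_1,e_2,e_3,e_4\}$ is any orthonormal basis of $T_{F_t(p)}M$ such that $\{e_1,e_2\}$ is an orthonormal basis of $dF_t(T_p\Sigma)$ with $d\mu(e_1,e_2)>0$ (identifying $T_p\Sigma$ with its image) and \[ \overline\omega^2(e_1,e_2,e_3,e_4):=\overline\omega(e_1,e_2)\,\overline\omega(e_3,e_4)-\overline\omega(e_1,e_3)\,\overline\omega(e_2,e_4)+\overline\omega(e_1,e_4)\,\overline\omega(e_2,e_3)>0, \] and $h_{\alpha ij}$ are the components of the second fundamental form, $A(e_i,e_j)=h_{3ij}e_3+h_{4ij}e_4$ for $i,j\in\{1,2\}$. -/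

import Mathlib

open scoped Manifold ContDiff
open Set

noncomputable section

namespace KaehlerMCF

/-- The model space `ℝⁿ`. -/
abbrev Rn (n : ℕ) : Type := EuclideanSpace ℝ (Fin n)

/-! ### Riemannian geometry on an open subset of `ℝⁿ` -/

section Local

variable {n : ℕ}

/-- The partial derivative `∂ᵢ u` at `y`. -/
def pd {V : Type*} [NormedAddCommGroup V] [NormedSpace ℝ V]
    (i : Fin n) (u : Rn n → V) (y : Rn n) : V :=
  fderiv ℝ u y (EuclideanSpace.single i 1)

/-- The Christoffel symbol `Γᵏᵢⱼ` of the Levi-Civita connection of the metric with coefficients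
`G`. -/
def christoffel (G : Rn n → Matrix (Fin n) (Fin n) ℝ) (k i j : Fin n) (y : Rn n) : ℝ :=
  (1 / 2) * ∑ l, (G y)⁻¹ k l *
    (pd i (fun z => G z j l) y + pd j (fun z => G z i l) y - pd l (fun z => G z i j) y)

/-- The coefficient of `∂ₗ` in `R(∂ᵢ, ∂ⱼ) ∂ₖ`, where `R(X,Y)Z = ∇_X ∇_Y Z - ∇_Y ∇_X Z - ∇_[X,Y] Z`. -/
def riemannCoeff (G : Rn n → Matrix (Fin n) (Fin n) ℝ) (l i j k : Fin n) (y : Rn n) : ℝ :=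
  pd i (christoffel G l j k) y - pd j (christoffel G l i k) y
    + ∑ p, (christoffel G l i p y * christoffel G p j k y
      - christoffel G l j p y * christoffel G p i k y)

/-- `Ric(∂ⱼ, ∂ₖ)`, the trace of `X ↦ R(X, ∂ⱼ) ∂ₖ` (positive for the round sphere). -/
def ricciCoeff (G : Rn n → Matrix (Fin n) (Fin n) ℝ) (j k : Fin n) (y : Rn n) : ℝ :=
  ∑ i, riemannCoeff G i i j k y

/-- The Laplace–Beltrami operator `gⁱʲ (∂ᵢ ∂ⱼ u - Γᵏᵢⱼ ∂ₖ u)`. -/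
def laplacianCoord (G : Rn n → Matrix (Fin n) (Fin n) ℝ) (u : Rn n → ℝ) (y : Rn n) : ℝ :=
  ∑ i, ∑ j, (G y)⁻¹ i j * (pd i (pd j u) y - ∑ k, christoffel G k i j y * pd k u y)

end Local

/-! ### Tensors on manifolds and their coordinate expressions -/

section Manifold

variable {n : ℕ} {M : Type*} [TopologicalSpace M] [ChartedSpace (Rn n) M]

variable (n M) in
/-- A field of functions of two tangent vectors (used for metrics and two-forms). -/
abbrev TwoTensor : Type _ :=
  ∀ x : M, TangentSpace (𝓡 n) x → TangentSpace (𝓡 n) x → ℝ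

/-- The coordinate vector `∂ₐ` of the chart `φ`, at the point with coordinates `y`. -/
def coordVec (φ : OpenPartialHomeomorph M (Rn n)) (a : Fin n) (y : Rn n) :
    TangentSpace (𝓡 n) (φ.symm y) :=
  mfderiv 𝓘(ℝ, Rn n) (𝓡 n) φ.symm y (EuclideanSpace.single a 1 : Rn n)

/-- The components in the chart `φ` of a tangent vector at `x`. -/
def vecCoord (φ : OpenPartialHomeomorph M (Rn n)) (x : M) (v : TangentSpace (𝓡 n) x) : Rn n :=
  mfderiv (𝓡 n) 𝓘(ℝ, Rn n) φ x v

/-- The coefficients `h(∂ₐ, ∂_b)` of a two-tensor in the chart `φ`. -/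
def coeff (h : TwoTensor n M) (φ : OpenPartialHomeomorph M (Rn n)) (y : Rn n) :
    Matrix (Fin n) (Fin n) ℝ :=
  Matrix.of fun a b => h (φ.symm y) (coordVec φ a y) (coordVec φ b y)

/-- The Laplace–Beltrami operator of the metric `h` applied to `u`, at the point `x`. -/
def laplaceBeltrami (h : TwoTensor n M) (u : M → ℝ) (x : M) : ℝ :=
  laplacianCoord (coeff h (chartAt (Rn n) x)) (u ∘ (chartAt (Rn n) x).symm) (chartAt (Rn n) x x)

/-- The Ricci tensor of the metric `h` at the point `x`. -/
def ricci (h : TwoTensor n M) (x : M) (v w : TangentSpace (𝓡 n) x) : ℝ :=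
  ∑ j, ∑ k, ricciCoeff (coeff h (chartAt (Rn n) x)) j k (chartAt (Rn n) x x)
    * vecCoord (chartAt (Rn n) x) x v j * vecCoord (chartAt (Rn n) x) x w k

/-- The two-tensor `β` is parallel for the Levi-Civita connection of `h`: `∇β = 0` in every
chart. -/
def IsParallel (h β : TwoTensor n M) : Prop :=
  ∀ φ ∈ atlas (Rn n) M, ∀ y ∈ φ.target, ∀ a b c : Fin n,
    pd c (fun z => coeff β φ z a b) y
      - ∑ d, christoffel (coeff h φ) d c a y * coeff β φ y d b
      - ∑ d, christoffel (coeff h φ) d c b y * coeff β φ y a d = 0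

variable (n M) in
/-- Smooth Riemannian metrics on the `n`-manifold `M`. -/
abbrev Metric [IsManifold (𝓡 n) ∞ M] : Type _ :=
  Bundle.ContMDiffRiemannianMetric (𝓡 n) ∞ (Rn n) (fun x : M => TangentSpace (𝓡 n) x)

/-- The metric as a two-tensor. -/
def Metric.tensor [IsManifold (𝓡 n) ∞ M] (g : Metric n M) : TwoTensor n M :=
  fun x v w => g.inner x v w

/-- The form `ω(X, Y) = ⟨J X, Y⟩`. -/
def kaehlerForm [IsManifold (𝓡 n) ∞ M] (g : Metric n M)
    (J : ∀ x : M, TangentSpace (𝓡 n) x →L[ℝ] TangentSpace (𝓡 n) x) : TwoTensor n M :=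
  fun x v w => g.inner x (J x v) w

/-- `(M, g, J)` is a Kähler manifold: `J` is a smooth orthogonal almost complex structure whose
form `⟨J ·, ·⟩` is parallel. -/
structure IsKaehler [IsManifold (𝓡 n) ∞ M] (g : Metric n M)
    (J : ∀ x : M, TangentSpace (𝓡 n) x →L[ℝ] TangentSpace (𝓡 n) x) : Prop where
  smooth : ContMDiff (𝓡 n) ((𝓡 n).prod 𝓘(ℝ, Rn n →L[ℝ] Rn n)) ∞
    (fun x => Bundle.TotalSpace.mk' (Rn n →L[ℝ] Rn n)
      (E := fun x : M => TangentSpace (𝓡 n) x →L[ℝ] TangentSpace (𝓡 n) x) x (J x))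
  sq : ∀ x v, J x (J x v) = -v
  orthogonal : ∀ x v w, g.inner x (J x v) (J x w) = g.inner x v w
  parallel : IsParallel g.tensor (kaehlerForm g J)

end Manifold

/-! ### Oriented surfaces -/

section Surface

variable {S : Type*} [TopologicalSpace S] [ChartedSpace (Rn 2) S] [IsManifold (𝓡 2) ∞ S]

variable (S) in
/-- An orientation of the surface `S`, given by a smooth nowhere vanishing two-form. -/
structure OrientationForm where
  form (x : S) : TangentSpace (𝓡 2) x →L[ℝ] TangentSpace (𝓡 2) x →L[ℝ] ℝ
  alternating : ∀ x v, form x v v = 0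
  ne_zero : ∀ x, form x ≠ 0
  smooth : ContMDiff (𝓡 2) ((𝓡 2).prod 𝓘(ℝ, Rn 2 →L[ℝ] Rn 2 →L[ℝ] ℝ)) ∞
    (fun x => Bundle.TotalSpace.mk' (Rn 2 →L[ℝ] Rn 2 →L[ℝ] ℝ)
      (E := fun x : S => TangentSpace (𝓡 2) x →L[ℝ] TangentSpace (𝓡 2) x →L[ℝ] ℝ) x (form x))

/-- The area form at `x` of the metric `h` and the orientation `μ`:
`± √(h(v,v) h(w,w) - h(v,w)²)`, with the sign of `μ(v,w)`. -/
def areaForm (μ : OrientationForm S) (h : TwoTensor 2 S) : TwoTensor 2 S :=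
  fun x v w => Real.sign (μ.form x v w) * √(h x v v * h x w w - h x v w ^ 2)

/-- The Hodge star `*β` of a two-form `β` on the oriented surface `S` with metric `h`: the function
with `β = (*β) · areaForm`, computed on the standard basis of the tangent space (any other basis
gives the same value). -/
def hodgeStar (μ : OrientationForm S) (h β : TwoTensor 2 S) (x : S) : ℝ :=
  let b₁ : TangentSpace (𝓡 2) x := (EuclideanSpace.single 0 1 : Rn 2)
  let b₂ : TangentSpace (𝓡 2) x := (EuclideanSpace.single 1 1 : Rn 2)
  β x b₁ b₂ / areaForm μ h x b₁ b₂

end Surface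

/-! ### Immersed submanifolds and the mean curvature flow -/

section Immersion

variable {k n : ℕ} {S : Type*} [TopologicalSpace S] [ChartedSpace (Rn k) S]
  {M : Type*} [TopologicalSpace M] [ChartedSpace (Rn n) M]

/-- The pull-back `f^* h`. -/
def pullback (f : S → M) (h : TwoTensor n M) : TwoTensor k S :=
  fun x v w => h (f x) (mfderiv (𝓡 k) (𝓡 n) f x v) (mfderiv (𝓡 k) (𝓡 n) f x w)

/-- The expression of `f` in the charts `ψ` of `S` and `φ` of `M`. -/
def localMap (f : S → M) (ψ : OpenPartialHomeomorph S (Rn k)) (φ : OpenPartialHomeomorph M (Rn n)) :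
    Rn k → Rn n :=
  fun y => φ (f (ψ.symm y))

/-- The inner product, for the matrix `G`, of vectors given by their components. -/
def dotG (G : Matrix (Fin n) (Fin n) ℝ) (v w : Rn n) : ℝ :=
  ∑ a, ∑ b, G a b * v a * w b

variable (h : TwoTensor n M) (f : S → M)
  (ψ : OpenPartialHomeomorph S (Rn k)) (φ : OpenPartialHomeomorph M (Rn n))

/-- The components in `φ` of the covariant derivative of `f_* ∂ⱼ` in the direction `f_* ∂ᵢ`:
`∂ᵢ ∂ⱼ fᴬ + Γᴬ_{BC}(f) ∂ᵢ fᴮ ∂ⱼ fᶜ`. -/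
def covDerivCoord (i j : Fin k) (y : Rn k) : Rn n :=
  WithLp.toLp 2 fun A =>
    pd i (pd j (localMap f ψ φ)) y A
      + ∑ B, ∑ C, christoffel (coeff h φ) A B C (localMap f ψ φ y)
          * pd i (localMap f ψ φ) y B * pd j (localMap f ψ φ) y C

/-- The components in `φ` of the second fundamental form `A(∂ᵢ, ∂ⱼ)`: the normal part
`D - gᵏˡ ⟨D, ∂ₖ f⟩ ∂ₗ f` of the covariant derivative `D`, where `g` is the induced metric. -/
def secondFormCoord (i j : Fin k) (y : Rn k) : Rn n :=
  covDerivCoord h f ψ φ i j y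
    - ∑ p, ∑ q, ((coeff (pullback f h) ψ y)⁻¹ p q
        * dotG (coeff h φ (localMap f ψ φ y)) (covDerivCoord h f ψ φ i j y)
            (pd p (localMap f ψ φ) y)) • pd q (localMap f ψ φ) y

/-- The components in `φ` of the mean curvature vector `gⁱʲ A(∂ᵢ, ∂ⱼ)`. -/
def meanCurvatureCoord (y : Rn k) : Rn n :=
  ∑ i, ∑ j, (coeff (pullback f h) ψ y)⁻¹ i j • secondFormCoord h f ψ φ i j y

/-- `⟨A(v, w), ν⟩` for tangent vectors `v, w` of `S` at `x` and a tangent vector `ν` of `M` at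
`f x`. -/
def secondForm (x : S) (v w : TangentSpace (𝓡 k) x) (ν : TangentSpace (𝓡 n) (f x)) : ℝ :=
  let ψ := chartAt (Rn k) x
  let φ := chartAt (Rn n) (f x)
  dotG (coeff h φ (φ (f x)))
    (∑ i, ∑ j, (vecCoord ψ x v i * vecCoord ψ x w j) • secondFormCoord h f ψ φ i j (ψ x))
    (vecCoord φ (f x) ν)

/-- `F : [0, T) × S → M` is a mean curvature flow for the metric `h` of `M`: a smooth family of
immersions with `∂F/∂t = H`, the equation being written in arbitrary charts of `S` and `M`. -/
structure IsMeanCurvatureFlow (T : ℝ) (F : ℝ → S → M) : Prop where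
  smooth : ContMDiffOn (𝓘(ℝ, ℝ).prod (𝓡 k)) (𝓡 n) ∞ (fun q : ℝ × S => F q.1 q.2) (Ico 0 T ×ˢ univ)
  immersion : ∀ t ∈ Ico 0 T, ∀ x, Function.Injective (mfderiv (𝓡 k) (𝓡 n) (F t) x)
  equation : ∀ ψ ∈ atlas (Rn k) S, ∀ φ ∈ atlas (Rn n) M, ∀ t ∈ Ico 0 T, ∀ x ∈ ψ.source,
    F t x ∈ φ.source →
      HasDerivWithinAt (fun s => φ (F s x)) (meanCurvatureCoord h (F t) ψ φ (ψ x)) (Ico 0 T) t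

end Immersion

/-! ### Adapted frames of a surface in a Kähler surface -/

section Frame

variable {S : Type*} [TopologicalSpace S] [ChartedSpace (Rn 2) S] [IsManifold (𝓡 2) ∞ S]
  {M : Type*} [TopologicalSpace M] [ChartedSpace (Rn 4) M] [IsManifold (𝓡 4) ∞ M]

/-- `e` is an orthonormal basis of the tangent space of `M` at `f p` whose first two vectors are the
images of the positively oriented basis `u` of the tangent space of `S` at `p`, and
`ω²(e₁, e₂, e₃, e₄) > 0` for the Kähler form `ω` (indices start from `0` in the code). -/
structure IsAdaptedFrame (g : Metric 4 M)
    (J : ∀ x : M, TangentSpace (𝓡 4) x →L[ℝ] TangentSpace (𝓡 4) x) (μ : OrientationForm S)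
    (f : S → M) (p : S) (u : Fin 2 → TangentSpace (𝓡 2) p)
    (e : Fin 4 → TangentSpace (𝓡 4) (f p)) : Prop where
  orthonormal : ∀ a b, g.inner (f p) (e a) (e b) = if a = b then 1 else 0
  tangent_one : e 0 = mfderiv (𝓡 2) (𝓡 4) f p (u 0)
  tangent_two : e 1 = mfderiv (𝓡 2) (𝓡 4) f p (u 1)
  oriented : 0 < μ.form p (u 0) (u 1)
  compatible : 0 < kaehlerForm g J (f p) (e 0) (e 1) * kaehlerForm g J (f p) (e 2) (e 3)
    - kaehlerForm g J (f p) (e 0) (e 2) * kaehlerForm g J (f p) (e 1) (e 3)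
    + kaehlerForm g J (f p) (e 0) (e 3) * kaehlerForm g J (f p) (e 1) (e 2)

end Frame

end KaehlerMCF

end

/-! When the ambient form Ω is parallel, differentiating Ω(X, Y) along a map, in space or in time,
only differentiates X and Y covariantly. Fix a positive basis u of constant coordinate fields and
write η = Ω(f_*u₁, f_*u₂) / √det, with det the Gram determinant (`starFun`).

In space, the Hessian of f splits into a tangential part, which is the induced connection, and the
second fundamental form A. The tangential part multiplies η by the trace of the connection matrix,
and the derivative of √det removes exactly this, so √det · dη(v) = Ω(A(v,u₁), f_*u₂) + Ω(f_*u₁,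
A(v,u₂)) (`fderiv_starFun`). One more derivative gives Δη in terms of ∇A. In time, the connection
being torsion-free, the covariant time derivative of f_*u is the derivative of H along u
(`IsParallelOn.hasDerivWithinAt_form`), and H is the trace of A. In the difference ∂η/∂t - Δη,
Codazzi exchanges the normal derivatives of A at the price of the ambient curvature R(e₁,e₂), while
the tangential parts of ∇A are quadratic in A.

The rest is algebra in an adapted frame. The matrix of Ω is skew and orthogonal with positive
Pfaffian, hence self-dual (`IsKaehlerFrame.selfDual`): it is given by a unit vector (η, y, z). The
quadratic terms then collapse to η times the sum of squares. For the curvature terms (`ricci_term`),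
R(e₁,e₂) is skew for both g and Ω, so its self-dual part is a multiple of Ω; by the Bianchi identity
the multiple is -Ric(Je₁,e₂) (`sum_curvature_complex_structure`), and y² + z² = 1 - η² produces the
factor.

The coordinate fields are orthonormal only at the point considered, and no normal coordinates are
used: the connection coefficients are carried along and cancel (`IsImmersedIn.evolution`). What
remains identifies the chart expressions of the statement with these coordinate-free objects on open
sets of vector spaces. -/

set_option maxSynthPendingDepth 3

noncomputable section

namespace KaehlerMCF

/-! ### Connections on open sets of a vector space: parallel forms, curvature, derivatives along
maps. -/

section Connection

variable {E V : Type*} [NormedAddCommGroup E] [NormedSpace ℝ E]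
  [NormedAddCommGroup V] [NormedSpace ℝ V]

/-- The curvature `R(a, b) c` of the connection on an open subset of a vector space with Christoffel
map `Γ`. -/
def curv (Γ : E → E →L[ℝ] E →L[ℝ] E) (z a b c : E) : E :=
  fderiv ℝ Γ z a b c - fderiv ℝ Γ z b a c + Γ z a (Γ z b c) - Γ z b (Γ z a c)

/-- The bilinear form `β` is parallel on `O` for the connection `Γ`. -/
def IsParallelOn (Γ : E → E →L[ℝ] E →L[ℝ] E) (O : Set E) (β : E → E →L[ℝ] E →L[ℝ] ℝ) : Prop :=
  ∀ z ∈ O, ∀ c a b, fderiv ℝ β z c a b = β z (Γ z c a) b + β z a (Γ z c b)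

/-- The covariant derivative in the direction `v` of the field `X` along the map `f`. -/
def covD (Γ : E → E →L[ℝ] E →L[ℝ] E) (f : V → E) (X : V → E) (v : V) (y : V) : E :=
  fderiv ℝ X y v + Γ (f y) (fderiv ℝ f y v) (X y)

variable {Γ : E → E →L[ℝ] E →L[ℝ] E} {O : Set E} {β : E → E →L[ℝ] E →L[ℝ] ℝ}

theorem fderiv_bilin_apply {F : Type*} [NormedAddCommGroup F] [NormedSpace ℝ F]
    {B : V → E →L[ℝ] E →L[ℝ] F} {X Y : V → E} {y : V}
    (hB : DifferentiableAt ℝ B y) (hX : DifferentiableAt ℝ X y) (hY : DifferentiableAt ℝ Y y)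
    (v : V) :
    fderiv ℝ (fun y => B y (X y) (Y y)) y v =
      fderiv ℝ B y v (X y) (Y y) + B y (fderiv ℝ X y v) (Y y) + B y (X y) (fderiv ℝ Y y v) := by
  have h1 := (hB.hasFDerivAt.clm_apply hX.hasFDerivAt).clm_apply hY.hasFDerivAt
  rw [h1.fderiv]
  simp
  abel

theorem fderiv_comp_map_apply {F : Type*} [NormedAddCommGroup F] [NormedSpace ℝ F] {B : E → F}
    {f : V → E} {y : V} (hB : DifferentiableAt ℝ B (f y)) (hf : DifferentiableAt ℝ f y) (v : V) :
    fderiv ℝ (fun y => B (f y)) y v = fderiv ℝ B (f y) (fderiv ℝ f y v) := by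
  have h : HasFDerivAt (fun y => B (f y)) _ y := hB.hasFDerivAt.comp y hf.hasFDerivAt
  rw [h.fderiv]
  rfl

theorem fderiv_fderiv_comm {f : V → E} {y : V} (hf : ContDiffAt ℝ ∞ f y) (v w : V) :
    fderiv ℝ (fderiv ℝ f) y v w = fderiv ℝ (fderiv ℝ f) y w v :=
  (hf.isSymmSndFDerivAt (by simpa [minSmoothness_of_isRCLikeNormedField] using WithTop.coe_le_coe.2 (le_top (a := (2 : ℕ∞))))).eq
    v w

theorem differentiableAt_fderiv {f : V → E} {y : V} (hf : ContDiffAt ℝ ∞ f y) :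
    DifferentiableAt ℝ (fderiv ℝ f) y :=
  (hf.fderiv_right (m := ∞) (by simp)).differentiableAt (by simp)

theorem fderiv_fderiv_apply {f : V → E} {y : V} (hf : ContDiffAt ℝ ∞ f y) (v w : V) :
    fderiv ℝ (fun y => fderiv ℝ f y w) y v = fderiv ℝ (fderiv ℝ f) y v w := by
  rw [((differentiableAt_fderiv hf).hasFDerivAt.clm_apply (hasFDerivAt_const w y)).fderiv]
  simp

/-- The curvature acts by infinitesimal isometries on a parallel bilinear form. -/
theorem IsParallelOn.curv_skew (hO : IsOpen O) (hΓ : ContDiffOn ℝ ∞ Γ O) (hβ : ContDiffOn ℝ ∞ β O)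
    (hp : IsParallelOn Γ O β) {z : E} (hz : z ∈ O) (a b c d : E) :
    β z (curv Γ z a b c) d + β z c (curv Γ z a b d) = 0 := by
  have hΓz := hΓ.contDiffAt (hO.mem_nhds hz)
  have hβz := hβ.contDiffAt (hO.mem_nhds hz)
  have dΓ : DifferentiableAt ℝ Γ z := hΓz.differentiableAt (by simp)
  have dβ : DifferentiableAt ℝ β z := hβz.differentiableAt (by simp)
  -- Differentiating the parallel equation expresses the second derivative of β through Γ. The mixed
  -- terms, with one Γ in each slot, are symmetric in a and b, so the symmetry of the second
  -- derivative leaves only the curvature.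
  have key : ∀ a b, fderiv ℝ (fderiv ℝ β) z a b c d =
      β z (Γ z a (Γ z b c)) d + β z (Γ z b c) (Γ z a d) + β z (fderiv ℝ Γ z a b c) d
      + (β z (Γ z a c) (Γ z b d) + β z c (Γ z a (Γ z b d)) + β z c (fderiv ℝ Γ z a b d)) := by
    intro a b
    have h1 : fderiv ℝ (fun z => fderiv ℝ β z b c d) z a = fderiv ℝ (fderiv ℝ β) z a b c d := by
      rw [((((differentiableAt_fderiv hβz).hasFDerivAt.clm_apply (hasFDerivAt_const b z)).clm_apply
        (hasFDerivAt_const c z)).clm_apply (hasFDerivAt_const d z)).fderiv]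
      simp
    rw [← h1]
    have h2 : (fun z => fderiv ℝ β z b c d) =ᶠ[nhds z]
        fun z => β z (Γ z b c) d + β z c (Γ z b d) := by
      filter_upwards [hO.mem_nhds hz] with w hw using hp w hw b c d
    have dg : ∀ c : E, DifferentiableAt ℝ (fun z => Γ z b c) z := fun c => by fun_prop
    have fg : ∀ c : E, fderiv ℝ (fun z => Γ z b c) z a = fderiv ℝ Γ z a b c := by
      intro c
      rw [((dΓ.hasFDerivAt.clm_apply (hasFDerivAt_const b z)).clm_apply
        (hasFDerivAt_const c z)).fderiv]
      simp
    rw [h2.fderiv_eq, fderiv_fun_add (by fun_prop) (by fun_prop)]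
    simp only [_root_.add_apply]
    rw [fderiv_bilin_apply dβ (dg c) (differentiableAt_const d),
      fderiv_bilin_apply dβ (differentiableAt_const c) (dg d), fg, fg, hp z hz, hp z hz]
    simp
  have hs := fderiv_fderiv_comm hβz a b
  have hs' := congrArg (fun L => L c d) hs
  simp only [key] at hs'
  simp only [curv, map_add, map_sub, _root_.add_apply, _root_.sub_apply]
  linarith

theorem curv_swap (z a b c : E) : curv Γ z b a c = - curv Γ z a b c := by
  simp only [curv]; abel

/-- The first Bianchi identity. -/
theorem curv_bianchi (hO : IsOpen O) (hΓ : ContDiffOn ℝ ∞ Γ O)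
    (hs : ∀ z ∈ O, ∀ a b, Γ z a b = Γ z b a) {z : E} (hz : z ∈ O) (a b c : E) :
    curv Γ z a b c + curv Γ z b c a + curv Γ z c a b = 0 := by
  have dΓ : DifferentiableAt ℝ Γ z := (hΓ.contDiffAt (hO.mem_nhds hz)).differentiableAt (by simp)
  have key : ∀ x a b, fderiv ℝ Γ z x a b = fderiv ℝ Γ z x b a := by
    intro x a b
    have fg : ∀ a b : E, fderiv ℝ (fun z => Γ z a b) z x = fderiv ℝ Γ z x a b := by
      intro a b
      rw [((dΓ.hasFDerivAt.clm_apply (hasFDerivAt_const a z)).clm_apply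
        (hasFDerivAt_const b z)).fderiv]
      simp
    rw [← fg, ← fg]
    have h2 : (fun z => Γ z a b) =ᶠ[nhds z] fun z => Γ z b a := by
      filter_upwards [hO.mem_nhds hz] with w hw using hs w hw a b
    rw [h2.fderiv_eq]
  simp only [curv]
  rw [key a b c, key b c a, key c a b, hs z hz b c, hs z hz c a, hs z hz a b]
  abel

/-- The pair symmetry of the Riemann tensor. -/
theorem curv_pair_symm (hO : IsOpen O) (hΓ : ContDiffOn ℝ ∞ Γ O)
    (hs : ∀ z ∈ O, ∀ a b, Γ z a b = Γ z b a) {g : E → E →L[ℝ] E →L[ℝ] ℝ} (hg : ContDiffOn ℝ ∞ g O)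
    (hgs : ∀ z ∈ O, ∀ a b, g z a b = g z b a)
    (hp : IsParallelOn Γ O g) {z : E} (hz : z ∈ O) (a b c d : E) :
    g z (curv Γ z a b c) d = g z (curv Γ z c d a) b := by
  have B : ∀ a b c d, g z (curv Γ z a b c) d + g z (curv Γ z b c a) d + g z (curv Γ z c a b) d = 0 := by
    intro a b c d
    have := congrArg (fun x => g z x d) (curv_bianchi hO hΓ hs hz a b c)
    simpa using this
  have S : ∀ a b c d, g z (curv Γ z a b c) d + g z (curv Γ z a b d) c = 0 := by
    intro a b c d
    have := hp.curv_skew hO hΓ hg hz a b c d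
    rwa [hgs z hz c] at this
  have W : ∀ a b c d, g z (curv Γ z b a c) d = - g z (curv Γ z a b c) d := by
    intro a b c d
    rw [curv_swap]; simp
  -- In the signed sum of the four Bianchi identities for the cyclic shifts of (a, b, c, d), with
  -- signs +, +, -, -, the skew symmetries in the first and in the last pair cancel all but twice
  -- the required difference.
  linarith [B a b c d, B b c d a, B c d a b, B d a b c, S a b c d, S b c a d, S c a b d,
    S b c d a, S c d b a, S d b c a, S c d a b, S d a c b, S a c d b, S d a b c, S a b d c,
    S b d a c, W a b c d, W a c b d, W b d c a, W b d a c, W a c d b]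

variable {f : V → E} {U : Set V}

/-- The derivative of β in the direction of f_*v is replaced, by parallelism, with the two Γ terms
that complete the ordinary derivatives of X and Y to covariant ones. -/
theorem IsParallelOn.fderiv_along (hp : IsParallelOn Γ O β) (hO : IsOpen O)
    (hβ : ContDiffOn ℝ ∞ β O) {y : V} (hy : f y ∈ O) {X Y : V → E}
    (hf : DifferentiableAt ℝ f y) (hX : DifferentiableAt ℝ X y) (hY : DifferentiableAt ℝ Y y)
    (v : V) :
    fderiv ℝ (fun y => β (f y) (X y) (Y y)) y v =
      β (f y) (covD Γ f X v y) (Y y) + β (f y) (X y) (covD Γ f Y v y) := by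
  have dβ : DifferentiableAt ℝ β (f y) :=
    (hβ.contDiffAt (hO.mem_nhds hy)).differentiableAt (by simp)
  have h1 : fderiv ℝ (fun y => β (f y)) y v = fderiv ℝ β (f y) (fderiv ℝ f y v) :=
    fderiv_comp_map_apply dβ hf v
  rw [fderiv_bilin_apply (B := fun y => β (f y)) (DifferentiableAt.comp (g := β) y dβ hf) hX hY, h1, hp _ hy]
  simp only [covD, map_add, _root_.add_apply]
  ring

/-- Vanishing torsion: both the second derivative of f and Γ are symmetric. -/
theorem covD_fderiv_comm (hs : ∀ z ∈ O, ∀ a b, Γ z a b = Γ z b a) {y : V} (hy : f y ∈ O)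
    (hf : ContDiffAt ℝ ∞ f y) (v w : V) :
    covD Γ f (fun y => fderiv ℝ f y w) v y = covD Γ f (fun y => fderiv ℝ f y v) w y := by
  simp only [covD]
  rw [fderiv_fderiv_apply hf, fderiv_fderiv_apply hf, fderiv_fderiv_comm hf, hs _ hy]

theorem covD_congr {X X' : V → E} {y : V} (h : X =ᶠ[nhds y] X') (v : V) :
    covD Γ f X v y = covD Γ f X' v y := by
  simp only [covD, h.fderiv_eq, h.eq_of_nhds]

theorem covD_sub {X Y : V → E} {y : V} (hX : DifferentiableAt ℝ X y) (hY : DifferentiableAt ℝ Y y)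
    (v : V) : covD Γ f (fun y => X y - Y y) v y = covD Γ f X v y - covD Γ f Y v y := by
  simp only [covD, fderiv_fun_sub hX hY, map_sub, _root_.sub_apply]
  abel

theorem covD_smul {c : V → ℝ} {Y : V → E} {y : V} (hc : DifferentiableAt ℝ c y)
    (hY : DifferentiableAt ℝ Y y) (v : V) :
    covD Γ f (fun y => c y • Y y) v y = fderiv ℝ c y v • Y y + c y • covD Γ f Y v y := by
  simp only [covD, fderiv_fun_smul hc hY, map_smul, _root_.add_apply,
    _root_.smul_apply, ContinuousLinearMap.smulRight_apply, smul_add]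
  abel

theorem covD_sum {ι : Type*} (s : Finset ι) {X : ι → V → E} {y : V}
    (hX : ∀ i ∈ s, DifferentiableAt ℝ (X i) y) (v : V) :
    covD Γ f (fun y => ∑ i ∈ s, X i y) v y = ∑ i ∈ s, covD Γ f (X i) v y := by
  simp only [covD, fderiv_fun_sum hX, map_sum, Finset.sum_add_distrib,
    _root_.sum_apply]

theorem contDiffOn_covD (hU : IsOpen U) (hΓ : ContDiffOn ℝ ∞ Γ O)
    (hf : ContDiffOn ℝ ∞ f U) (hm : MapsTo f U O) {X : V → E} (hX : ContDiffOn ℝ ∞ X U) (v : V) :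
    ContDiffOn ℝ ∞ (covD Γ f X v) U := by
  have h1 := (hX.fderiv_of_isOpen (m := ∞) hU (by simp)).clm_apply (contDiffOn_const (c := v))
  have h2 := (hf.fderiv_of_isOpen (m := ∞) hU (by simp)).clm_apply (contDiffOn_const (c := v))
  exact h1.add (((hΓ.comp hf hm).clm_apply h2).clm_apply hX)

/-- The Ricci identity for a field along a map. -/
theorem covD_covD_sub (hO : IsOpen O) (hΓ : ContDiffOn ℝ ∞ Γ O) {y : V} (hy : f y ∈ O)
    (hf : ContDiffAt ℝ ∞ f y) {X : V → E} (hX : ContDiffAt ℝ ∞ X y) (v w : V) :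
    covD Γ f (covD Γ f X w) v y - covD Γ f (covD Γ f X v) w y =
      curv Γ (f y) (fderiv ℝ f y v) (fderiv ℝ f y w) (X y) := by
  have dΓ : DifferentiableAt ℝ Γ (f y) :=
    (hΓ.contDiffAt (hO.mem_nhds hy)).differentiableAt (by simp)
  have df : DifferentiableAt ℝ f y := hf.differentiableAt (by simp)
  have dX : DifferentiableAt ℝ X y := hX.differentiableAt (by simp)
  have ddf := differentiableAt_fderiv hf
  have ddX := differentiableAt_fderiv hX
  have h1 : ∀ v, fderiv ℝ (fun y => Γ (f y)) y v = fderiv ℝ Γ (f y) (fderiv ℝ f y v) := by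
    intro v
    exact fderiv_comp_map_apply dΓ df v
  have dΓf : DifferentiableAt ℝ (fun y => Γ (f y)) y := DifferentiableAt.comp (g := Γ) y dΓ df
  -- The second derivatives of X and of f, and the two terms with Γ applied to a first derivative of
  -- X, are together symmetric in v and w. Only the derivative of Γ and the product of two Γ
  -- survive, and these make up `curv`.
  have key : ∀ v w, covD Γ f (covD Γ f X w) v y =
      fderiv ℝ (fderiv ℝ X) y v w + (fderiv ℝ Γ (f y) (fderiv ℝ f y v) (fderiv ℝ f y w) (X y)
      + Γ (f y) (fderiv ℝ (fderiv ℝ f) y v w) (X y)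
      + Γ (f y) (fderiv ℝ f y w) (fderiv ℝ X y v))
      + Γ (f y) (fderiv ℝ f y v) (fderiv ℝ X y w + Γ (f y) (fderiv ℝ f y w) (X y)) := by
    intro v w
    have dfw : DifferentiableAt ℝ (fun y => fderiv ℝ f y w) y := by fun_prop
    have e : covD Γ f X w = fun y => fderiv ℝ X y w + Γ (f y) (fderiv ℝ f y w) (X y) := rfl
    rw [covD, e, fderiv_fun_add (by fun_prop)
      ((dΓf.clm_apply dfw).clm_apply dX), _root_.add_apply,
      fderiv_bilin_apply dΓf dfw dX, fderiv_fderiv_apply hX, fderiv_fderiv_apply hf, h1]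
  rw [key, key, fderiv_fderiv_comm hf w v, fderiv_fderiv_comm hX w v]
  simp only [curv, map_add]
  abel

end Connection

/-! ### Linear algebra of an orthonormal frame with a complex structure. -/

section FrameAlgebra

variable {E : Type*} [NormedAddCommGroup E] [NormedSpace ℝ E]

/-- A skew-symmetric orthogonal `4 × 4` matrix with positive Pfaffian is self-dual. -/
theorem selfDual_of_skew_orthogonal {a b c d e f : ℝ}
    (h00 : a ^ 2 + b ^ 2 + c ^ 2 = 1) (h11 : a ^ 2 + d ^ 2 + e ^ 2 = 1)
    (h22 : b ^ 2 + d ^ 2 + f ^ 2 = 1) (h33 : c ^ 2 + e ^ 2 + f ^ 2 = 1)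
    (h12 : a * b + e * f = 0) (h13 : a * c - d * f = 0) (h23 : b * c + d * e = 0)
    (hpf : 0 < a * f - b * e + c * d) : f = a ∧ e = -b ∧ d = c := by
  -- p is the Pfaffian. The product of a skew 4 × 4 matrix with its dual is -p times the identity,
  -- and orthogonality makes the inverse equal to minus the matrix; so the dual (f, -e, d) is p
  -- times (a, b, c). Both vectors have norm one, hence p² = 1.
  set p := a * f - b * e + c * d with hp
  have h1 : p * a = f := by
    rw [hp]; linear_combination f * h11 - e * h12 + d * h13
  have h2 : p * b = -e := by
    rw [hp]; linear_combination f * h12 + d * h23 - e * h22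
  have h3 : p * c = d := by
    rw [hp]; linear_combination f * h13 - e * h23 + d * h33
  have hsq : f ^ 2 + e ^ 2 + d ^ 2 = 1 := by linarith
  have h4 : p ^ 2 = 1 := by
    have : p ^ 2 * (a ^ 2 + b ^ 2 + c ^ 2) = f ^ 2 + e ^ 2 + d ^ 2 := by
      rw [← h1, ← h3, show e = -(p * b) by linarith]; ring
    rw [h00, hsq] at this; linarith
  have h5 : p = 1 := by nlinarith
  rw [h5] at h1 h2 h3
  exact ⟨by linarith, by linarith, by linarith⟩

variable {g : E →L[ℝ] E →L[ℝ] ℝ} {J : E →L[ℝ] E} {e : Fin 4 → E}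

/-- The vectors J eᵢ form another orthonormal frame, and the trace of a bilinear form does not
depend on the frame. Linearity of Q is needed only on expansions in the frame, so Q can be a plain
function. -/
theorem sum_frame_complex_structure (hJ : ∀ v w, g (J v) (J w) = g v w)
    (hsk : ∀ v w, g (J v) w = - g v (J w)) (hgs : ∀ v w, g v w = g w v)
    (hon : ∀ a b, g (e a) (e b) = if a = b then 1 else 0)
    (hexp : ∀ X, X = ∑ n, g X (e n) • e n) (Q : E → E → ℝ)
    (hQ1 : ∀ (c : Fin 4 → ℝ) w, Q (∑ n, c n • e n) w = ∑ n, c n * Q (e n) w)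
    (hQ2 : ∀ (c : Fin 4 → ℝ) w, Q w (∑ n, c n • e n) = ∑ n, c n * Q w (e n)) :
    ∑ i, Q (J (e i)) (J (e i)) = ∑ i, Q (e i) (e i) := by
  have h1 : ∀ i, Q (J (e i)) (J (e i)) =
      ∑ n, ∑ m, (g (J (e i)) (e n) * g (J (e i)) (e m)) * Q (e n) (e m) := by
    intro i
    conv_lhs => rw [hexp (J (e i)), hQ1]
    refine Finset.sum_congr rfl fun n _ => ?_
    rw [hQ2, Finset.mul_sum]
    exact Finset.sum_congr rfl fun m _ => by ring
  have h2 : ∀ n m, ∑ i, g (J (e i)) (e n) * g (J (e i)) (e m) = if n = m then 1 else 0 := by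
    intro n m
    rw [← hon, ← hJ]
    conv_rhs => rw [hexp (J (e n))]
    simp only [map_sum, map_smul, _root_.sum_apply, _root_.smul_apply, smul_eq_mul]
    refine Finset.sum_congr rfl fun i _ => ?_
    rw [hsk (e i) (e n), hsk (e i) (e m), hgs (e i), hgs (e i) (J (e m)), hgs (J (e m))]
    ring
  simp only [h1]
  rw [Finset.sum_comm]
  refine Finset.sum_congr rfl fun n _ => ?_
  rw [Finset.sum_comm]
  simp only [← Finset.sum_mul, h2]
  simp

variable {R : E → E → E → E → ℝ}

/-- On a Kähler manifold `Ric(J a, b) = -½ ∑ ⟨R(a, b) eᵢ, J eᵢ⟩`. -/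
theorem sum_curvature_complex_structure (hJJ : ∀ v, J (J v) = -v)
    (hJ : ∀ v w, g (J v) (J w) = g v w) (hgs : ∀ v w, g v w = g w v)
    (hon : ∀ a b, g (e a) (e b) = if a = b then 1 else 0)
    (hexp : ∀ X, X = ∑ n, g X (e n) • e n)
    (hsw : ∀ a b c d, R b a c d = - R a b c d)
    (hB : ∀ a b c d, R a b c d + R b c a d + R c a b d = 0)
    (hpair : ∀ a b c d, R a b c d = R c d a b)
    (hRJ : ∀ a b c d, R a b (J c) d = - R a b c (J d))
    (hneg : ∀ a b c d, R a b c (-d) = - R a b c d)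
    (hlin : ∀ (c : Fin 4 → ℝ) a b d, R (∑ n, c n • e n) a b d = ∑ n, c n * R (e n) a b d)
    (hlin' : ∀ (c : Fin 4 → ℝ) a b d, R d a b (∑ n, c n • e n) = ∑ n, c n * R d a b (e n))
    (a b : E) :
    ∑ i, R a b (e i) (J (e i)) = -2 * ∑ i, R (e i) (J a) b (e i) := by
  have hsk : ∀ v w, g (J v) w = - g v (J w) := by
    intro v w
    rw [← hJ v (J w), hJJ]; simp
  have hs : ∀ p q r s, R p q r s = - R p q s r := by
    intro p q r s; rw [hpair p q r s, hsw s r, hpair s r]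
  have hsym : ∀ p q r, R p q r p = R p r q p := by
    intro p q r; rw [hpair p q r p, hsw p r, hs p r p q, neg_neg]
  -- Bianchi on a, b, eᵢ, followed by moving J from the last slot to the neighbouring one. The two
  -- resulting terms are Ricci summands, one in the frame eᵢ and one in the frame J eᵢ, so they have
  -- the same sum; this is the factor 2.
  have h1 : ∀ i, R a b (e i) (J (e i)) =
      - R (e i) (J a) b (e i) - R (J (e i)) b (J a) (J (e i)) := by
    intro i
    have e1 := hB a b (e i) (J (e i))
    have e2 := hsw (e i) b a (J (e i))
    have e3 := hRJ (e i) b a (e i)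
    rw [hsym] at e3
    have e4 : R (e i) a b (J (e i)) = R (J (e i)) b (J a) (J (e i)) := by
      have h2 := hRJ b (J (e i)) (e i) (J a)
      rw [hJJ, hneg, neg_neg] at h2
      rw [hpair, ← h2, hsw (J (e i)) b, hs, neg_neg]
    linarith
  simp only [h1, Finset.sum_sub_distrib, Finset.sum_neg_distrib]
  rw [sum_frame_complex_structure hJ hsk hgs hon hexp (fun v w => R v b (J a) w)
    (fun c w => hlin _ _ _ _) (fun c w => hlin' _ _ _ _)]
  simp only [hsym _ b (J a)]
  ring

end FrameAlgebra

/-! ### Immersions: the Gauss decomposition, the Weingarten relation and the Codazzi equation. -/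

section Immersed

variable {E V : Type*} [NormedAddCommGroup E] [NormedSpace ℝ E]
  [NormedAddCommGroup V] [NormedSpace ℝ V]

/-- The second covariant derivative of the map `f`. -/
def hessAlong (Γ : E → E →L[ℝ] E →L[ℝ] E) (f : V → E) (y : V) : V →L[ℝ] V →L[ℝ] E :=
  fderiv ℝ (fderiv ℝ f) y + (Γ (f y)).bilinearComp (fderiv ℝ f y) (fderiv ℝ f y)

/-- The Christoffel map of the metric induced by `f`, when `P` is the tangential projection. -/
def tanPart (Γ : E → E →L[ℝ] E →L[ℝ] E) (f : V → E) (P : V → E →L[ℝ] V) (y v w : V) : V :=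
  P y (hessAlong Γ f y v w)

/-- The second fundamental form of `f`, when `P` is the tangential projection. -/
def normPart (Γ : E → E →L[ℝ] E →L[ℝ] E) (f : V → E) (P : V → E →L[ℝ] V) (v w y : V) : E :=
  hessAlong Γ f y v w - fderiv ℝ f y (P y (hessAlong Γ f y v w))

/-- A smooth immersion `f` of an open set `U` into an open set `O` with metric `g`, whose
tangential projection is `P`. -/
structure IsImmersedIn (Γ : E → E →L[ℝ] E →L[ℝ] E) (O : Set E) (g : E → E →L[ℝ] E →L[ℝ] ℝ)
    (U : Set V) (f : V → E) (P : V → E →L[ℝ] V) : Prop where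
  open_O : IsOpen O
  open_U : IsOpen U
  smooth_Γ : ContDiffOn ℝ ∞ Γ O
  symm_Γ : ∀ z ∈ O, ∀ a b, Γ z a b = Γ z b a
  smooth_g : ContDiffOn ℝ ∞ g O
  symm_g : ∀ z ∈ O, ∀ a b, g z a b = g z b a
  parallel_g : IsParallelOn Γ O g
  smooth_f : ContDiffOn ℝ ∞ f U
  mapsTo : MapsTo f U O
  smooth_P : ContDiffOn ℝ ∞ P U
  left_inv : ∀ y ∈ U, ∀ v, P y (fderiv ℝ f y v) = v
  orth : ∀ y ∈ U, ∀ X v, g (f y) (X - fderiv ℝ f y (P y X)) (fderiv ℝ f y v) = 0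

variable {Γ : E → E →L[ℝ] E →L[ℝ] E} {O : Set E} {g Ω : E → E →L[ℝ] E →L[ℝ] ℝ}
  {U : Set V} {f : V → E} {P : V → E →L[ℝ] V}

theorem covD_fderiv {y : V} (hf : ContDiffAt ℝ ∞ f y) (v w : V) :
    covD Γ f (fun y => fderiv ℝ f y w) v y = hessAlong Γ f y v w := by
  simp only [covD]
  rw [fderiv_fderiv_apply hf]
  simp [hessAlong]

theorem covD_fderiv_field {y : V} (hf : ContDiffAt ℝ ∞ f y) {c : V → V}
    (hc : DifferentiableAt ℝ c y) (v : V) :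
    covD Γ f (fun y => fderiv ℝ f y (c y)) v y =
      fderiv ℝ f y (fderiv ℝ c y v) + hessAlong Γ f y v (c y) := by
  simp only [covD]
  rw [((differentiableAt_fderiv hf).hasFDerivAt.clm_apply hc.hasFDerivAt).fderiv]
  simp only [hessAlong, _root_.add_apply, ContinuousLinearMap.bilinearComp_apply,
    ContinuousLinearMap.coe_comp, Function.comp_apply, ContinuousLinearMap.flip_apply]
  abel

namespace IsImmersedIn

variable (h : IsImmersedIn Γ O g U f P)
include h

theorem contDiffAt_f {y : V} (hy : y ∈ U) : ContDiffAt ℝ ∞ f y :=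
  h.smooth_f.contDiffAt (h.open_U.mem_nhds hy)

theorem differentiableAt_f {y : V} (hy : y ∈ U) : DifferentiableAt ℝ f y :=
  (h.contDiffAt_f hy).differentiableAt (by simp)

theorem contDiffOn_fderiv : ContDiffOn ℝ ∞ (fderiv ℝ f) U :=
  h.smooth_f.fderiv_of_isOpen h.open_U (by simp)

theorem contDiffOn_fderiv_apply (v : V) : ContDiffOn ℝ ∞ (fun y => fderiv ℝ f y v) U :=
  h.contDiffOn_fderiv.clm_apply contDiffOn_const

theorem differentiableAt_fderiv_apply {y : V} (hy : y ∈ U) (v : V) :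
    DifferentiableAt ℝ (fun y => fderiv ℝ f y v) y :=
  ((h.contDiffOn_fderiv_apply v).contDiffAt (h.open_U.mem_nhds hy)).differentiableAt (by simp)

theorem hess_symm {y : V} (hy : y ∈ U) (v w : V) :
    hessAlong Γ f y v w = hessAlong Γ f y w v := by
  rw [← covD_fderiv (h.contDiffAt_f hy), ← covD_fderiv (h.contDiffAt_f hy)]
  exact covD_fderiv_comm h.symm_Γ (h.mapsTo hy) (h.contDiffAt_f hy) v w

theorem normPart_symm {y : V} (hy : y ∈ U) (v w : V) :
    normPart Γ f P v w y = normPart Γ f P w v y := by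
  simp only [normPart, h.hess_symm hy v w]

theorem contDiffOn_hess (v w : V) : ContDiffOn ℝ ∞ (fun y => hessAlong Γ f y v w) U :=
  (contDiffOn_covD h.open_U h.smooth_Γ h.smooth_f h.mapsTo
    (h.contDiffOn_fderiv_apply w) v).congr fun _ hy => (covD_fderiv (h.contDiffAt_f hy) v w).symm

theorem contDiffOn_tanPart (v w : V) : ContDiffOn ℝ ∞ (fun y => tanPart Γ f P y v w) U :=
  h.smooth_P.clm_apply (h.contDiffOn_hess v w)

theorem differentiableAt_tanPart {y : V} (hy : y ∈ U) (v w : V) :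
    DifferentiableAt ℝ (fun y => tanPart Γ f P y v w) y :=
  ((h.contDiffOn_tanPart v w).contDiffAt (h.open_U.mem_nhds hy)).differentiableAt (by simp)

theorem contDiffOn_normPart (v w : V) : ContDiffOn ℝ ∞ (normPart Γ f P v w) U :=
  (h.contDiffOn_hess v w).sub (h.contDiffOn_fderiv.clm_apply (h.contDiffOn_tanPart v w))

theorem differentiableAt_normPart {y : V} (hy : y ∈ U) (v w : V) :
    DifferentiableAt ℝ (normPart Γ f P v w) y :=
  ((h.contDiffOn_normPart v w).contDiffAt (h.open_U.mem_nhds hy)).differentiableAt (by simp)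

omit h in
theorem hess_eq (y v w : V) : hessAlong Γ f y v w =
    fderiv ℝ f y (tanPart Γ f P y v w) + normPart Γ f P v w y := by
  simp [tanPart, normPart]

theorem normPart_orth {y : V} (hy : y ∈ U) (v w x : V) :
    g (f y) (normPart Γ f P v w y) (fderiv ℝ f y x) = 0 :=
  h.orth y hy _ x

/-- The derivative of a parallel form on two coordinate fields. -/
theorem fderiv_form {β : E → E →L[ℝ] E →L[ℝ] ℝ} (hβ : ContDiffOn ℝ ∞ β O)
    (hp : IsParallelOn Γ O β) {y : V} (hy : y ∈ U) (v a b : V) :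
    fderiv ℝ (fun y => β (f y) (fderiv ℝ f y a) (fderiv ℝ f y b)) y v =
      β (f y) (hessAlong Γ f y v a) (fderiv ℝ f y b)
        + β (f y) (fderiv ℝ f y a) (hessAlong Γ f y v b) := by
  rw [hp.fderiv_along h.open_O hβ (h.mapsTo hy) (h.differentiableAt_f hy)
    (h.differentiableAt_fderiv_apply hy a) (h.differentiableAt_fderiv_apply hy b),
    covD_fderiv (h.contDiffAt_f hy), covD_fderiv (h.contDiffAt_f hy)]

/-- The normal part of the Hessian is orthogonal to tangent vectors and drops out: `tanPart` is
compatible with the induced metric. -/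
theorem fderiv_metric {y : V} (hy : y ∈ U) (v a b : V) :
    fderiv ℝ (fun y => g (f y) (fderiv ℝ f y a) (fderiv ℝ f y b)) y v =
      g (f y) (fderiv ℝ f y (tanPart Γ f P y v a)) (fderiv ℝ f y b)
        + g (f y) (fderiv ℝ f y a) (fderiv ℝ f y (tanPart Γ f P y v b)) := by
  rw [h.fderiv_form h.smooth_g h.parallel_g hy, hess_eq (P := P), hess_eq (P := P)]
  simp only [map_add, _root_.add_apply]
  rw [h.normPart_orth hy, h.symm_g _ (h.mapsTo hy) _ (normPart Γ f P v b y), h.normPart_orth hy]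
  ring

/-- The tangential part of the derivative of a normal field. -/
theorem covD_normal_tangential {N : V → E} {y : V} (hy : y ∈ U) (hN : DifferentiableAt ℝ N y)
    (hort : ∀ y ∈ U, ∀ x, g (f y) (N y) (fderiv ℝ f y x) = 0) (v x : V) :
    g (f y) (covD Γ f N v y) (fderiv ℝ f y x) = - g (f y) (N y) (normPart Γ f P v x y) := by
  have h1 := h.parallel_g.fderiv_along h.open_O h.smooth_g (h.mapsTo hy) (h.differentiableAt_f hy)
    hN (h.differentiableAt_fderiv_apply hy x) v
  have h2 : (fun y => g (f y) (N y) (fderiv ℝ f y x)) =ᶠ[nhds y] fun _ => 0 := by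
    filter_upwards [h.open_U.mem_nhds hy] with w hw using hort w hw x
  rw [h2.fderiv_eq, covD_fderiv (h.contDiffAt_f hy), hess_eq (P := P)] at h1
  simp only [map_add, hort y hy] at h1
  simp at h1
  linarith

/-- The Codazzi equation. -/
theorem codazzi {y : V} (hy : y ∈ U) (v w x : V) {ν : E}
    (hν : ∀ x, g (f y) (fderiv ℝ f y x) ν = 0) :
    g (f y) (covD Γ f (normPart Γ f P w x) v y - covD Γ f (normPart Γ f P v x) w y
      + normPart Γ f P v (tanPart Γ f P y w x) y - normPart Γ f P w (tanPart Γ f P y v x) y) ν =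
    g (f y) (curv Γ (f y) (fderiv ℝ f y v) (fderiv ℝ f y w) (fderiv ℝ f y x)) ν := by
  -- Write A(w, x) as the covariant derivative of f_*x minus its tangential part. Differentiating
  -- that tangential part contributes, in normal directions, exactly A(v, ∇_w x). Codazzi is then
  -- the Ricci identity for the field f_*x.
  have key : ∀ v w, g (f y) (covD Γ f (normPart Γ f P w x) v y
      + normPart Γ f P v (tanPart Γ f P y w x) y) ν =
      g (f y) (covD Γ f (covD Γ f (fun y => fderiv ℝ f y x) w) v y) ν := by
    intro v w
    have h1 : normPart Γ f P w x =ᶠ[nhds y] fun y => covD Γ f (fun y => fderiv ℝ f y x) w y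
        - fderiv ℝ f y (tanPart Γ f P y w x) := by
      filter_upwards [h.open_U.mem_nhds hy] with z hz
      rw [covD_fderiv (h.contDiffAt_f hz)]; rfl
    have d1 : DifferentiableAt ℝ (covD Γ f (fun y => fderiv ℝ f y x) w) y :=
      ((contDiffOn_covD h.open_U h.smooth_Γ h.smooth_f h.mapsTo
        (h.contDiffOn_fderiv_apply x) w).contDiffAt (h.open_U.mem_nhds hy)).differentiableAt
        (by simp)
    have d2 : DifferentiableAt ℝ (fun y => fderiv ℝ f y (tanPart Γ f P y w x)) y :=
      ((h.contDiffOn_fderiv.clm_apply (h.contDiffOn_tanPart w x)).contDiffAt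
        (h.open_U.mem_nhds hy)).differentiableAt (by simp)
    rw [covD_congr h1, covD_sub d1 d2, covD_fderiv_field (h.contDiffAt_f hy)
      (h.differentiableAt_tanPart hy w x), hess_eq (P := P) y v]
    simp only [map_add, map_sub, _root_.add_apply, _root_.sub_apply, hν]
    ring
  rw [← covD_covD_sub h.open_O h.smooth_Γ (h.mapsTo hy) (h.contDiffAt_f hy)
    ((h.contDiffOn_fderiv_apply x).contDiffAt (h.open_U.mem_nhds hy))]
  have k1 := key v w
  have k2 := key w v
  simp only [map_add, map_sub, _root_.add_apply, _root_.sub_apply] at k1 k2 ⊢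
  linarith

end IsImmersedIn

end Immersed

/-! ### First and second derivatives of the Hodge star function. -/

section Star

variable {E V : Type*} [NormedAddCommGroup E] [NormedSpace ℝ E]
  [NormedAddCommGroup V] [NormedSpace ℝ V]

/-- The Gram determinant of the coordinate fields `u`. -/
def gramDet (g : E → E →L[ℝ] E →L[ℝ] ℝ) (f : V → E) (u : Fin 2 → V) (y : V) : ℝ :=
  g (f y) (fderiv ℝ f y (u 0)) (fderiv ℝ f y (u 0)) * g (f y) (fderiv ℝ f y (u 1)) (fderiv ℝ f y (u 1))
    - g (f y) (fderiv ℝ f y (u 0)) (fderiv ℝ f y (u 1)) ^ 2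

/-- The Hodge star of the pull-back of `Ω`, computed on the positive basis `u`. -/
def starFun (g Ω : E → E →L[ℝ] E →L[ℝ] ℝ) (f : V → E) (u : Fin 2 → V) (y : V) : ℝ :=
  Ω (f y) (fderiv ℝ f y (u 0)) (fderiv ℝ f y (u 1)) / √(gramDet g f u y)

/-- The hypothesis on d has the form satisfied by a Gram determinant, with τ the trace of the
connection matrix; dividing by √d then subtracts τ w. -/
theorem fderiv_div_sqrt {w d : V → ℝ} {y : V} (hw : DifferentiableAt ℝ w y)
    (hd : DifferentiableAt ℝ d y) (hpos : 0 < d y) {v : V} {τ : ℝ}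
    (hd' : fderiv ℝ d y v = 2 * τ * d y) :
    fderiv ℝ (fun y => w y / √(d y)) y v = (fderiv ℝ w y v - τ * w y) / √(d y) := by
  have hs : √(d y) ≠ 0 := (Real.sqrt_pos.2 hpos).ne'
  have h1 : HasFDerivAt (fun y => w y * (√(d y))⁻¹) _ y :=
    hw.hasFDerivAt.mul ((hasDerivAt_inv hs).comp_hasFDerivAt y (hd.hasFDerivAt.sqrt hpos.ne'))
  simp only [div_eq_mul_inv]
  rw [h1.fderiv]
  simp only [_root_.add_apply, _root_.smul_apply, smul_eq_mul, hd']
  have h2 : √(d y) ^ 2 = d y := Real.sq_sqrt hpos.le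
  field_simp
  rw [h2]
  ring

variable {Γ : E → E →L[ℝ] E →L[ℝ] E} {O : Set E} {g Ω : E → E →L[ℝ] E →L[ℝ] ℝ}
  {U : Set V} {f : V → E} {P : V → E →L[ℝ] V}

theorem normPart_add_left (v v' w y : V) :
    normPart Γ f P (v + v') w y = normPart Γ f P v w y + normPart Γ f P v' w y := by
  simp only [normPart, map_add, _root_.add_apply]; abel

theorem normPart_smul_left (c : ℝ) (v w y : V) :
    normPart Γ f P (c • v) w y = c • normPart Γ f P v w y := by
  simp only [normPart, map_smul, _root_.smul_apply, smul_sub]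

theorem normPart_add_right (v w w' y : V) :
    normPart Γ f P v (w + w') y = normPart Γ f P v w y + normPart Γ f P v w' y := by
  simp only [normPart, map_add]; abel

theorem normPart_smul_right (c : ℝ) (v w y : V) :
    normPart Γ f P v (c • w) y = c • normPart Γ f P v w y := by
  simp only [normPart, map_smul, smul_sub]

/-- The numerator of the derivative of `starFun`. -/
def starNum (Γ : E → E →L[ℝ] E →L[ℝ] E) (Ω : E → E →L[ℝ] E →L[ℝ] ℝ) (f : V → E)
    (P : V → E →L[ℝ] V) (u : Fin 2 → V) (v y : V) : ℝ :=
  Ω (f y) (normPart Γ f P v (u 0) y) (fderiv ℝ f y (u 1))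
    + Ω (f y) (fderiv ℝ f y (u 0)) (normPart Γ f P v (u 1) y)

theorem basis_two_expand (u : Module.Basis (Fin 2) ℝ V) (x : V) :
    x = u.repr x 0 • u 0 + u.repr x 1 • u 1 := by
  conv_lhs => rw [← u.sum_repr x]
  rw [Fin.sum_univ_two]

namespace IsImmersedIn

variable (h : IsImmersedIn Γ O g U f P)
include h

theorem contDiffOn_form {β : E → E →L[ℝ] E →L[ℝ] ℝ} (hβ : ContDiffOn ℝ ∞ β O) (a b : V) :
    ContDiffOn ℝ ∞ (fun y => β (f y) (fderiv ℝ f y a) (fderiv ℝ f y b)) U :=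
  ((hβ.comp h.smooth_f h.mapsTo).clm_apply (h.contDiffOn_fderiv_apply a)).clm_apply
    (h.contDiffOn_fderiv_apply b)

theorem differentiableAt_form {β : E → E →L[ℝ] E →L[ℝ] ℝ} (hβ : ContDiffOn ℝ ∞ β O) {y : V}
    (hy : y ∈ U) (a b : V) :
    DifferentiableAt ℝ (fun y => β (f y) (fderiv ℝ f y a) (fderiv ℝ f y b)) y :=
  ((h.contDiffOn_form hβ a b).contDiffAt (h.open_U.mem_nhds hy)).differentiableAt (by simp)

theorem contDiffOn_gramDet (u : Fin 2 → V) : ContDiffOn ℝ ∞ (gramDet g f u) U :=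
  ((h.contDiffOn_form h.smooth_g _ _).mul (h.contDiffOn_form h.smooth_g _ _)).sub
    ((h.contDiffOn_form h.smooth_g _ _).pow 2)

theorem contDiffOn_starFun (hΩ : ContDiffOn ℝ ∞ Ω O) (u : Fin 2 → V)
    (hdet : ∀ y ∈ U, 0 < gramDet g f u y) : ContDiffOn ℝ ∞ (starFun g Ω f u) U :=
  (h.contDiffOn_form hΩ _ _).div ((h.contDiffOn_gramDet u).sqrt fun y hy => (hdet y hy).ne')
    fun y hy => (Real.sqrt_pos.2 (hdet y hy)).ne'

/-- Jacobi's formula: by metric compatibility the Gram matrix varies through the connection matrix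
and its transpose, so its determinant varies by twice the trace. -/
theorem fderiv_gramDet (u : Module.Basis (Fin 2) ℝ V) {y : V} (hy : y ∈ U) (v : V) :
    fderiv ℝ (gramDet g f u) y v =
      2 * (u.repr (tanPart Γ f P y v (u 0)) 0 + u.repr (tanPart Γ f P y v (u 1)) 1)
        * gramDet g f u y := by
  have d00 := (h.differentiableAt_form h.smooth_g hy (u 0) (u 0)).hasFDerivAt
  have d11 := (h.differentiableAt_form h.smooth_g hy (u 1) (u 1)).hasFDerivAt
  have d01 := (h.differentiableAt_form h.smooth_g hy (u 0) (u 1)).hasFDerivAt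
  have hd : HasFDerivAt (gramDet g f u) _ y := (d00.mul d11).sub (d01.pow 2)
  rw [hd.fderiv]
  simp only [_root_.add_apply, _root_.sub_apply, _root_.smul_apply, smul_eq_mul,
    h.fderiv_metric hy, nsmul_eq_mul]
  have e0 := basis_two_expand u (tanPart Γ f P y v (u 0))
  have e1 := basis_two_expand u (tanPart Γ f P y v (u 1))
  generalize u.repr (tanPart Γ f P y v (u 0)) 0 = p at *
  generalize u.repr (tanPart Γ f P y v (u 0)) 1 = q at *
  generalize u.repr (tanPart Γ f P y v (u 1)) 0 = r at *
  generalize u.repr (tanPart Γ f P y v (u 1)) 1 = s at *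
  rw [e0, e1]
  simp only [map_add, map_smul, _root_.add_apply, _root_.smul_apply, smul_eq_mul, gramDet]
  rw [h.symm_g _ (h.mapsTo hy) (fderiv ℝ f y (u 1)) (fderiv ℝ f y (u 0))]
  push_cast
  ring

/-- On a plane, an endomorphism acts on an alternating form through its trace. Hence the tangential
part of the Hessian contributes the trace of the connection times Ω, which the derivative of the
area factor cancels. -/
theorem fderiv_starFun (hΩ : ContDiffOn ℝ ∞ Ω O) (hp : IsParallelOn Γ O Ω)
    (hsk : ∀ z ∈ O, ∀ v w, Ω z v w = - Ω z w v) (u : Module.Basis (Fin 2) ℝ V)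
    (hdet : ∀ y ∈ U, 0 < gramDet g f u y) {y : V} (hy : y ∈ U) (v : V) :
    fderiv ℝ (starFun g Ω f u) y v = starNum Γ Ω f P u v y / √(gramDet g f u y) := by
  have hd := ((h.contDiffOn_gramDet u).contDiffAt (h.open_U.mem_nhds hy)).differentiableAt
    (by simp)
  have key := fderiv_div_sqrt (h.differentiableAt_form hΩ hy (u 0) (u 1)) hd (hdet y hy)
    (h.fderiv_gramDet u hy v)
  rw [show starFun g Ω f u = fun y => Ω (f y) (fderiv ℝ f y (u 0)) (fderiv ℝ f y (u 1)) /
    √(gramDet g f u y) from rfl, key, h.fderiv_form hΩ hp hy, hess_eq (P := P),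
    hess_eq (P := P)]
  congr 1
  have e0 := basis_two_expand u (tanPart Γ f P y v (u 0))
  have e1 := basis_two_expand u (tanPart Γ f P y v (u 1))
  generalize u.repr (tanPart Γ f P y v (u 0)) 0 = p at *
  generalize u.repr (tanPart Γ f P y v (u 0)) 1 = q at *
  generalize u.repr (tanPart Γ f P y v (u 1)) 0 = r at *
  generalize u.repr (tanPart Γ f P y v (u 1)) 1 = s at *
  rw [e0, e1]
  have hO := h.mapsTo hy
  have z0 : Ω (f y) (fderiv ℝ f y (u 0)) (fderiv ℝ f y (u 0)) = 0 := by
    linarith [hsk _ hO (fderiv ℝ f y (u 0)) (fderiv ℝ f y (u 0))]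
  have z1 : Ω (f y) (fderiv ℝ f y (u 1)) (fderiv ℝ f y (u 1)) = 0 := by
    linarith [hsk _ hO (fderiv ℝ f y (u 1)) (fderiv ℝ f y (u 1))]
  simp only [map_add, map_smul, _root_.add_apply, _root_.smul_apply, smul_eq_mul, starNum, z0, z1]
  ring

theorem contDiffOn_starNum (hΩ : ContDiffOn ℝ ∞ Ω O) (u : Fin 2 → V) (v : V) :
    ContDiffOn ℝ ∞ (starNum Γ Ω f P u v) U :=
  (((hΩ.comp h.smooth_f h.mapsTo).clm_apply (h.contDiffOn_normPart v _)).clm_apply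
    (h.contDiffOn_fderiv_apply _)).add
  (((hΩ.comp h.smooth_f h.mapsTo).clm_apply (h.contDiffOn_fderiv_apply _)).clm_apply
    (h.contDiffOn_normPart v _))

theorem fderiv_starNum (hΩ : ContDiffOn ℝ ∞ Ω O) (hp : IsParallelOn Γ O Ω) (u : Fin 2 → V)
    {y : V} (hy : y ∈ U) (v w : V) :
    fderiv ℝ (starNum Γ Ω f P u w) y v =
      Ω (f y) (covD Γ f (normPart Γ f P w (u 0)) v y) (fderiv ℝ f y (u 1))
      + Ω (f y) (normPart Γ f P w (u 0) y) (hessAlong Γ f y v (u 1))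
      + (Ω (f y) (hessAlong Γ f y v (u 0)) (normPart Γ f P w (u 1) y)
      + Ω (f y) (fderiv ℝ f y (u 0)) (covD Γ f (normPart Γ f P w (u 1)) v y)) := by
  have dΩ : DifferentiableAt ℝ (fun y => Ω (f y)) y :=
    ((hΩ.comp h.smooth_f h.mapsTo).contDiffAt (h.open_U.mem_nhds hy)).differentiableAt (by simp)
  have e : starNum Γ Ω f P u w = fun y =>
    Ω (f y) (normPart Γ f P w (u 0) y) (fderiv ℝ f y (u 1))
    + Ω (f y) (fderiv ℝ f y (u 0)) (normPart Γ f P w (u 1) y) := rfl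
  rw [e, fderiv_fun_add
    ((dΩ.clm_apply (h.differentiableAt_normPart hy _ _)).clm_apply
      (h.differentiableAt_fderiv_apply hy _))
    ((dΩ.clm_apply (h.differentiableAt_fderiv_apply hy _)).clm_apply
      (h.differentiableAt_normPart hy _ _)), _root_.add_apply,
    hp.fderiv_along h.open_O hΩ (h.mapsTo hy) (h.differentiableAt_f hy)
      (h.differentiableAt_normPart hy _ _) (h.differentiableAt_fderiv_apply hy _),
    hp.fderiv_along h.open_O hΩ (h.mapsTo hy) (h.differentiableAt_f hy)
      (h.differentiableAt_fderiv_apply hy _) (h.differentiableAt_normPart hy _ _),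
    covD_fderiv (h.contDiffAt_f hy), covD_fderiv (h.contDiffAt_f hy)]

/-- The Gram determinant equals 1 at y only; its derivative there is responsible for the trace term.
-/
theorem fderiv_fderiv_starFun (hΩ : ContDiffOn ℝ ∞ Ω O) (hp : IsParallelOn Γ O Ω)
    (hsk : ∀ z ∈ O, ∀ v w, Ω z v w = - Ω z w v) (u : Module.Basis (Fin 2) ℝ V)
    (hdet : ∀ y ∈ U, 0 < gramDet g f u y) {y : V} (hy : y ∈ U) (h1 : gramDet g f u y = 1)
    (v w : V) :
    fderiv ℝ (fun y => fderiv ℝ (starFun g Ω f u) y w) y v =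
      fderiv ℝ (starNum Γ Ω f P u w) y v
      - (u.repr (tanPart Γ f P y v (u 0)) 0 + u.repr (tanPart Γ f P y v (u 1)) 1)
        * starNum Γ Ω f P u w y := by
  have e : (fun y => fderiv ℝ (starFun g Ω f u) y w) =ᶠ[nhds y]
      fun y => starNum Γ Ω f P u w y / √(gramDet g f u y) := by
    filter_upwards [h.open_U.mem_nhds hy] with z hz using
      h.fderiv_starFun hΩ hp hsk u hdet hz w
  have hd := ((h.contDiffOn_gramDet u).contDiffAt (h.open_U.mem_nhds hy)).differentiableAt
    (by simp)
  have hn := ((h.contDiffOn_starNum hΩ u w).contDiffAt (h.open_U.mem_nhds hy)).differentiableAt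
    (by simp)
  rw [e.fderiv_eq, fderiv_div_sqrt hn hd (hdet y hy) (h.fderiv_gramDet u hy v), h1]
  simp

/-- The covariant derivative of the mean curvature vector, at a point where the coordinate fields
are orthonormal. -/
theorem covD_meanCurvature (u : Module.Basis (Fin 2) ℝ V) {c : Fin 2 → Fin 2 → V → ℝ}
    (hc : ∀ a b, ContDiffOn ℝ ∞ (c a b) U)
    (hinv : ∀ y ∈ U, ∀ a d, ∑ b, c a b y * g (f y) (fderiv ℝ f y (u b)) (fderiv ℝ f y (u d))
      = if a = d then 1 else 0) {y : V} (hy : y ∈ U)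
    (hon : ∀ a b, g (f y) (fderiv ℝ f y (u a)) (fderiv ℝ f y (u b)) = if a = b then 1 else 0)
    (v : V) :
    covD Γ f (fun y => ∑ a, ∑ b, c a b y • normPart Γ f P (u a) (u b) y) v y =
      ∑ a, ∑ b, ((if a = b then (1 : ℝ) else 0) • covD Γ f (normPart Γ f P (u a) (u b)) v y
        - (u.repr (tanPart Γ f P y v (u a)) b + u.repr (tanPart Γ f P y v (u b)) a)
          • normPart Γ f P (u a) (u b) y) := by
  have dc : ∀ a b, DifferentiableAt ℝ (c a b) y := fun a b =>
    ((hc a b).contDiffAt (h.open_U.mem_nhds hy)).differentiableAt (by simp)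
  have dA : ∀ a b, DifferentiableAt ℝ (normPart Γ f P (u a) (u b)) y := fun a b =>
    h.differentiableAt_normPart hy _ _
  have c0 : ∀ a b, c a b y = if a = b then 1 else 0 := by
    intro a d
    have := hinv y hy a d
    simpa [hon] using this
  -- Differentiate the identity c · Gram = 1 at y, where both factors are the identity: the
  -- derivative of c is minus that of the Gram matrix.
  have c1 : ∀ a d, fderiv ℝ (c a d) y v =
      - (u.repr (tanPart Γ f P y v (u a)) d + u.repr (tanPart Γ f P y v (u d)) a) := by
    intro a d
    have e : (fun y => ∑ b, c a b y * g (f y) (fderiv ℝ f y (u b)) (fderiv ℝ f y (u d)))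
        =ᶠ[nhds y] fun _ => if a = d then 1 else 0 := by
      filter_upwards [h.open_U.mem_nhds hy] with z hz using hinv z hz a d
    have hd : HasFDerivAt (fun y => ∑ b, c a b y * g (f y) (fderiv ℝ f y (u b))
        (fderiv ℝ f y (u d))) _ y := HasFDerivAt.fun_sum fun b _ =>
      (dc a b).hasFDerivAt.mul (h.differentiableAt_form h.smooth_g hy (u b) (u d)).hasFDerivAt
    have e2 := Filter.EventuallyEq.fderiv_eq (𝕜 := ℝ) e
    rw [hd.fderiv] at e2
    have e3 := congrArg (fun L : V →L[ℝ] ℝ => L v) e2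
    simp only [_root_.sum_apply, _root_.add_apply, _root_.smul_apply, smul_eq_mul,
      h.fderiv_metric hy, c0, hon] at e3
    have hx : ∀ x w, g (f y) (fderiv ℝ f y x) (fderiv ℝ f y (u w)) = u.repr x w := by
      intro x w
      conv_lhs => rw [← u.sum_repr x]
      simp only [map_sum, map_smul, _root_.sum_apply, _root_.smul_apply, smul_eq_mul, hon]
      simp
    have hx' : ∀ x w, g (f y) (fderiv ℝ f y (u w)) (fderiv ℝ f y x) = u.repr x w := by
      intro x w
      rw [h.symm_g _ (h.mapsTo hy), hx]
    simp [hx, hx', Finset.sum_add_distrib] at e3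
    linarith
  rw [covD_sum _ fun a _ => DifferentiableAt.fun_sum fun b _ => (dc a b).fun_smul (dA a b)]
  refine Finset.sum_congr rfl fun a _ => ?_
  rw [covD_sum _ fun b _ => (dc a b).fun_smul (dA a b)]
  refine Finset.sum_congr rfl fun b _ => ?_
  rw [covD_smul (dc a b) (dA a b), c0, c1]
  module

end IsImmersedIn
end Star

/-! ### The evolution identity for an immersion, at a point with an adapted frame. -/

section Evolution

variable {E V : Type*} [NormedAddCommGroup E] [NormedSpace ℝ E]
  [NormedAddCommGroup V] [NormedSpace ℝ V]

variable {Γ : E → E →L[ℝ] E →L[ℝ] E} {O : Set E} {g Ω : E → E →L[ℝ] E →L[ℝ] ℝ}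
  {U : Set V} {f : V → E} {P : V → E →L[ℝ] V}

theorem curv_sum_left {ι : Type*} [Fintype ι] (z a b : E) (c : ι → ℝ) (e : ι → E) :
    curv Γ z (∑ n, c n • e n) a b = ∑ n, c n • curv Γ z (e n) a b := by
  simp only [curv, map_sum, map_smul, _root_.sum_apply, _root_.smul_apply,
    ← Finset.sum_sub_distrib, ← Finset.sum_add_distrib, smul_sub, smul_add]

/-- An orthonormal frame at a point, positive for the Kähler form `Ω = ⟨J ·, ·⟩`. -/
structure IsKaehlerFrame (g Ω : E →L[ℝ] E →L[ℝ] ℝ) (J : E →L[ℝ] E) (e : Fin 4 → E) : Prop where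
  symm : ∀ v w, g v w = g w v
  form : ∀ v w, Ω v w = g (J v) w
  sq : ∀ v, J (J v) = -v
  orthogonal : ∀ v w, g (J v) (J w) = g v w
  orthonormal : ∀ a b, g (e a) (e b) = if a = b then 1 else 0
  expand : ∀ X, X = ∑ n, g X (e n) • e n
  compatible : 0 < Ω (e 0) (e 1) * Ω (e 2) (e 3) - Ω (e 0) (e 2) * Ω (e 1) (e 3)
    + Ω (e 0) (e 3) * Ω (e 1) (e 2)

namespace IsKaehlerFrame

variable {g Ω : E →L[ℝ] E →L[ℝ] ℝ} {J : E →L[ℝ] E} {e : Fin 4 → E}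
  (k : IsKaehlerFrame g Ω J e)
include k

theorem skew_J (v w : E) : g (J v) w = - g v (J w) := by
  rw [← k.orthogonal v (J w), k.sq]; simp

theorem skew (v w : E) : Ω v w = - Ω w v := by
  rw [k.form, k.form, k.skew_J, k.symm]

theorem self (v : E) : Ω v v = 0 := by linarith [k.skew v v]

theorem form_expand (X Y : E) : Ω X Y = ∑ m, ∑ n, g X (e m) * g Y (e n) * Ω (e m) (e n) := by
  conv_lhs => rw [k.expand X, k.expand Y]
  simp only [map_sum, map_smul, _root_.sum_apply, _root_.smul_apply, smul_eq_mul, Finset.mul_sum]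
  rw [Finset.sum_comm]
  exact Finset.sum_congr rfl fun m _ => Finset.sum_congr rfl fun n _ => by ring

/-- The a-th row of the matrix of Ω consists of the components of J (e a), and J is orthogonal. -/
theorem sum_form_mul (a b : Fin 4) :
    ∑ n, Ω (e a) (e n) * Ω (e b) (e n) = if a = b then 1 else 0 := by
  rw [← k.orthonormal, ← k.orthogonal]
  conv_rhs => rw [k.expand (J (e a))]
  simp only [map_sum, map_smul, _root_.sum_apply, _root_.smul_apply, smul_eq_mul, k.form]
  exact Finset.sum_congr rfl fun n _ => by rw [k.symm (e n)]

/-- The matrix of Ω is skew and orthogonal, and `compatible` is the positivity of its Pfaffian. -/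
theorem selfDual : Ω (e 2) (e 3) = Ω (e 0) (e 1) ∧ Ω (e 1) (e 3) = - Ω (e 0) (e 2) ∧
    Ω (e 1) (e 2) = Ω (e 0) (e 3) := by
  have s10 := k.skew (e 1) (e 0)
  have s20 := k.skew (e 2) (e 0)
  have s30 := k.skew (e 3) (e 0)
  have s21 := k.skew (e 2) (e 1)
  have s31 := k.skew (e 3) (e 1)
  have s32 := k.skew (e 3) (e 2)
  have S := k.sum_form_mul
  have h00 := S 0 0
  have h11 := S 1 1
  have h22 := S 2 2
  have h33 := S 3 3
  have h12 := S 1 2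
  have h13 := S 1 3
  have h23 := S 2 3
  simp only [Fin.sum_univ_four, k.self, s10, s20, s30, s21, s31, s32, Fin.reduceEq, if_true,
    if_false] at h00 h11 h22 h33 h12 h13 h23
  refine selfDual_of_skew_orthogonal (a := Ω (e 0) (e 1)) (b := Ω (e 0) (e 2))
    (c := Ω (e 0) (e 3)) ?_ ?_ ?_ ?_ ?_ ?_ ?_ k.compatible <;> linarith

theorem form_sq : Ω (e 0) (e 1) ^ 2 + Ω (e 0) (e 2) ^ 2 + Ω (e 0) (e 3) ^ 2 = 1 := by
  have := k.sum_form_mul 0 0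
  simp only [Fin.sum_univ_four, k.self] at this
  norm_num at this
  linarith

/-- The form in the frame, by means of its three independent components. -/
theorem form_eq (X Y : E) : Ω X Y =
    Ω (e 0) (e 1) * (g X (e 0) * g Y (e 1) - g X (e 1) * g Y (e 0)
      + g X (e 2) * g Y (e 3) - g X (e 3) * g Y (e 2))
    + Ω (e 0) (e 2) * (g X (e 0) * g Y (e 2) - g X (e 2) * g Y (e 0)
      - g X (e 1) * g Y (e 3) + g X (e 3) * g Y (e 1))
    + Ω (e 0) (e 3) * (g X (e 0) * g Y (e 3) - g X (e 3) * g Y (e 0)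
      + g X (e 1) * g Y (e 2) - g X (e 2) * g Y (e 1)) := by
  obtain ⟨h1, h2, h3⟩ := k.selfDual
  rw [k.form_expand]
  simp only [Fin.sum_univ_four, k.self, k.skew (e 1) (e 0), k.skew (e 2) (e 0),
    k.skew (e 3) (e 0), k.skew (e 2) (e 1), k.skew (e 3) (e 1), k.skew (e 3) (e 2), h1, h2, h3]
  ring

theorem inner_expand (X Y : E) : g X Y = ∑ n, g X (e n) * g Y (e n) := by
  conv_lhs => rw [k.expand X]
  simp only [map_sum, map_smul, _root_.sum_apply, _root_.smul_apply, smul_eq_mul]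
  exact Finset.sum_congr rfl fun n _ => by rw [k.symm (e n)]

end IsKaehlerFrame

/-- The Ricci term of the evolution equation in terms of the curvature operator of the tangent
plane. -/
theorem ricci_term (hO : IsOpen O) (hΓ : ContDiffOn ℝ ∞ Γ O)
    (hs : ∀ z ∈ O, ∀ a b, Γ z a b = Γ z b a) (hg : ContDiffOn ℝ ∞ g O)
    (hgs : ∀ z ∈ O, ∀ a b, g z a b = g z b a) (hpg : IsParallelOn Γ O g)
    (hΩ : ContDiffOn ℝ ∞ Ω O) (hp : IsParallelOn Γ O Ω) {z : E} (hz : z ∈ O)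
    {J : E →L[ℝ] E} {e : Fin 4 → E} (k : IsKaehlerFrame (g z) (Ω z) J e) :
    (1 - Ω z (e 0) (e 1) ^ 2) * ∑ i, g z (curv Γ z (e i) (J (e 0)) (e 1)) (e i) =
      (g z (curv Γ z (e 0) (e 1) (e 1)) (e 3) - g z (curv Γ z (e 0) (e 1) (e 0)) (e 2))
        * Ω z (e 0) (e 2)
      - (g z (curv Γ z (e 0) (e 1) (e 1)) (e 2) + g z (curv Γ z (e 0) (e 1) (e 0)) (e 3))
        * Ω z (e 0) (e 3) := by
  have hskΩ := hp.curv_skew hO hΓ hΩ hz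
  have hskg := hpg.curv_skew hO hΓ hg hz
  -- The curvature is skew for g and for Ω = g(J ·, ·), both being parallel; therefore it commutes
  -- with J.
  have hRJ : ∀ a b c d, g z (curv Γ z a b (J c)) d = - g z (curv Γ z a b c) (J d) := by
    intro a b c d
    have h1 := hskΩ a b c d
    rw [k.form, k.form, k.skew_J] at h1
    have h2 := hskg a b (J c) d
    linarith
  have key := sum_curvature_complex_structure (R := fun a b c d => g z (curv Γ z a b c) d)
    k.sq k.orthogonal k.symm k.orthonormal k.expand
    (fun a b c d => by simp only [curv_swap z a b c, map_neg, _root_.neg_apply])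
    (fun a b c d => by
      have := congrArg (fun x => g z x d) (curv_bianchi hO hΓ hs hz a b c)
      simpa using this)
    (fun a b c d => curv_pair_symm hO hΓ hs hg hgs hpg hz a b c d) hRJ
    (fun a b c d => by simp)
    (fun c a b d => by
      simp only [curv_sum_left, map_sum, map_smul, _root_.sum_apply, _root_.smul_apply,
        smul_eq_mul])
    (fun c a b d => by simp only [map_sum, map_smul, smul_eq_mul]) (e 0) (e 1)
  have hJe : ∀ X i, g z X (J (e i)) = Ω z (e i) X := fun X i => by rw [k.form, k.symm]
  simp only [hJe] at key
  have hsk : ∀ m n, g z (curv Γ z (e 0) (e 1) (e m)) (e n) =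
      - g z (curv Γ z (e 0) (e 1) (e n)) (e m) := by
    intro m n
    have h2 := hskg (e 0) (e 1) (e m) (e n)
    rw [k.symm (e m)] at h2
    linarith
  have hself : ∀ m, g z (curv Γ z (e 0) (e 1) (e m)) (e m) = 0 := fun m => by
    linarith [hsk m m]
  have c01 := hskΩ (e 0) (e 1) (e 0) (e 2)
  have c02 := hskΩ (e 0) (e 1) (e 0) (e 3)
  have hsq := k.form_sq
  have hform := k.form_eq
  generalize Ω z (e 0) (e 1) = x at *
  generalize Ω z (e 0) (e 2) = y at *
  generalize Ω z (e 0) (e 3) = w at *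
  simp only [hform, k.orthonormal, Fin.sum_univ_four] at key c01 c02
  simp only [hself, hsk 1 0, hsk 2 0, hsk 3 0, hsk 2 1, hsk 3 1, hsk 3 2] at key c01 c02
  rw [Fin.sum_univ_four] at *
  generalize g z (curv Γ z (e 0) (e 1) (e 0)) (e 1) = r01 at *
  generalize g z (curv Γ z (e 0) (e 1) (e 0)) (e 2) = r02 at *
  generalize g z (curv Γ z (e 0) (e 1) (e 0)) (e 3) = r03 at *
  generalize g z (curv Γ z (e 0) (e 1) (e 1)) (e 2) = r12 at *
  generalize g z (curv Γ z (e 0) (e 1) (e 1)) (e 3) = r13 at *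
  generalize g z (curv Γ z (e 0) (e 1) (e 2)) (e 3) = r23 at *
  simp only [Fin.reduceEq, if_true, if_false] at key c01 c02
  -- The self-dual part of R(e₀, e₁) is (r01 + r23, r02 - r13, r03 + r12). The relations `c01` and
  -- `c02` are two components of its proportionality to (x, y, w), `key` says that its inner product
  -- with (x, y, w) is minus the Ricci sum, and `hsq` that (x, y, w) is a unit vector.
  linear_combination (1 - x ^ 2) / 2 * key + x * (r01 + r23) * hsq + x * y * c02 - x * w * c01

/-- The left side is the time derivative of the star function under velocity H. It is compared with
the Laplacian written in the basis u, orthonormal at y. The functions c are the inverse Gram matrix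
of u, needed near y because H is differentiated. -/
theorem IsImmersedIn.evolution (h : IsImmersedIn Γ O g U f P)
    (hΩ : ContDiffOn ℝ ∞ Ω O) (hp : IsParallelOn Γ O Ω)
    (hsk : ∀ z ∈ O, ∀ v w, Ω z v w = - Ω z w v) (u : Module.Basis (Fin 2) ℝ V)
    (hdet : ∀ y ∈ U, 0 < gramDet g f u y) {c : Fin 2 → Fin 2 → V → ℝ}
    (hc : ∀ a b, ContDiffOn ℝ ∞ (c a b) U)
    (hinv : ∀ y ∈ U, ∀ a d, ∑ b, c a b y * g (f y) (fderiv ℝ f y (u b)) (fderiv ℝ f y (u d))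
      = if a = d then 1 else 0)
    {H : V → E} (hH : ∀ y ∈ U, H y = ∑ a, ∑ b, c a b y • normPart Γ f P (u a) (u b) y)
    {y : V} (hy : y ∈ U) {J : E →L[ℝ] E} {e : Fin 4 → E}
    (k : IsKaehlerFrame (g (f y)) (Ω (f y)) J e)
    (he0 : e 0 = fderiv ℝ f y (u 0)) (he1 : e 1 = fderiv ℝ f y (u 1))
    {h₃ h₄ : Fin 2 → Fin 2 → ℝ}
    (hh₃ : ∀ i j, h₃ i j = g (f y) (normPart Γ f P (u i) (u j) y) (e 2))
    (hh₄ : ∀ i j, h₄ i j = g (f y) (normPart Γ f P (u i) (u j) y) (e 3)) :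
    Ω (f y) (covD Γ f H (u 0) y) (e 1) + Ω (f y) (e 0) (covD Γ f H (u 1) y)
      - starFun g Ω f u y * (g (f y) (covD Γ f H (u 0) y) (e 0)
        + g (f y) (covD Γ f H (u 1) y) (e 1)) =
    (∑ a, (fderiv ℝ (fun y => fderiv ℝ (starFun g Ω f u) y (u a)) y (u a)
      - fderiv ℝ (starFun g Ω f u) y (tanPart Γ f P y (u a) (u a))))
    + starFun g Ω f u y * ∑ k, ((h₃ 0 k - h₄ 1 k) ^ 2 + (h₃ 1 k + h₄ 0 k) ^ 2)
    + (1 - starFun g Ω f u y ^ 2)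
      * ∑ i, g (f y) (curv Γ (f y) (e i) (J (e 0)) (e 1)) (e i) := by
  have hz := h.mapsTo hy
  have hon2 : ∀ a b, g (f y) (fderiv ℝ f y (u a)) (fderiv ℝ f y (u b))
      = if a = b then 1 else 0 := by
    have hh : ∀ a : Fin 2, fderiv ℝ f y (u a) = e (Fin.castLE (by norm_num) a) := by
      intro a; fin_cases a
      · exact he0.symm
      · exact he1.symm
    intro a b
    rw [hh, hh, k.orthonormal]
    simp [Fin.ext_iff]
  have hdet1 : gramDet g f u y = 1 := by simp [gramDet, hon2]
  have hstar : starFun g Ω f u y = Ω (f y) (e 0) (e 1) := by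
    simp [starFun, hdet1, he0, he1]
  have hcov : ∀ v, covD Γ f H v y = covD Γ f
      (fun y => ∑ a, ∑ b, c a b y • normPart Γ f P (u a) (u b) y) v y := fun v =>
    covD_congr (by filter_upwards [h.open_U.mem_nhds hy] with z hz using hH z hz) v
  have hric := ricci_term h.open_O h.smooth_Γ h.symm_Γ h.smooth_g h.symm_g h.parallel_g hΩ hp hz k
  have hf1 : ∀ v, fderiv ℝ (starFun g Ω f u) y v = starNum Γ Ω f P u v y := by
    intro v
    rw [h.fderiv_starFun hΩ hp hsk u hdet hy, hdet1]; simp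
  have hnu : ∀ n : Fin 4, n ≠ 0 → n ≠ 1 → ∀ x, g (f y) (fderiv ℝ f y x) (e n) = 0 := by
    intro n h0 h1 x
    rw [basis_two_expand u x]
    simp only [map_add, map_smul, ← he0, ← he1, _root_.add_apply, _root_.smul_apply,
      k.orthonormal, if_neg h0.symm, if_neg h1.symm]
    simp
  -- The time derivative contains ∇₀A(1,1) and ∇₁A(0,0), the Laplacian ∇₁A(0,1) and ∇₀A(0,1).
  -- Codazzi relates them, once for each of the normals e₂ and e₃.
  have C02 := h.codazzi hy (u 1) (u 0) (u 1) (hnu 2 (by decide) (by decide))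
  have C03 := h.codazzi hy (u 1) (u 0) (u 1) (hnu 3 (by decide) (by decide))
  have C12 := h.codazzi hy (u 0) (u 1) (u 0) (hnu 2 (by decide) (by decide))
  have C13 := h.codazzi hy (u 0) (u 1) (u 0) (hnu 3 (by decide) (by decide))
  have sA : ∀ y ∈ U, normPart Γ f P (u 1) (u 0) y = normPart Γ f P (u 0) (u 1) y :=
    fun y hy => h.normPart_symm hy _ _
  have sT : ∀ v, covD Γ f (normPart Γ f P (u 1) (u 0)) v y
      = covD Γ f (normPart Γ f P (u 0) (u 1)) v y := fun v =>
    covD_congr (by filter_upwards [h.open_U.mem_nhds hy] with z hz using sA z hz) v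
  have sG : tanPart Γ f P y (u 1) (u 0) = tanPart Γ f P y (u 0) (u 1) := by
    simp only [tanPart, h.hess_symm hy (u 1) (u 0)]
  have tA : ∀ a b x, g (f y) (normPart Γ f P (u a) (u b) y) (fderiv ℝ f y (u x)) = 0 :=
    fun a b x => h.normPart_orth hy _ _ _
  -- The tangential components of ∇A are products of second fundamental forms; they are the source
  -- of the quadratic terms.
  have tT : ∀ v a b x, g (f y) (covD Γ f (normPart Γ f P (u a) (u b)) (u v) y) (fderiv ℝ f y (u x))
      = - g (f y) (normPart Γ f P (u a) (u b) y) (normPart Γ f P (u v) (u x) y) := fun v a b x =>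
    h.covD_normal_tangential hy (h.differentiableAt_normPart hy _ _)
      (fun z hz x => h.normPart_orth hz _ _ _) _ _
  have hcov' : ∀ v, covD Γ f H v y = _ := fun v =>
    (hcov v).trans (h.covD_meanCurvature u hc hinv hy hon2 v)
  simp only [hric, hstar, hcov', h.fderiv_fderiv_starFun hΩ hp hsk u hdet hy hdet1,
    h.fderiv_starNum hΩ hp u hy, hf1, hess_eq (P := P), Fin.sum_univ_two, starNum, sA y hy, sT, sG]
  simp only [sT, sG] at C02 C03 C12 C13
  clear hf1 hcov hcov' hric hstar
  have e0 := basis_two_expand u (tanPart Γ f P y (u 0) (u 0))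
  have e1 := basis_two_expand u (tanPart Γ f P y (u 0) (u 1))
  have e2 := basis_two_expand u (tanPart Γ f P y (u 1) (u 1))
  generalize u.repr (tanPart Γ f P y (u 0) (u 0)) 0 = p0 at *
  generalize u.repr (tanPart Γ f P y (u 0) (u 0)) 1 = p1 at *
  generalize u.repr (tanPart Γ f P y (u 0) (u 1)) 0 = q0 at *
  generalize u.repr (tanPart Γ f P y (u 0) (u 1)) 1 = q1 at *
  generalize u.repr (tanPart Γ f P y (u 1) (u 1)) 0 = r0 at *
  generalize u.repr (tanPart Γ f P y (u 1) (u 1)) 1 = r1 at *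
  simp only [e0, e1, e2, normPart_add_left, normPart_smul_left, normPart_add_right,
    normPart_smul_right, map_add, map_smul, map_sub, _root_.add_apply, _root_.sub_apply,
    _root_.smul_apply, smul_eq_mul, sA y hy, ← he0, ← he1, ← hh₃, ← hh₄, curv_swap (f y) (e 0) (e 1),
    map_neg, _root_.neg_apply] at C02 C03 C12 C13 ⊢
  have tT0 : ∀ v a b, g (f y) (covD Γ f (normPart Γ f P (u a) (u b)) (u v) y) (e 0)
      = - (h₃ a b * h₃ v 0 + h₄ a b * h₄ v 0) := by
    intro v a b
    have := tT v a b 0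
    rw [k.inner_expand (normPart Γ f P (u a) (u b) y)] at this
    rw [he0, this]
    simp [Fin.sum_univ_four, hh₃, hh₄, he0, he1, tA]
  have tT1 : ∀ v a b, g (f y) (covD Γ f (normPart Γ f P (u a) (u b)) (u v) y) (e 1)
      = - (h₃ a b * h₃ v 1 + h₄ a b * h₄ v 1) := by
    intro v a b
    have := tT v a b 1
    rw [k.inner_expand (normPart Γ f P (u a) (u b) y)] at this
    rw [he1, this]
    simp [Fin.sum_univ_four, hh₃, hh₄, he0, he1, tA]
  have tA0 : ∀ a b, g (f y) (normPart Γ f P (u a) (u b) y) (e 0) = 0 := fun a b => by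
    rw [he0]; exact tA a b 0
  have tA1 : ∀ a b, g (f y) (normPart Γ f P (u a) (u b) y) (e 1) = 0 := fun a b => by
    rw [he1]; exact tA a b 1
  have s3 : h₃ 1 0 = h₃ 0 1 := by rw [hh₃, hh₃, sA y hy]
  have s4 : h₄ 1 0 = h₄ 0 1 := by rw [hh₄, hh₄, sA y hy]
  have hform := k.form_eq
  generalize Ω (f y) (e 0) (e 1) = x at *
  generalize Ω (f y) (e 0) (e 2) = w at *
  generalize Ω (f y) (e 0) (e 3) = z at *
  simp only [hform, k.orthonormal, tT0, tT1, tA0, tA1, ← hh₃, ← hh₄, s3, s4, Fin.reduceEq,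
    if_true, if_false, mul_zero, zero_mul, mul_one, one_mul, add_zero, zero_add, sub_zero, zero_sub]
  -- Self-duality gives Ω(e₀, ν) = w ν₂ + z ν₃ and Ω(ν, e₁) = w ν₃ - z ν₂ for normal ν. These are
  -- the weights of the normal components of ∇A, up to the sign convention in the four Codazzi
  -- equations.
  linear_combination z * C02 - w * C03 - w * C12 - z * C13

end Evolution

/-! ### Derivatives in time, up to the initial time. -/

section Time

variable {E V : Type*} [NormedAddCommGroup E] [NormedSpace ℝ E]
  [NormedAddCommGroup V] [NormedSpace ℝ V]

/-- Time and space derivatives commute. At an endpoint of I this is a statement about derivatives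
within I × U, whose second derivative is symmetric because every point of I lies in the closure of
the interior of I. -/
theorem hasDerivWithinAt_fderiv_of_family {I : Set ℝ} (hI : Convex ℝ I) (hI' : (interior I).Nonempty)
    {U : Set V} (hU : IsOpen U) {f : ℝ → V → E}
    (hf : ContDiffOn ℝ ∞ (fun q : ℝ × V => f q.1 q.2) (I ×ˢ U)) {t : ℝ} (ht : t ∈ I) {H : V → E}
    (hH : ∀ y ∈ U, HasDerivWithinAt (fun s => f s y) (H y) I t) {y : V} (hy : y ∈ U) :
    DifferentiableAt ℝ H y ∧
      ∀ v, HasDerivWithinAt (fun s => fderiv ℝ (f s) y v) (fderiv ℝ H y v) I t := by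
  set Φ : ℝ × V → E := fun q => f q.1 q.2 with hΦ
  set S : Set (ℝ × V) := I ×ˢ U with hS
  have uI : UniqueDiffOn ℝ I := uniqueDiffOn_convex hI hI'
  have uS : UniqueDiffOn ℝ S := uI.prod hU.uniqueDiffOn
  have hL : ContDiffOn ℝ ∞ (fderivWithin ℝ Φ S) S := hf.fderivWithin uS (by simp)
  have dΦ : ∀ q ∈ S, HasFDerivWithinAt Φ (fderivWithin ℝ Φ S q) S q := fun q hq =>
    ((hf q hq).differentiableWithinAt (by simp)).hasFDerivWithinAt
  -- Both partial derivatives are read off the joint derivative within S, applied to (0, v) here and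
  -- to (1, 0) in `hb`.
  have ha : ∀ s ∈ I, ∀ y ∈ U, ∀ v, fderiv ℝ (f s) y v = fderivWithin ℝ Φ S (s, y) (0, v) := by
    intro s hs y hy v
    have h1 : HasFDerivWithinAt (fun y : V => (s, y)) (ContinuousLinearMap.inr ℝ ℝ V) U y :=
      (hasFDerivAt_prodMk_right s y).hasFDerivWithinAt
    have h2 : HasFDerivWithinAt (f s) _ U y :=
      (dΦ (s, y) ⟨hs, hy⟩).comp y h1 (fun z hz => ⟨hs, hz⟩)
    rw [(h2.hasFDerivAt (hU.mem_nhds hy)).fderiv]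
    simp
  have hmk : ∀ y ∈ U, HasDerivWithinAt (fun s : ℝ => (s, y)) ((1 : ℝ), (0 : V)) I t := fun y _ =>
    ((hasDerivAt_id t).prodMk (hasDerivAt_const t y)).hasDerivWithinAt
  have hb : ∀ y ∈ U, H y = fderivWithin ℝ Φ S (t, y) (1, 0) := by
    intro y hy
    have h2 : HasDerivWithinAt (fun s => f s y) (fderivWithin ℝ Φ S (t, y) (1, 0)) I t :=
      HasFDerivWithinAt.comp_hasDerivWithinAt (l := Φ) (t := S) t (dΦ (t, y) ⟨ht, hy⟩) (hmk y hy)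
        (show MapsTo (fun s => (s, y)) I S from fun s hs => ⟨hs, hy⟩)
    exact (uI t ht).eq_deriv I (hH y hy) h2
  have hq : (t, y) ∈ S := ⟨ht, hy⟩
  have dL : HasFDerivWithinAt (fderivWithin ℝ Φ S) (fderivWithin ℝ (fderivWithin ℝ Φ S) S (t, y)) S
      (t, y) := ((hL _ hq).differentiableWithinAt (by simp)).hasFDerivWithinAt
  have sym : IsSymmSndFDerivWithinAt ℝ Φ S (t, y) := by
    refine (hf _ hq).isSymmSndFDerivWithinAt (n := ∞) ?_ uS ?_ hq
    · simpa [minSmoothness_of_isRCLikeNormedField] using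
        WithTop.coe_le_coe.2 (le_top (a := (2 : ℕ∞)))
    · rw [hS, interior_prod_eq, closure_prod_eq]
      refine ⟨?_, ?_⟩
      · rw [hI.closure_interior_eq_closure_of_nonempty_interior hI']
        exact subset_closure ht
      · rw [hU.interior_eq]; exact subset_closure hy
  have dH : HasFDerivAt H (((fderivWithin ℝ (fderivWithin ℝ Φ S) S (t, y)).comp
      (ContinuousLinearMap.inr ℝ ℝ V)).flip (1, 0)) y := by
    have h1 : HasFDerivWithinAt (fun y : V => (t, y)) (ContinuousLinearMap.inr ℝ ℝ V) U y :=
      (hasFDerivAt_prodMk_right t y).hasFDerivWithinAt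
    have h2 : HasFDerivWithinAt (fun y => fderivWithin ℝ Φ S (t, y)) _ U y :=
      dL.comp y h1 (fun z hz => ⟨ht, hz⟩)
    have h3 := ((h2.hasFDerivAt (hU.mem_nhds hy)).clm_apply
      (hasFDerivAt_const ((1 : ℝ), (0 : V)) y))
    have h4 : H =ᶠ[nhds y] fun y => fderivWithin ℝ Φ S (t, y) (1, 0) := by
      filter_upwards [hU.mem_nhds hy] with z hz using hb z hz
    refine (h3.congr_of_eventuallyEq h4).congr_fderiv ?_
    ext v
    simp
  refine ⟨dH.differentiableAt, fun v => ?_⟩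
  have h2 : HasDerivWithinAt (fun s => fderivWithin ℝ Φ S (s, y))
      (fderivWithin ℝ (fderivWithin ℝ Φ S) S (t, y) (1, 0)) I t :=
    dL.comp_hasDerivWithinAt t (hmk y hy)
        (show MapsTo (fun s => (s, y)) I S from fun s hs => ⟨hs, hy⟩)
  have h3 := h2.clm_apply (hasDerivWithinAt_const t I ((0 : ℝ), v))
  have h4 : HasDerivWithinAt (fun s => fderiv ℝ (f s) y v) _ I t :=
    h3.congr (fun s hs => ha s hs y hy v) (ha t ht y hy v)
  refine h4.congr_deriv ?_
  rw [dH.fderiv]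
  simp [sym.eq (1, 0) (0, v)]

variable {Γ : E → E →L[ℝ] E →L[ℝ] E} {O : Set E} {g Ω β : E → E →L[ℝ] E →L[ℝ] ℝ}

/-- The time derivative of f_*a is the ordinary derivative of H along a. Parallelism adds Γ(H,
f_*a), and symmetry of Γ turns this into the term that completes the covariant derivative of H. -/
theorem IsParallelOn.hasDerivWithinAt_form (hO : IsOpen O) (hβ : ContDiffOn ℝ ∞ β O)
    (hp : IsParallelOn Γ O β) (hs : ∀ z ∈ O, ∀ a b, Γ z a b = Γ z b a) {I : Set ℝ} {t : ℝ}
    {f : ℝ → V → E} {H : V → E} {y : V} (hy : f t y ∈ O)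
    (hf : HasDerivWithinAt (fun s => f s y) (H y) I t)
    (hf' : ∀ v, HasDerivWithinAt (fun s => fderiv ℝ (f s) y v) (fderiv ℝ H y v) I t) (a b : V) :
    HasDerivWithinAt (fun s => β (f s y) (fderiv ℝ (f s) y a) (fderiv ℝ (f s) y b))
      (β (f t y) (covD Γ (f t) H a y) (fderiv ℝ (f t) y b)
        + β (f t y) (fderiv ℝ (f t) y a) (covD Γ (f t) H b y)) I t := by
  have dβ : HasFDerivAt β (fderiv ℝ β (f t y)) (f t y) :=
    ((hβ.contDiffAt (hO.mem_nhds hy)).differentiableAt (by simp)).hasFDerivAt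
  have h1 : HasDerivWithinAt (fun s => β (f s y)) (fderiv ℝ β (f t y) (H y)) I t :=
    dβ.comp_hasDerivWithinAt t hf
  have h2 := (h1.clm_apply (hf' a)).clm_apply (hf' b)
  refine h2.congr_deriv ?_
  simp only [covD, map_add, _root_.add_apply]
  rw [hp _ hy, hs _ hy (H y), hs _ hy (H y)]
  ring

/-- The time derivative of `starFun` at a point where the coordinate fields are orthonormal. -/
theorem hasDerivWithinAt_starFun (hO : IsOpen O) (hs : ∀ z ∈ O, ∀ a b, Γ z a b = Γ z b a)
    (hg : ContDiffOn ℝ ∞ g O) (hpg : IsParallelOn Γ O g) (hgs : ∀ z ∈ O, ∀ a b, g z a b = g z b a)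
    (hΩ : ContDiffOn ℝ ∞ Ω O) (hp : IsParallelOn Γ O Ω) {I : Set ℝ} {t : ℝ}
    {f : ℝ → V → E} {H : V → E} {y : V} (hy : f t y ∈ O)
    (hf : HasDerivWithinAt (fun s => f s y) (H y) I t)
    (hf' : ∀ v, HasDerivWithinAt (fun s => fderiv ℝ (f s) y v) (fderiv ℝ H y v) I t)
    (u : Fin 2 → V)
    (hon : ∀ a b, g (f t y) (fderiv ℝ (f t) y (u a)) (fderiv ℝ (f t) y (u b))
      = if a = b then 1 else 0) :
    HasDerivWithinAt (fun s => starFun g Ω (f s) u y)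
      (Ω (f t y) (covD Γ (f t) H (u 0) y) (fderiv ℝ (f t) y (u 1))
        + Ω (f t y) (fderiv ℝ (f t) y (u 0)) (covD Γ (f t) H (u 1) y)
      - starFun g Ω (f t) u y * (g (f t y) (covD Γ (f t) H (u 0) y) (fderiv ℝ (f t) y (u 0))
        + g (f t y) (covD Γ (f t) H (u 1) y) (fderiv ℝ (f t) y (u 1)))) I t := by
  have hw := hp.hasDerivWithinAt_form hO hΩ hs hy hf hf' (u 0) (u 1)
  have d := hpg.hasDerivWithinAt_form hO hg hs hy hf hf'
  have hd : HasDerivWithinAt (fun s => gramDet g (f s) u y) _ I t :=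
    ((d (u 0) (u 0)).mul (d (u 1) (u 1))).sub ((d (u 0) (u 1)).pow 2)
  have h1 : gramDet g (f t) u y = 1 := by simp [gramDet, hon]
  have h2 : HasDerivWithinAt (fun s => starFun g Ω (f s) u y) _ I t :=
    hw.div (hd.sqrt (by rw [h1]; norm_num)) (by rw [h1]; norm_num)
  refine h2.congr_deriv ?_
  rw [h1]
  have h3 : starFun g Ω (f t) u y = Ω (f t y) (fderiv ℝ (f t) y (u 0)) (fderiv ℝ (f t) y (u 1)) := by
    simp [starFun, h1]
  rw [h3]
  simp only [hon, hgs _ hy (fderiv ℝ (f t) y (u 0)) (covD Γ (f t) H (u 0) y),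
    hgs _ hy (fderiv ℝ (f t) y (u 1)) (covD Γ (f t) H (u 1) y), zero_ne_one, if_true, if_false,
    Real.sqrt_one]
  push_cast
  ring

end Time

/-! ### From matrices and Christoffel symbols to bilinear maps on `Rn n`. -/

section Coordinates

variable {n : ℕ}

/-- The `i`-th vector of the standard basis. -/
abbrev bvec (n : ℕ) (i : Fin n) : Rn n := EuclideanSpace.single i 1

theorem sum_bvec (v : Rn n) : v = ∑ i, v i • bvec n i := by
  ext j
  simp [bvec, Finset.sum_apply, Pi.single_apply]

section Bilin

variable {W : Type*} [NormedAddCommGroup W] [NormedSpace ℝ W]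

/-- The bilinear map with the given values on pairs of vectors of the standard basis. -/
def bilinOf (c : Fin n → Fin n → W) : Rn n →L[ℝ] Rn n →L[ℝ] W :=
  ∑ i, ∑ j, (EuclideanSpace.proj i : Rn n →L[ℝ] ℝ).smulRight
    ((EuclideanSpace.proj j : Rn n →L[ℝ] ℝ).smulRight (c i j))

theorem bilinOf_apply (c : Fin n → Fin n → W) (v w : Rn n) :
    bilinOf c v w = ∑ i, ∑ j, (v i * w j) • c i j := by
  simp [bilinOf, smul_smul]

theorem bilinOf_bvec (c : Fin n → Fin n → W) (i j : Fin n) :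
    bilinOf c (bvec n i) (bvec n j) = c i j := by
  simp [bilinOf_apply, bvec, PiLp.single_apply]

/-- `bilinOf` as a linear map. -/
def bilinOfL : (Fin n → Fin n → W) →ₗ[ℝ] (Rn n →L[ℝ] Rn n →L[ℝ] W) where
  toFun := bilinOf
  map_add' c d := by
    ext v w; simp [bilinOf_apply, Finset.sum_add_distrib]
  map_smul' r c := by
    ext v w; simp [bilinOf_apply, Finset.smul_sum, smul_comm r]

variable [FiniteDimensional ℝ W] {X : Type*} [NormedAddCommGroup X] [NormedSpace ℝ X]

theorem contDiffOn_bilinOf {c : X → Fin n → Fin n → W} {s : Set X}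
    (hc : ∀ i j, ContDiffOn ℝ ∞ (fun z => c z i j) s) :
    ContDiffOn ℝ ∞ (fun z => bilinOf (c z)) s := by
  have h1 : ContDiffOn ℝ ∞ c s := contDiffOn_pi.2 fun i => contDiffOn_pi.2 fun j => hc i j
  exact ((LinearMap.toContinuousLinearMap (bilinOfL (n := n) (W := W))).contDiff).comp_contDiffOn h1

theorem fderiv_bilinOf {c : X → Fin n → Fin n → W} {z : X}
    (hc : ∀ i j, DifferentiableAt ℝ (fun z => c z i j) z) (v : X) :
    fderiv ℝ (fun z => bilinOf (c z)) z v = bilinOf fun i j => fderiv ℝ (fun z => c z i j) z v := by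
  have h1 : HasFDerivAt c (ContinuousLinearMap.pi fun i => ContinuousLinearMap.pi fun j =>
      fderiv ℝ (fun z => c z i j) z) z :=
    hasFDerivAt_pi.2 fun i => hasFDerivAt_pi.2 fun j => (hc i j).hasFDerivAt
  have h2 : HasFDerivAt (fun z => bilinOf (c z)) _ z :=
    (LinearMap.toContinuousLinearMap (bilinOfL (n := n) (W := W))).hasFDerivAt.comp z h1
  rw [h2.fderiv]
  rfl

end Bilin

theorem eq_zero_of_bvec {D : Rn n → ℝ} (hD : IsLinearMap ℝ D) (h : ∀ i, D (bvec n i) = 0)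
    (v : Rn n) : D v = 0 := by
  rw [sum_bvec v]
  change hD.mk' D _ = 0
  simp [h]

theorem contDiffOn_det {X : Type*} [NormedAddCommGroup X] [NormedSpace ℝ X] {s : Set X}
    {A : X → Matrix (Fin n) (Fin n) ℝ} (hA : ∀ i j, ContDiffOn ℝ ∞ (fun z => A z i j) s) :
    ContDiffOn ℝ ∞ (fun z => (A z).det) s := by
  simp only [Matrix.det_apply]
  exact ContDiffOn.sum fun σ _ => (contDiffOn_prod fun i _ => hA _ _).const_smul _

theorem contDiffOn_inv {X : Type*} [NormedAddCommGroup X] [NormedSpace ℝ X] {s : Set X}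
    {A : X → Matrix (Fin n) (Fin n) ℝ} (hA : ∀ i j, ContDiffOn ℝ ∞ (fun z => A z i j) s)
    (hdet : ∀ z ∈ s, (A z).det ≠ 0) (i j : Fin n) : ContDiffOn ℝ ∞ (fun z => (A z)⁻¹ i j) s := by
  simp only [Matrix.inv_def, Matrix.smul_apply, Ring.inverse_eq_inv', smul_eq_mul,
    Matrix.adjugate_apply]
  refine ((contDiffOn_det hA).inv hdet).mul (contDiffOn_det fun a b => ?_)
  by_cases h : a = j
  · subst h; simpa using contDiffOn_const
  · simpa [Matrix.updateRow_ne h] using hA a b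

/-- A nonzero kernel vector x would give B x x = 0. -/
theorem isUnit_det_of_pos {B : Rn n →L[ℝ] Rn n →L[ℝ] ℝ} (hB : ∀ v, v ≠ 0 → 0 < B v v)
    {A : Matrix (Fin n) (Fin n) ℝ} (hA : ∀ i j, A i j = B (bvec n i) (bvec n j)) :
    IsUnit A.det := by
  rw [← Matrix.isUnit_iff_isUnit_det, ← Matrix.mulVec_injective_iff_isUnit]
  rw [← Matrix.coe_mulVecLin, ← LinearMap.ker_eq_bot, LinearMap.ker_eq_bot']
  intro x hx
  by_contra hne
  have h1 : (WithLp.toLp 2 x : Rn n) ≠ 0 := by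
    intro h; apply hne; simpa using h
  have h2 := hB _ h1
  have h3 : B (WithLp.toLp 2 x) (WithLp.toLp 2 x) = ∑ i, x i * (A.mulVec x) i := by
    conv_lhs => rw [sum_bvec (WithLp.toLp 2 x : Rn n)]
    simp only [map_sum, map_smul, _root_.sum_apply, _root_.smul_apply, smul_eq_mul, ← hA,
      Matrix.mulVec, dotProduct]
    simp only [Finset.mul_sum]
    rw [Finset.sum_comm]
    exact Finset.sum_congr rfl fun i _ => Finset.sum_congr rfl fun j _ => by ring
  rw [Matrix.mulVecLin_apply] at hx
  rw [h3, hx] at h2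
  simp at h2

variable {G : Rn n → Matrix (Fin n) (Fin n) ℝ} {O : Set (Rn n)}

/-- The bilinear form with the given matrix. -/
abbrev matForm (M : Matrix (Fin n) (Fin n) ℝ) : Rn n →L[ℝ] Rn n →L[ℝ] ℝ :=
  bilinOf fun i j => M i j

theorem dotG_eq (M : Matrix (Fin n) (Fin n) ℝ) (v w : Rn n) : dotG M v w = matForm M v w := by
  simp only [dotG, bilinOf_apply, smul_eq_mul]
  exact Finset.sum_congr rfl fun i _ => Finset.sum_congr rfl fun j _ => by ring

/-- The Christoffel symbols as a bilinear map. -/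
def chrMap (G : Rn n → Matrix (Fin n) (Fin n) ℝ) (z : Rn n) : Rn n →L[ℝ] Rn n →L[ℝ] Rn n :=
  bilinOf fun i j => WithLp.toLp 2 fun k => christoffel G k i j z

theorem chrMap_bvec (i j k : Fin n) (z : Rn n) :
    chrMap G z (bvec n i) (bvec n j) k = christoffel G k i j z := by
  rw [chrMap, bilinOf_bvec]

theorem contDiffOn_pd (hO : IsOpen O) {W : Type*} [NormedAddCommGroup W] [NormedSpace ℝ W]
    {u : Rn n → W} (hu : ContDiffOn ℝ ∞ u O) (i : Fin n) : ContDiffOn ℝ ∞ (pd i u) O :=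
  (hu.fderiv_of_isOpen hO (by simp)).clm_apply contDiffOn_const

theorem contDiffOn_christoffel (hO : IsOpen O) (hG : ∀ i j, ContDiffOn ℝ ∞ (fun z => G z i j) O)
    (hdet : ∀ z ∈ O, IsUnit (G z).det) (k i j : Fin n) :
    ContDiffOn ℝ ∞ (christoffel G k i j) O := by
  unfold christoffel
  refine contDiffOn_const.mul (ContDiffOn.sum fun l _ => ?_)
  exact (contDiffOn_inv hG (fun z hz => (hdet z hz).ne_zero) k l).mul
    (((contDiffOn_pd hO (hG _ _) _).add (contDiffOn_pd hO (hG _ _) _)).sub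
      (contDiffOn_pd hO (hG _ _) _))

theorem contDiffOn_chrMap (hO : IsOpen O) (hG : ∀ i j, ContDiffOn ℝ ∞ (fun z => G z i j) O)
    (hdet : ∀ z ∈ O, IsUnit (G z).det) : ContDiffOn ℝ ∞ (chrMap G) O :=
  contDiffOn_bilinOf fun i j => (contDiffOn_piLp 2).2 fun k =>
    contDiffOn_christoffel hO hG hdet k i j

theorem pd_symm (hO : IsOpen O) (hs : ∀ z ∈ O, ∀ i j, G z i j = G z j i) {z : Rn n} (hz : z ∈ O)
    (l i j : Fin n) : pd l (fun z => G z i j) z = pd l (fun z => G z j i) z := by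
  have : (fun z => G z i j) =ᶠ[nhds z] fun z => G z j i := by
    filter_upwards [hO.mem_nhds hz] with w hw using hs w hw i j
  simp only [pd, this.fderiv_eq]

theorem christoffel_symm (hO : IsOpen O) (hs : ∀ z ∈ O, ∀ i j, G z i j = G z j i) {z : Rn n}
    (hz : z ∈ O) (k i j : Fin n) : christoffel G k i j z = christoffel G k j i z := by
  simp only [christoffel, pd_symm hO hs hz _ i j]
  congr 1
  exact Finset.sum_congr rfl fun l _ => by ring

theorem chrMap_symm (hO : IsOpen O) (hs : ∀ z ∈ O, ∀ i j, G z i j = G z j i) {z : Rn n}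
    (hz : z ∈ O) (a b : Rn n) : chrMap G z a b = chrMap G z b a := by
  simp only [chrMap, bilinOf_apply]
  rw [Finset.sum_comm]
  refine Finset.sum_congr rfl fun i _ => Finset.sum_congr rfl fun j _ => ?_
  rw [mul_comm]
  congr 2
  funext k
  exact christoffel_symm hO hs hz k j i

/-- Lowering the upper index of the Christoffel symbols. -/
theorem sum_mul_christoffel {z : Rn n} (hdet : IsUnit (G z).det) (i j b : Fin n) :
    ∑ d, G z b d * christoffel G d i j z = (1 / 2) *
      (pd i (fun z => G z j b) z + pd j (fun z => G z i b) z - pd b (fun z => G z i j) z) := by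
  have h := Matrix.mul_nonsing_inv (G z) hdet
  simp only [christoffel]
  have : ∀ d, G z b d * ((1 / 2) * ∑ l, (G z)⁻¹ d l *
      (pd i (fun z => G z j l) z + pd j (fun z => G z i l) z - pd l (fun z => G z i j) z)) =
      (1 / 2) * ∑ l, (G z b d * (G z)⁻¹ d l) *
      (pd i (fun z => G z j l) z + pd j (fun z => G z i l) z - pd l (fun z => G z i j) z) := by
    intro d
    rw [mul_left_comm, Finset.mul_sum]
    congr 1
    exact Finset.sum_congr rfl fun l _ => by ring
  simp only [this, ← Finset.mul_sum]
  congr 1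
  rw [Finset.sum_comm]
  simp only [← Finset.sum_mul, ← Matrix.mul_apply, h, Matrix.one_apply]
  simp

/-- The coordinate equation is the parallel condition on basis vectors; the condition is linear in
each of its three arguments. -/
theorem isParallelOn_of_coord (hO : IsOpen O) {B : Rn n → Matrix (Fin n) (Fin n) ℝ}
    (hB : ∀ i j, ContDiffOn ℝ ∞ (fun z => B z i j) O)
    (h : ∀ z ∈ O, ∀ a b c : Fin n, pd c (fun z => B z a b) z
      - ∑ d, christoffel G d c a z * B z d b - ∑ d, christoffel G d c b z * B z a d = 0) :
    IsParallelOn (chrMap G) O (fun z => matForm (B z)) := by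
  intro z hz
  have key : ∀ c a b : Fin n, fderiv ℝ (fun z => matForm (B z)) z (bvec n c) (bvec n a) (bvec n b)
      - (matForm (B z) (chrMap G z (bvec n c) (bvec n a)) (bvec n b)
        + matForm (B z) (bvec n a) (chrMap G z (bvec n c) (bvec n b))) = 0 := by
    intro c a b
    rw [fderiv_bilinOf fun i j =>
      ((hB i j).contDiffAt (hO.mem_nhds hz)).differentiableAt (by simp), bilinOf_bvec]
    have h1 := h z hz a b c
    have h2 : ∀ v (b : Fin n), matForm (B z) v (bvec n b) = ∑ d, v d * B z d b := by
      intro v b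
      simp [bilinOf_apply, bvec, PiLp.single_apply]
    have h3 : ∀ v (a : Fin n), matForm (B z) (bvec n a) v = ∑ d, v d * B z a d := by
      intro v b
      simp [bilinOf_apply, bvec, PiLp.single_apply]
    rw [h2, h3]
    simp only [chrMap_bvec]
    simp only [pd] at h1
    linarith
  intro c a b
  rw [← sub_eq_zero]
  refine eq_zero_of_bvec (D := fun b => fderiv ℝ (fun z => matForm (B z)) z c a b
      - (matForm (B z) (chrMap G z c a) b + matForm (B z) a (chrMap G z c b)))
    ⟨fun x y => by simp only [map_add]; ring, fun r x => by
      simp only [map_smul, smul_eq_mul]; ring⟩ (fun b => ?_) b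
  refine eq_zero_of_bvec (D := fun a => fderiv ℝ (fun z => matForm (B z)) z c a (bvec n b)
      - (matForm (B z) (chrMap G z c a) (bvec n b) + matForm (B z) a (chrMap G z c (bvec n b))))
    ⟨fun x y => by simp only [map_add, _root_.add_apply]; ring, fun r x => by
      simp only [map_smul, _root_.smul_apply, smul_eq_mul]; ring⟩ (fun a => ?_) a
  exact eq_zero_of_bvec (D := fun c => fderiv ℝ (fun z => matForm (B z)) z c (bvec n a) (bvec n b)
      - (matForm (B z) (chrMap G z c (bvec n a)) (bvec n b)
        + matForm (B z) (bvec n a) (chrMap G z c (bvec n b))))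
    ⟨fun x y => by simp only [map_add, _root_.add_apply]; ring, fun r x => by
      simp only [map_smul, _root_.smul_apply, smul_eq_mul]; ring⟩ (fun c => key c a b) c

/-- With the upper index lowered, the sum of the two Christoffel terms is the derivative of the
metric coefficient, the other derivatives cancelling by symmetry. -/
theorem isParallelOn_metric (hO : IsOpen O) (hG : ∀ i j, ContDiffOn ℝ ∞ (fun z => G z i j) O)
    (hs : ∀ z ∈ O, ∀ i j, G z i j = G z j i) (hdet : ∀ z ∈ O, IsUnit (G z).det) :
    IsParallelOn (chrMap G) O (fun z => matForm (G z)) := by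
  refine isParallelOn_of_coord hO hG fun z hz a b c => ?_
  have h1 : ∑ d, christoffel G d c a z * G z d b = ∑ d, G z b d * christoffel G d c a z :=
    Finset.sum_congr rfl fun d _ => by rw [hs z hz d b, mul_comm]
  have h2 : ∑ d, christoffel G d c b z * G z a d = ∑ d, G z a d * christoffel G d c b z :=
    Finset.sum_congr rfl fun d _ => by rw [mul_comm]
  rw [h1, h2, sum_mul_christoffel (hdet z hz), sum_mul_christoffel (hdet z hz),
    pd_symm hO hs hz c b a, pd_symm hO hs hz b c a, pd_symm hO hs hz a c b]
  ring

theorem curv_chrMap_bvec (hO : IsOpen O) (hG : ∀ i j, ContDiffOn ℝ ∞ (fun z => G z i j) O)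
    (hdet : ∀ z ∈ O, IsUnit (G z).det) {z : Rn n} (hz : z ∈ O) (l i j k : Fin n) :
    curv (chrMap G) z (bvec n i) (bvec n j) (bvec n k) l = riemannCoeff G l i j k z := by
  have dΓ : ∀ i j k, DifferentiableAt ℝ (christoffel G k i j) z := fun i j k =>
    ((contDiffOn_christoffel hO hG hdet k i j).contDiffAt (hO.mem_nhds hz)).differentiableAt
      (by simp)
  have d1 : ∀ i j k, fderiv ℝ (chrMap G) z (bvec n i) (bvec n j) (bvec n k) l
      = pd i (christoffel G l j k) z := by
    intro i j k
    have h1 : ∀ j k, HasFDerivAt (fun z => (WithLp.toLp 2 fun l => christoffel G l j k z : Rn n))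
        ((PiLp.continuousLinearEquiv 2 ℝ (fun _ : Fin n => ℝ)).symm.toContinuousLinearMap.comp
          (ContinuousLinearMap.pi fun l => fderiv ℝ (christoffel G l j k) z)) z := by
      intro j k
      exact (PiLp.continuousLinearEquiv 2 ℝ (fun _ : Fin n => ℝ)).symm.toContinuousLinearMap.hasFDerivAt.comp
        z (hasFDerivAt_pi.2 fun l => (dΓ j k l).hasFDerivAt)
    have h2 : chrMap G = fun z => bilinOf fun i j => (WithLp.toLp 2 fun k => christoffel G k i j z : Rn n) := rfl
    rw [h2, fderiv_bilinOf fun i j => (h1 i j).differentiableAt, bilinOf_bvec, (h1 j k).fderiv]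
    rfl
  have h3 : ∀ (i : Fin n) (v : Rn n), chrMap G z (bvec n i) v l
      = ∑ p, christoffel G l i p z * v p := by
    intro i v
    conv_lhs => rw [sum_bvec v]
    simp only [map_sum, map_smul]
    rw [WithLp.ofLp_sum, Finset.sum_apply]
    refine Finset.sum_congr rfl fun p _ => ?_
    rw [PiLp.smul_apply, chrMap_bvec, smul_eq_mul, mul_comm]
  simp only [curv, riemannCoeff, PiLp.add_apply, PiLp.sub_apply, d1, h3, chrMap_bvec]
  rw [Finset.sum_sub_distrib]
  ring

end Coordinates

/-! ### Smoothness and chart expressions of tensors on manifolds. -/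

section Charts

variable {n : ℕ} {M : Type*} [TopologicalSpace M] [ChartedSpace (Rn n) M] [IsManifold (𝓡 n) ∞ M]
  {φ : OpenPartialHomeomorph M (Rn n)}

theorem mdifferentiable_chart (hφ : φ ∈ atlas (Rn n) M) : φ.MDifferentiable (𝓡 n) (𝓡 n) :=
  mdifferentiable_of_mem_atlas hφ

theorem mfderiv_symm_vecCoord (hφ : φ ∈ atlas (Rn n) M) {x : M} (hx : x ∈ φ.source)
    (v : TangentSpace (𝓡 n) x) :
    (mfderiv 𝓘(ℝ, Rn n) (𝓡 n) φ.symm (φ x) (vecCoord φ x v) : Rn n) = v :=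
  congrArg (fun L => L v) ((mdifferentiable_chart hφ).symm_comp_deriv hx)

theorem vecCoord_mfderiv_symm (hφ : φ ∈ atlas (Rn n) M) {y : Rn n} (hy : y ∈ φ.target)
    (v : Rn n) :
    vecCoord φ (φ.symm y) (mfderiv 𝓘(ℝ, Rn n) (𝓡 n) φ.symm y v) = v :=
  congrArg (fun L => L v) ((mdifferentiable_chart hφ).comp_symm_deriv hy)

/-- The field is the tangent map of the inverse chart applied to a constant section. -/
theorem contMDiffOn_coordField (hφ : φ ∈ atlas (Rn n) M) (v : Rn n) :
    ContMDiffOn 𝓘(ℝ, Rn n) ((𝓡 n).prod 𝓘(ℝ, Rn n)) ∞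
      (fun y => Bundle.TotalSpace.mk' (Rn n) (E := fun x : M => TangentSpace (𝓡 n) x)
        (φ.symm y) (mfderiv 𝓘(ℝ, Rn n) (𝓡 n) φ.symm y v)) φ.target := by
  have h1 : ContMDiffOn 𝓘(ℝ, Rn n) (𝓡 n) ∞ φ.symm φ.target :=
    contMDiffOn_symm_of_mem_maximalAtlas (IsManifold.subset_maximalAtlas hφ)
  have h2 := h1.contMDiffOn_tangentMapWithin (m := ∞) (by simp) φ.open_target.uniqueMDiffOn
  have h3 : ContMDiff 𝓘(ℝ, Rn n) (𝓘(ℝ, Rn n).prod 𝓘(ℝ, Rn n)) ∞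
      (fun y : Rn n => (Bundle.TotalSpace.mk' (Rn n)
        (E := fun x : Rn n => TangentSpace 𝓘(ℝ, Rn n) x) y v : TangentBundle 𝓘(ℝ, Rn n) (Rn n))) :=
    (contMDiff_vectorSpace_iff_contDiff (V := fun _ => v)).2 contDiff_const
  have h4 := h2.comp (h3.contMDiffOn (s := φ.target)) (fun y hy => hy)
  refine h4.congr fun y hy => ?_
  simp only [Function.comp, tangentMapWithin]
  rw [mfderivWithin_of_isOpen φ.open_target hy]

/-- Applying a smooth field of bilinear forms to smooth fields along the inverse of a chart. -/
theorem contDiffOn_bilin_fields (hφ : φ ∈ atlas (Rn n) M)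
    {B : ∀ x : M, TangentSpace (𝓡 n) x →L[ℝ] TangentSpace (𝓡 n) x →L[ℝ] ℝ}
    (hB : ContMDiff (𝓡 n) ((𝓡 n).prod 𝓘(ℝ, Rn n →L[ℝ] Rn n →L[ℝ] ℝ)) ∞
      (fun x => Bundle.TotalSpace.mk' (Rn n →L[ℝ] Rn n →L[ℝ] ℝ)
      (E := fun x : M => TangentSpace (𝓡 n) x →L[ℝ] TangentSpace (𝓡 n) x →L[ℝ] ℝ) x (B x)))
    {X Y : ∀ y : Rn n, TangentSpace (𝓡 n) (φ.symm y)}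
    (hX : ContMDiffOn 𝓘(ℝ, Rn n) ((𝓡 n).prod 𝓘(ℝ, Rn n)) ∞
      (fun y => Bundle.TotalSpace.mk' (Rn n) (E := fun x : M => TangentSpace (𝓡 n) x)
        (φ.symm y) (X y)) φ.target)
    (hY : ContMDiffOn 𝓘(ℝ, Rn n) ((𝓡 n).prod 𝓘(ℝ, Rn n)) ∞
      (fun y => Bundle.TotalSpace.mk' (Rn n) (E := fun x : M => TangentSpace (𝓡 n) x)
        (φ.symm y) (Y y)) φ.target) :
    ContDiffOn ℝ ∞ (fun y => B (φ.symm y) (X y) (Y y)) φ.target := by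
  have h1 : ContMDiffOn 𝓘(ℝ, Rn n) (𝓡 n) ∞ φ.symm φ.target :=
    contMDiffOn_symm_of_mem_maximalAtlas (IsManifold.subset_maximalAtlas hφ)
  have h2 := hB.comp_contMDiffOn h1
  have h3 := ContMDiffOn.clm_bundle_apply₂ (F₁ := Rn n) (F₂ := Rn n) (F₃ := ℝ)
    (E₁ := fun x : M => TangentSpace (𝓡 n) x) (E₂ := fun x : M => TangentSpace (𝓡 n) x)
    (E₃ := Bundle.Trivial M ℝ) (b := φ.symm) h2 hX hY
  rw [← contMDiffOn_iff_contDiffOn]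
  intro y hy
  have h4 := h3 y hy
  rw [Bundle.contMDiffWithinAt_totalSpace] at h4
  exact h4.2

theorem contDiffOn_coeff_metric (hφ : φ ∈ atlas (Rn n) M) (g : Metric n M) (a b : Fin n) :
    ContDiffOn ℝ ∞ (fun y => coeff g.tensor φ y a b) φ.target :=
  contDiffOn_bilin_fields hφ g.contMDiff (contMDiffOn_coordField hφ _)
    (contMDiffOn_coordField hφ _)

theorem contDiffOn_coeff_kaehlerForm (hφ : φ ∈ atlas (Rn n) M) (g : Metric n M)
    {J : ∀ x : M, TangentSpace (𝓡 n) x →L[ℝ] TangentSpace (𝓡 n) x} (hJ : IsKaehler g J)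
    (a b : Fin n) :
    ContDiffOn ℝ ∞ (fun y => coeff (kaehlerForm g J) φ y a b) φ.target := by
  have h1 : ContMDiffOn 𝓘(ℝ, Rn n) (𝓡 n) ∞ φ.symm φ.target :=
    contMDiffOn_symm_of_mem_maximalAtlas (IsManifold.subset_maximalAtlas hφ)
  exact contDiffOn_bilin_fields hφ g.contMDiff
    (ContMDiffOn.clm_bundle_apply (F₁ := Rn n) (F₂ := Rn n)
      (E₁ := fun x : M => TangentSpace (𝓡 n) x) (E₂ := fun x : M => TangentSpace (𝓡 n) x)
      (b := φ.symm) (hJ.smooth.comp_contMDiffOn h1) (contMDiffOn_coordField hφ _))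
    (contMDiffOn_coordField hφ _)

/-- A field of bilinear forms in a chart. -/
theorem tensor_eq_matForm (hφ : φ ∈ atlas (Rn n) M)
    (B : ∀ x : M, TangentSpace (𝓡 n) x →L[ℝ] TangentSpace (𝓡 n) x →L[ℝ] ℝ) {x : M}
    (hx : x ∈ φ.source) (v w : TangentSpace (𝓡 n) x) :
    B x v w = matForm (coeff (fun x v w => B x v w) φ (φ x)) (vecCoord φ x v) (vecCoord φ x w) := by
  -- All tangent spaces are the same model space, so the base point φ.symm (φ x) can be replaced by
  -- x without transporting vectors.
  have h1 : ∀ x', x' = x → ∀ v' w' : Rn n, B x' v' w' = B x v' w' := by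
    rintro _ rfl v' w'; rfl
  have h2 : ∀ v' w' : Rn n, matForm (coeff (fun x v w => B x v w) φ (φ x)) v' w' =
      B (φ.symm (φ x)) (mfderiv 𝓘(ℝ, Rn n) (𝓡 n) φ.symm (φ x) v')
        (mfderiv 𝓘(ℝ, Rn n) (𝓡 n) φ.symm (φ x) w') := by
    intro v' w'
    set D : Rn n →L[ℝ] TangentSpace (𝓡 n) (φ.symm (φ x)) :=
      mfderiv 𝓘(ℝ, Rn n) (𝓡 n) φ.symm (φ x) with hD
    have h3 : B (φ.symm (φ x)) (D v') (D w') =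
        ∑ i, ∑ j, (v' i * w' j) * B (φ.symm (φ x)) (D (bvec n i)) (D (bvec n j)) := by
      conv_lhs => rw [sum_bvec v', sum_bvec w']
      simp only [map_sum, map_smul, _root_.sum_apply, _root_.smul_apply, smul_eq_mul,
        Finset.mul_sum]
      rw [Finset.sum_comm]
      exact Finset.sum_congr rfl fun i _ => Finset.sum_congr rfl fun j _ => by ring
    refine Eq.trans ?_ h3.symm
    rw [bilinOf_apply]
    rfl
  exact (((h2 _ _).trans (h1 _ (φ.left_inv hx) _ _)).trans
    (congrArg₂ (fun a b : Rn n => B x a b) (mfderiv_symm_vecCoord hφ hx v)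
      (mfderiv_symm_vecCoord hφ hx w))).symm

end Charts

/-! ### The chain rule for maps read in charts. -/

section Maps

variable {k n : ℕ} {S : Type*} [TopologicalSpace S] [ChartedSpace (Rn k) S]
  [IsManifold (𝓡 k) ∞ S] {M : Type*} [TopologicalSpace M] [ChartedSpace (Rn n) M]
  [IsManifold (𝓡 n) ∞ M] {ψ : OpenPartialHomeomorph S (Rn k)} {φ : OpenPartialHomeomorph M (Rn n)}
  {f : S → M}

theorem vecCoord_mfderiv (hψ : ψ ∈ atlas (Rn k) S) (hφ : φ ∈ atlas (Rn n) M) {x : S}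
    (hx : x ∈ ψ.source) (hfx : f x ∈ φ.source) (hf : MDifferentiableAt (𝓡 k) (𝓡 n) f x)
    (v : TangentSpace (𝓡 k) x) :
    vecCoord φ (f x) (mfderiv (𝓡 k) (𝓡 n) f x v) =
      fderiv ℝ (localMap f ψ φ) (ψ x) (vecCoord ψ x v) := by
  have h1 : MDifferentiableAt (𝓡 n) 𝓘(ℝ, Rn n) φ (f x) :=
    (mdifferentiable_chart hφ).mdifferentiableAt hfx
  have h2 : MDifferentiableAt 𝓘(ℝ, Rn k) (𝓡 k) ψ.symm (ψ x) :=
    (mdifferentiable_chart hψ).symm.mdifferentiableAt (ψ.map_source hx)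
  have e : ψ.symm (ψ x) = x := ψ.left_inv hx
  have h3 : HasMFDerivAt (𝓡 k) 𝓘(ℝ, Rn n) (φ ∘ f) x
      ((mfderiv (𝓡 n) 𝓘(ℝ, Rn n) φ (f x)).comp (mfderiv (𝓡 k) (𝓡 n) f x)) :=
    h1.hasMFDerivAt.comp x hf.hasMFDerivAt
  have h4 : MDifferentiableAt (𝓡 k) 𝓘(ℝ, Rn n) (φ ∘ f) (ψ.symm (ψ x)) := by
    rw [e]; exact h3.mdifferentiableAt
  have h5 : DifferentiableAt ℝ (localMap f ψ φ) (ψ x) :=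
    (MDifferentiableAt.comp (ψ x) h4 h2 :
      MDifferentiableAt 𝓘(ℝ, Rn k) 𝓘(ℝ, Rn n) ((φ ∘ f) ∘ ψ.symm) (ψ x)).differentiableAt
  have h6 : HasMFDerivAt 𝓘(ℝ, Rn k) 𝓘(ℝ, Rn n) (localMap f ψ φ) (ψ x)
      (fderiv ℝ (localMap f ψ φ) (ψ x)) := h5.hasFDerivAt.hasMFDerivAt
  have h7 : HasMFDerivAt (𝓡 k) 𝓘(ℝ, Rn k) ψ x (mfderiv (𝓡 k) 𝓘(ℝ, Rn k) ψ x) :=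
    ((mdifferentiable_chart hψ).mdifferentiableAt hx).hasMFDerivAt
  have h8 := h6.comp x h7
  have h9 : φ ∘ f =ᶠ[nhds x] localMap f ψ φ ∘ ψ := by
    filter_upwards [ψ.open_source.mem_nhds hx] with z hz
    simp [localMap, ψ.left_inv hz]
  have h10 := h8.congr_of_eventuallyEq h9
  have h11 := hasMFDerivAt_unique h3 h10
  exact congrArg (fun L => L v) h11

end Maps

/-! ### The tangential projection and the induced connection from the Gram matrix. -/

section Gram

variable {k n : ℕ} {G : Rn n → Matrix (Fin n) (Fin n) ℝ} {O : Set (Rn n)}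
  {A : Rn k → Matrix (Fin k) (Fin k) ℝ} {f : Rn k → Rn n} {U : Set (Rn k)}

/-- The tangential projection of an immersion `f` with Gram matrix `A`. -/
def tanProj (G : Rn n → Matrix (Fin n) (Fin n) ℝ) (A : Rn k → Matrix (Fin k) (Fin k) ℝ)
    (f : Rn k → Rn n) (y : Rn k) : Rn n →L[ℝ] Rn k :=
  ∑ p, ∑ q, (A y)⁻¹ p q • ((matForm (G (f y))).flip (pd p f y)).smulRight (bvec k q)

theorem tanProj_apply (y : Rn k) (X : Rn n) : tanProj G A f y X =
    ∑ p, ∑ q, ((A y)⁻¹ p q * matForm (G (f y)) X (pd p f y)) • bvec k q := by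
  simp only [tanProj, _root_.sum_apply, _root_.smul_apply, ContinuousLinearMap.smulRight_apply,
    ContinuousLinearMap.flip_apply, smul_smul]

/-- The metric with matrix `G` on `O`, an immersion `f` of `U` into `O`, and the Gram matrix `A` of
its coordinate fields. -/
structure IsGramData (G : Rn n → Matrix (Fin n) (Fin n) ℝ) (O : Set (Rn n))
    (A : Rn k → Matrix (Fin k) (Fin k) ℝ) (f : Rn k → Rn n) (U : Set (Rn k)) : Prop where
  open_O : IsOpen O
  smooth_G : ∀ i j, ContDiffOn ℝ ∞ (fun z => G z i j) O
  symm_G : ∀ z ∈ O, ∀ i j, G z i j = G z j i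
  pos_G : ∀ z ∈ O, ∀ v, v ≠ 0 → 0 < matForm (G z) v v
  open_U : IsOpen U
  smooth_f : ContDiffOn ℝ ∞ f U
  mapsTo : MapsTo f U O
  injective : ∀ y ∈ U, Function.Injective (fderiv ℝ f y)
  gram : ∀ y ∈ U, ∀ i j, A y i j = matForm (G (f y)) (pd i f y) (pd j f y)

theorem matForm_symm {M : Matrix (Fin n) (Fin n) ℝ} (h : ∀ i j, M i j = M j i) (v w : Rn n) :
    matForm M v w = matForm M w v := by
  rw [bilinOf_apply, bilinOf_apply, Finset.sum_comm]
  exact Finset.sum_congr rfl fun i _ => Finset.sum_congr rfl fun j _ => by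
    rw [h j i]; simp only [smul_eq_mul]; ring

namespace IsGramData

variable (h : IsGramData G O A f U)
include h

theorem isUnit_G {z : Rn n} (hz : z ∈ O) : IsUnit (G z).det :=
  isUnit_det_of_pos (h.pos_G z hz) fun i j => (bilinOf_bvec (fun i j => G z i j) i j).symm

theorem pos_pullback {y : Rn k} (hy : y ∈ U) (v : Rn k) (hv : v ≠ 0) :
    0 < matForm (G (f y)) (fderiv ℝ f y v) (fderiv ℝ f y v) := by
  refine h.pos_G _ (h.mapsTo hy) _ fun h0 => hv ?_
  exact h.injective y hy (by rw [h0, map_zero])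

theorem isUnit_A {y : Rn k} (hy : y ∈ U) : IsUnit (A y).det := by
  refine isUnit_det_of_pos (B := (matForm (G (f y))).bilinearComp (fderiv ℝ f y) (fderiv ℝ f y))
    (fun v hv => h.pos_pullback hy v hv) fun i j => ?_
  rw [h.gram y hy]; rfl

theorem symm_form {z : Rn n} (hz : z ∈ O) (v w : Rn n) :
    matForm (G z) v w = matForm (G z) w v :=
  matForm_symm (h.symm_G z hz) v w

theorem smooth_form : ContDiffOn ℝ ∞ (fun z => matForm (G z)) O :=
  contDiffOn_bilinOf h.smooth_G

theorem contDiffOn_pdf (i : Fin k) : ContDiffOn ℝ ∞ (pd i f) U :=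
  contDiffOn_pd h.open_U h.smooth_f i

theorem contDiffOn_A (i j : Fin k) : ContDiffOn ℝ ∞ (fun y => A y i j) U := by
  have h1 : ContDiffOn ℝ ∞ (fun y => matForm (G (f y))) U := h.smooth_form.comp h.smooth_f h.mapsTo
  exact ((h1.clm_apply (h.contDiffOn_pdf i)).clm_apply (h.contDiffOn_pdf j)).congr
    fun y hy => h.gram y hy i j

theorem contDiffOn_tanProj : ContDiffOn ℝ ∞ (tanProj G A f) U := by
  have h1 : ContDiffOn ℝ ∞ (fun y => matForm (G (f y))) U := h.smooth_form.comp h.smooth_f h.mapsTo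
  rw [contDiffOn_clm_apply]
  intro X
  have : (fun y => tanProj G A f y X) = fun y =>
      ∑ p, ∑ q, ((A y)⁻¹ p q * matForm (G (f y)) X (pd p f y)) • bvec k q :=
    funext fun y => tanProj_apply y X
  rw [this]
  exact ContDiffOn.sum fun p _ => ContDiffOn.sum fun q _ =>
    ((contDiffOn_inv h.contDiffOn_A (fun y hy => (h.isUnit_A hy).ne_zero) p q).mul
      ((h1.clm_apply contDiffOn_const).clm_apply (h.contDiffOn_pdf p))).smul contDiffOn_const

theorem tanProj_fderiv {y : Rn k} (hy : y ∈ U) (v : Rn k) :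
    tanProj G A f y (fderiv ℝ f y v) = v := by
  have h1 : ∀ r, tanProj G A f y (fderiv ℝ f y (bvec k r)) = bvec k r := by
    intro r
    have h2 := Matrix.mul_nonsing_inv (A y) (h.isUnit_A hy)
    rw [tanProj_apply, Finset.sum_comm]
    have h3 : ∀ q p, (A y)⁻¹ p q * matForm (G (f y)) (fderiv ℝ f y (bvec k r)) (pd p f y)
        = A y r p * (A y)⁻¹ p q := by
      intro q p; rw [h.gram y hy, mul_comm]; rfl
    simp only [h3, ← Finset.sum_smul, ← Matrix.mul_apply, h2, Matrix.one_apply]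
    simp
  rw [sum_bvec v]
  simp only [map_sum, map_smul, h1]

omit h in
theorem fderiv_tanProj (y : Rn k) (X : Rn n) : fderiv ℝ f y (tanProj G A f y X) =
    ∑ p, ∑ q, ((A y)⁻¹ p q * matForm (G (f y)) X (pd p f y)) • pd q f y := by
  rw [tanProj_apply]
  simp only [map_sum, map_smul]
  rfl

theorem orth {y : Rn k} (hy : y ∈ U) (X : Rn n) (v : Rn k) :
    matForm (G (f y)) (X - fderiv ℝ f y (tanProj G A f y X)) (fderiv ℝ f y v) = 0 := by
  have h1 : ∀ s, matForm (G (f y)) (X - fderiv ℝ f y (tanProj G A f y X)) (pd s f y) = 0 := by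
    intro s
    have h2 := Matrix.nonsing_inv_mul (A y) (h.isUnit_A hy)
    rw [fderiv_tanProj]
    simp only [map_sub, map_sum, map_smul, _root_.sub_apply, _root_.sum_apply, _root_.smul_apply,
      smul_eq_mul, ← h.gram y hy]
    have h3 : ∀ p q, (A y)⁻¹ p q * matForm (G (f y)) X (pd p f y) * A y q s
        = matForm (G (f y)) X (pd p f y) * ((A y)⁻¹ p q * A y q s) := fun p q => by ring
    simp only [h3, ← Finset.mul_sum, ← Matrix.mul_apply, h2, Matrix.one_apply]
    simp
  rw [sum_bvec v]
  simp only [map_sum, map_smul]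
  refine Finset.sum_eq_zero fun s _ => ?_
  rw [show fderiv ℝ f y (bvec k s) = pd s f y from rfl, h1]
  simp

theorem isImmersedIn : IsImmersedIn (chrMap G) O (fun z => matForm (G z)) U f (tanProj G A f) where
  open_O := h.open_O
  open_U := h.open_U
  smooth_Γ := contDiffOn_chrMap h.open_O h.smooth_G fun _ hz => h.isUnit_G hz
  symm_Γ _ hz := chrMap_symm h.open_O h.symm_G hz
  smooth_g := h.smooth_form
  symm_g _ hz := h.symm_form hz
  parallel_g := isParallelOn_metric h.open_O h.smooth_G h.symm_G fun _ hz => h.isUnit_G hz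
  smooth_f := h.smooth_f
  mapsTo := h.mapsTo
  smooth_P := h.contDiffOn_tanProj
  left_inv _ hy := h.tanProj_fderiv hy
  orth _ hy := h.orth hy

/-- The Christoffel symbols of the Gram matrix are the components of the tangential part. -/
theorem christoffel_eq {y : Rn k} (hy : y ∈ U) (l i j : Fin k) :
    christoffel A l i j y = tanPart (chrMap G) f (tanProj G A f) y (bvec k i) (bvec k j) l := by
  have hI := h.isImmersedIn
  have hs : ∀ i j, A y i j = A y j i := fun i j => by
    rw [h.gram y hy, h.gram y hy, h.symm_form (h.mapsTo hy)]
  -- Each derivative of the Gram matrix is a sum of two products of the Hessian with a tangent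
  -- vector. In the Christoffel combination the symmetry of the Hessian leaves only twice ⟨Hess(i,
  -- j), ∂ₚ f⟩.
  have hpd : ∀ c a b, pd c (fun y => A y a b) y =
      matForm (G (f y)) (hessAlong (chrMap G) f y (bvec k c) (bvec k a)) (pd b f y)
      + matForm (G (f y)) (hessAlong (chrMap G) f y (bvec k c) (bvec k b)) (pd a f y) := by
    intro c a b
    have e : (fun y => A y a b) =ᶠ[nhds y]
        fun y => matForm (G (f y)) (fderiv ℝ f y (bvec k a)) (fderiv ℝ f y (bvec k b)) := by
      filter_upwards [h.open_U.mem_nhds hy] with z hz using h.gram z hz a b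
    rw [pd, e.fderiv_eq, hI.fderiv_form hI.smooth_g hI.parallel_g hy,
      h.symm_form (h.mapsTo hy) (fderiv ℝ f y (bvec k a))]
    rfl
  have hinv : ∀ p q, (A y)⁻¹ p q = (A y)⁻¹ q p := by
    intro p q
    have : (A y).transpose = A y := by ext i j; exact hs j i
    conv_lhs => rw [← this, ← Matrix.transpose_nonsing_inv, Matrix.transpose_apply]
  have h0 : tanPart (chrMap G) f (tanProj G A f) y (bvec k i) (bvec k j) l =
      ∑ p, (A y)⁻¹ p l * matForm (G (f y)) (hessAlong (chrMap G) f y (bvec k i) (bvec k j))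
        (pd p f y) := by
    rw [tanPart, tanProj_apply, WithLp.ofLp_sum, Finset.sum_apply]
    refine Finset.sum_congr rfl fun p _ => ?_
    rw [WithLp.ofLp_sum, Finset.sum_apply]
    simp [bvec]
  rw [h0, christoffel, Finset.mul_sum]
  refine Finset.sum_congr rfl fun p _ => ?_
  rw [hpd, hpd, hpd, hI.hess_symm hy (bvec k j) (bvec k i), hI.hess_symm hy (bvec k p) (bvec k i),
    hI.hess_symm hy (bvec k p) (bvec k j), hinv l p]
  ring

end IsGramData

/-- Change of basis of the inverse Gram matrix. -/
theorem inv_eq_of_frame {A B : Matrix (Fin k) (Fin k) ℝ} {m : Matrix (Fin k) (Fin k) ℝ}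
    (hm : IsUnit m.det) (hB : B = m * A * m.transpose) :
    A⁻¹ = m.transpose * B⁻¹ * m := by
  have ht : IsUnit m.transpose.det := by rwa [Matrix.det_transpose]
  rw [hB, Matrix.mul_inv_rev, Matrix.mul_inv_rev, Matrix.mul_assoc, Matrix.mul_assoc,
    Matrix.mul_assoc, Matrix.nonsing_inv_mul m hm, Matrix.mul_one, ← Matrix.mul_assoc,
    Matrix.mul_nonsing_inv _ ht, Matrix.one_mul]

/-- The trace of a bilinear map with respect to the inverse Gram matrix, in another basis. -/
theorem sum_inv_eq_of_frame {W : Type*} [NormedAddCommGroup W] [NormedSpace ℝ W]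
    {A B : Matrix (Fin k) (Fin k) ℝ} {u : Fin k → Rn k}
    (hm : IsUnit (Matrix.of fun a i => u a i).det)
    (hB : B = (Matrix.of fun a i => u a i) * A * (Matrix.of fun a i => u a i).transpose)
    (Q : Rn k → Rn k → W) (hQ : ∀ v w, Q v w = ∑ i, ∑ j, (v i * w j) • Q (bvec k i) (bvec k j)) :
    ∑ i, ∑ j, A⁻¹ i j • Q (bvec k i) (bvec k j) = ∑ a, ∑ b, B⁻¹ a b • Q (u a) (u b) := by
  rw [inv_eq_of_frame hm hB]
  have h1 : ∀ a b, B⁻¹ a b • Q (u a) (u b) =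
      ∑ i, ∑ j, (u a i * B⁻¹ a b * u b j) • Q (bvec k i) (bvec k j) := by
    intro a b
    rw [hQ, Finset.smul_sum]
    refine Finset.sum_congr rfl fun i _ => ?_
    rw [Finset.smul_sum]
    refine Finset.sum_congr rfl fun j _ => ?_
    rw [smul_smul]; congr 1; ring
  simp only [h1]
  simp only [Matrix.mul_apply, Matrix.transpose_apply, Matrix.of_apply, Finset.sum_mul,
    Finset.sum_smul]
  have h2 : ∀ x : Fin k → Fin k → Fin k → Fin k → W,
      ∑ i, ∑ j, ∑ b, ∑ a, x a b i j = ∑ a, ∑ b, ∑ i, ∑ j, x a b i j := by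
    intro x
    calc ∑ i, ∑ j, ∑ b, ∑ a, x a b i j = ∑ i, ∑ j, ∑ a, ∑ b, x a b i j := by
          refine Finset.sum_congr rfl fun i _ => Finset.sum_congr rfl fun j _ => Finset.sum_comm
      _ = ∑ i, ∑ a, ∑ j, ∑ b, x a b i j :=
          Finset.sum_congr rfl fun i _ => Finset.sum_comm
      _ = ∑ a, ∑ i, ∑ j, ∑ b, x a b i j := Finset.sum_comm
      _ = ∑ a, ∑ i, ∑ b, ∑ j, x a b i j :=
          Finset.sum_congr rfl fun a _ => Finset.sum_congr rfl fun i _ => Finset.sum_comm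
      _ = ∑ a, ∑ b, ∑ i, ∑ j, x a b i j :=
          Finset.sum_congr rfl fun a _ => Finset.sum_comm
  exact h2 fun a b i j => (u a i * B⁻¹ a b * u b j) • Q (bvec k i) (bvec k j)

end Gram

/-! ### The evolution identity in terms of coordinate Laplacian and Ricci coefficients. -/

section LocalEvolution

theorem bilin_expand {k : ℕ} {W : Type*} [NormedAddCommGroup W] [NormedSpace ℝ W]
    (T : Rn k →L[ℝ] Rn k →L[ℝ] W) (v w : Rn k) :
    T v w = ∑ i, ∑ j, (v i * w j) • T (bvec k i) (bvec k j) := by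
  conv_lhs => rw [sum_bvec v, sum_bvec w]
  simp only [map_sum, map_smul, _root_.sum_apply, _root_.smul_apply, Finset.smul_sum, smul_smul]
  rw [Finset.sum_comm]
  exact Finset.sum_congr rfl fun i _ => Finset.sum_congr rfl fun j _ => by rw [mul_comm]

section Curvature

variable {E : Type*} [NormedAddCommGroup E] [NormedSpace ℝ E] {Γ : E → E →L[ℝ] E →L[ℝ] E}

theorem curv_sum_mid {ι : Type*} [Fintype ι] (z a b : E) (c : ι → ℝ) (e : ι → E) :
    curv Γ z a (∑ n, c n • e n) b = ∑ n, c n • curv Γ z a (e n) b := by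
  rw [curv_swap, curv_sum_left, ← Finset.sum_neg_distrib]
  exact Finset.sum_congr rfl fun n _ => by rw [curv_swap z (e n) a, smul_neg]

theorem curv_sum_right {ι : Type*} [Fintype ι] (z a b : E) (c : ι → ℝ) (e : ι → E) :
    curv Γ z a b (∑ n, c n • e n) = ∑ n, c n • curv Γ z a b (e n) := by
  simp only [curv, map_sum, map_smul,
    ← Finset.sum_sub_distrib, ← Finset.sum_add_distrib, smul_sub, smul_add]

end Curvature

/-- The trace of an endomorphism, in an orthonormal frame and in the standard basis. It links the
frame sum of curvatures to the contraction of coordinates defining `ricciCoeff`. -/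
theorem sum_frame_trace {n : ℕ} {g : Rn n →L[ℝ] Rn n →L[ℝ] ℝ} {ι : Type*} [Fintype ι]
    {e : ι → Rn n} (hexp : ∀ X, X = ∑ a, g X (e a) • e a) (L : Rn n → Rn n)
    (hL : ∀ c : ι → ℝ, L (∑ a, c a • e a) = ∑ a, c a • L (e a)) :
    ∑ a, g (L (e a)) (e a) = ∑ i, L (bvec n i) i := by
  have h1 : ∀ i, L (bvec n i) i = ∑ a, g (bvec n i) (e a) * L (e a) i := by
    intro i
    conv_lhs => rw [hexp (bvec n i), hL]
    rw [WithLp.ofLp_sum, Finset.sum_apply]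
    simp
  simp only [h1]
  rw [Finset.sum_comm]
  refine Finset.sum_congr rfl fun a _ => ?_
  conv_lhs => rw [sum_bvec (L (e a))]
  simp only [map_sum, map_smul, _root_.sum_apply, _root_.smul_apply, smul_eq_mul]
  exact Finset.sum_congr rfl fun i _ => by ring

theorem sum_ricciCoeff {n : ℕ} {G : Rn n → Matrix (Fin n) (Fin n) ℝ} {O : Set (Rn n)}
    (hO : IsOpen O) (hG : ∀ i j, ContDiffOn ℝ ∞ (fun z => G z i j) O)
    (hdet : ∀ z ∈ O, IsUnit (G z).det) {z : Rn n} (hz : z ∈ O) (X Y : Rn n) :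
    ∑ j, ∑ k, ricciCoeff G j k z * X j * Y k = ∑ i, curv (chrMap G) z (bvec n i) X Y i := by
  have h1 : ∀ i, curv (chrMap G) z (bvec n i) X Y i =
      ∑ j, ∑ k, riemannCoeff G i i j k z * X j * Y k := by
    intro i
    conv_lhs => rw [sum_bvec X, sum_bvec Y, curv_sum_mid]
    rw [WithLp.ofLp_sum, Finset.sum_apply]
    refine Finset.sum_congr rfl fun j _ => ?_
    rw [curv_sum_right, PiLp.smul_apply, WithLp.ofLp_sum, Finset.sum_apply, Finset.smul_sum]
    refine Finset.sum_congr rfl fun k _ => ?_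
    rw [PiLp.smul_apply, curv_chrMap_bvec hO hG hdet hz]
    simp only [smul_eq_mul]
    ring
  simp only [h1, ricciCoeff, Finset.sum_mul]
  rw [Finset.sum_comm' (t' := Finset.univ) (s' := fun _ => Finset.univ) (by simp)]
  conv_rhs => rw [Finset.sum_comm]
  rw [Finset.sum_comm]
  refine Finset.sum_congr rfl fun j _ => ?_
  rw [Finset.sum_comm]

variable {G W : Rn 4 → Matrix (Fin 4) (Fin 4) ℝ} {O : Set (Rn 4)}
  {A : Rn 2 → Matrix (Fin 2) (Fin 2) ℝ} {f : Rn 2 → Rn 4} {U : Set (Rn 2)}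

namespace IsGramData

variable (h : IsGramData G O A f U)
include h

theorem gramDet_pos {u : Fin 2 → Rn 2} (hu : LinearIndependent ℝ u) {y : Rn 2} (hy : y ∈ U) :
    0 < gramDet (fun z => matForm (G z)) f u y := by
  have hp := h.pos_pullback hy
  have hs := h.symm_form (h.mapsTo hy) (fderiv ℝ f y (u 1)) (fderiv ℝ f y (u 0))
  have h0 := hp _ (hu.ne_zero 0)
  set a := matForm (G (f y)) (fderiv ℝ f y (u 0)) (fderiv ℝ f y (u 0)) with ha
  set b := matForm (G (f y)) (fderiv ℝ f y (u 0)) (fderiv ℝ f y (u 1)) with hb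
  -- As in the proof of Cauchy–Schwarz: the squared length of this vector is a times the Gram
  -- determinant.
  have hne : a • u 1 - b • u 0 ≠ 0 := by
    intro h1
    have h2 := Fintype.linearIndependent_iff.1 hu ![-b, a]
      (by rw [← h1, Fin.sum_univ_two]; simp; abel) 1
    exact h0.ne' (by simpa using h2)
  have h1 := hp _ hne
  simp only [map_sub, map_smul, _root_.sub_apply, _root_.smul_apply, smul_eq_mul, hs, ← ha, ← hb]
    at h1
  have h2 : 0 < a * gramDet (fun z => matForm (G z)) f u y := by
    simp only [gramDet, ← ha, ← hb]
    linarith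
  exact (pos_iff_pos_of_mul_pos h2).1 h0

omit h in
theorem linearIndependent_of_orthonormal {u : Fin 2 → Rn 2} {y : Rn 2}
    (hon : ∀ a b, matForm (G (f y)) (fderiv ℝ f y (u a)) (fderiv ℝ f y (u b))
      = if a = b then 1 else 0) : LinearIndependent ℝ u := by
  rw [Fintype.linearIndependent_iff]
  intro c hc b
  have h1 : matForm (G (f y)) (fderiv ℝ f y (∑ a, c a • u a)) (fderiv ℝ f y (u b)) = 0 := by
    rw [hc]; simp
  simp only [map_sum, map_smul, _root_.sum_apply, _root_.smul_apply, smul_eq_mul, hon] at h1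
  simpa using h1

theorem frame_gram (u : Fin 2 → Rn 2) {y : Rn 2} (hy : y ∈ U) (a b : Fin 2) :
    ((Matrix.of fun a i => u a i) * A y * (Matrix.of fun a i => u a i).transpose) a b =
      matForm (G (f y)) (fderiv ℝ f y (u a)) (fderiv ℝ f y (u b)) := by
  have h1 := bilin_expand ((matForm (G (f y))).bilinearComp (fderiv ℝ f y) (fderiv ℝ f y))
    (u a) (u b)
  simp only [ContinuousLinearMap.bilinearComp_apply] at h1
  rw [h1]
  simp only [Matrix.mul_apply, Matrix.of_apply, Matrix.transpose_apply, Finset.sum_mul,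
    smul_eq_mul]
  rw [Finset.sum_comm]
  refine Finset.sum_congr rfl fun i _ => Finset.sum_congr rfl fun j _ => ?_
  rw [h.gram y hy]
  simp only [pd]
  ring

/-- The Laplacian is the trace of the covariant Hessian, which may be taken in any basis; in the
orthonormal basis u the inverse Gram matrix is the identity. -/
theorem laplacianCoord_eq {η : Rn 2 → ℝ} {y : Rn 2} (hy : y ∈ U) (hη : ContDiffAt ℝ ∞ η y)
    {u : Fin 2 → Rn 2}
    (hon : ∀ a b, matForm (G (f y)) (fderiv ℝ f y (u a)) (fderiv ℝ f y (u b))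
      = if a = b then 1 else 0) :
    laplacianCoord A η y = ∑ a, (fderiv ℝ (fun y => fderiv ℝ η y (u a)) y (u a)
      - fderiv ℝ η y (tanPart (chrMap G) f (tanProj G A f) y (u a) (u a))) := by
  have hB : (1 : Matrix (Fin 2) (Fin 2) ℝ) = (Matrix.of fun a i => u a i) * A y
      * (Matrix.of fun a i => u a i).transpose := by
    ext a b
    rw [h.frame_gram u hy, hon, Matrix.one_apply]
  have hm : IsUnit (Matrix.of fun a i => u a i).det := by
    have h1 := congrArg Matrix.det hB
    rw [Matrix.det_one, Matrix.det_mul, Matrix.det_mul, mul_assoc] at h1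
    exact IsUnit.of_mul_eq_one _ h1.symm
  have key := sum_inv_eq_of_frame hm hB (fun v w => fderiv ℝ (fun y => fderiv ℝ η y w) y v
      - fderiv ℝ η y (tanPart (chrMap G) f (tanProj G A f) y v w)) (fun v w => by
    simp only [fderiv_fderiv_apply hη, tanPart]
    rw [bilin_expand (fderiv ℝ (fderiv ℝ η) y), bilin_expand (hessAlong (chrMap G) f y)]
    simp only [map_sum, map_smul, smul_sub, Finset.sum_sub_distrib])
  rw [inv_one] at key
  simp only [Matrix.one_apply, ite_smul, one_smul, zero_smul, Finset.sum_ite_eq,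
    Finset.mem_univ, if_true] at key
  rw [← key, laplacianCoord]
  refine Finset.sum_congr rfl fun i _ => Finset.sum_congr rfl fun j _ => ?_
  rw [smul_eq_mul]
  congr 1
  simp only [h.christoffel_eq hy]
  congr 1
  conv_rhs => rw [sum_bvec (tanPart (chrMap G) f (tanProj G A f) y (bvec 2 i) (bvec 2 j))]
  simp only [map_sum, map_smul, smul_eq_mul]
  rfl

/-- The inverse Gram matrix of a frame, and the mean curvature vector in this frame. -/
theorem exists_frame_inverse (u : Fin 2 → Rn 2) {y : Rn 2}
    (hon : ∀ a b, matForm (G (f y)) (fderiv ℝ f y (u a)) (fderiv ℝ f y (u b))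
      = if a = b then 1 else 0) (hy : y ∈ U) :
    ∃ c : Fin 2 → Fin 2 → Rn 2 → ℝ, (∀ a b, ContDiffOn ℝ ∞ (c a b) U) ∧
      (∀ y ∈ U, ∀ a d, ∑ b, c a b y * matForm (G (f y)) (fderiv ℝ f y (u b)) (fderiv ℝ f y (u d))
        = if a = d then 1 else 0) ∧
      ∀ y ∈ U, ∑ i, ∑ j, (A y)⁻¹ i j •
          normPart (chrMap G) f (tanProj G A f) (bvec 2 i) (bvec 2 j) y =
        ∑ a, ∑ b, c a b y • normPart (chrMap G) f (tanProj G A f) (u a) (u b) y := by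
  have hI := h.isImmersedIn
  set m : Matrix (Fin 2) (Fin 2) ℝ := Matrix.of fun a i => u a i with hm_def
  have hB1 : (1 : Matrix (Fin 2) (Fin 2) ℝ) = m * A y * m.transpose := by
    ext a b
    rw [h.frame_gram u hy, hon, Matrix.one_apply]
  have hm : IsUnit m.det := by
    have h1 := congrArg Matrix.det hB1
    rw [Matrix.det_one, Matrix.det_mul, Matrix.det_mul, mul_assoc] at h1
    exact IsUnit.of_mul_eq_one _ h1.symm
  have hBu : ∀ y ∈ U, IsUnit (m * A y * m.transpose).det := by
    intro y hy
    rw [Matrix.det_mul, Matrix.det_mul, Matrix.det_transpose]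
    exact (hm.mul (h.isUnit_A hy)).mul hm
  have hBs : ∀ a b, ContDiffOn ℝ ∞ (fun y => (m * A y * m.transpose) a b) U := fun a b =>
    (hI.contDiffOn_form hI.smooth_g (u a) (u b)).congr fun y hy => h.frame_gram u hy a b
  refine ⟨fun a b y => (m * A y * m.transpose)⁻¹ a b,
    fun a b => contDiffOn_inv hBs (fun y hy => (hBu y hy).ne_zero) a b, fun y hy a d => ?_,
    fun y hy => ?_⟩
  · have h1 := Matrix.nonsing_inv_mul _ (hBu y hy)
    have h2 := congrFun (congrFun h1 a) d
    rw [Matrix.mul_apply, Matrix.one_apply] at h2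
    rw [← h2]
    exact Finset.sum_congr rfl fun b _ => by rw [h.frame_gram u hy]
  · exact sum_inv_eq_of_frame hm rfl
      (fun v w => normPart (chrMap G) f (tanProj G A f) v w y) (fun v w => by
        simp only [normPart]
        rw [bilin_expand (hessAlong (chrMap G) f y) v w]
        simp only [map_sum, map_smul, smul_sub, Finset.sum_sub_distrib])

/-- The evolution equation at a point, in terms of the mean curvature vector field `H`. -/
theorem evolution (hW : ∀ i j, ContDiffOn ℝ ∞ (fun z => W z i j) O)
    (hp : IsParallelOn (chrMap G) O (fun z => matForm (W z)))
    (hsk : ∀ z ∈ O, ∀ v w, matForm (W z) v w = - matForm (W z) w v) {H : Rn 2 → Rn 4}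
    (hH : ∀ y ∈ U, H y = ∑ i, ∑ j, (A y)⁻¹ i j •
      normPart (chrMap G) f (tanProj G A f) (bvec 2 i) (bvec 2 j) y)
    {y : Rn 2} (hy : y ∈ U) (ub : Module.Basis (Fin 2) ℝ (Rn 2))
    {J : Rn 4 →L[ℝ] Rn 4} {e : Fin 4 → Rn 4}
    (k : IsKaehlerFrame (matForm (G (f y))) (matForm (W (f y))) J e)
    (he0 : e 0 = fderiv ℝ f y (ub 0)) (he1 : e 1 = fderiv ℝ f y (ub 1))
    (hon : ∀ a b, matForm (G (f y)) (fderiv ℝ f y (ub a)) (fderiv ℝ f y (ub b))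
      = if a = b then 1 else 0)
    {h₃ h₄ : Fin 2 → Fin 2 → ℝ}
    (hh₃ : ∀ i j, h₃ i j = matForm (G (f y))
      (normPart (chrMap G) f (tanProj G A f) (ub i) (ub j) y) (e 2))
    (hh₄ : ∀ i j, h₄ i j = matForm (G (f y))
      (normPart (chrMap G) f (tanProj G A f) (ub i) (ub j) y) (e 3)) :
    matForm (W (f y)) (covD (chrMap G) f H (ub 0) y) (e 1)
      + matForm (W (f y)) (e 0) (covD (chrMap G) f H (ub 1) y)
      - starFun (fun z => matForm (G z)) (fun z => matForm (W z)) f ub y * (matForm (G (f y)) (covD (chrMap G) f H (ub 0) y) (e 0)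
        + matForm (G (f y)) (covD (chrMap G) f H (ub 1) y) (e 1)) =
    laplacianCoord A (starFun (fun z => matForm (G z)) (fun z => matForm (W z)) f ub) y
      + starFun (fun z => matForm (G z)) (fun z => matForm (W z)) f ub y * ∑ k, ((h₃ 0 k - h₄ 1 k) ^ 2 + (h₃ 1 k + h₄ 0 k) ^ 2)
      + (1 - starFun (fun z => matForm (G z)) (fun z => matForm (W z)) f ub y ^ 2) * ∑ j, ∑ k, ricciCoeff G j k (f y) * J (e 0) j * e 1 k := by
  have hI := h.isImmersedIn
  have hΩ : ContDiffOn ℝ ∞ (fun z => matForm (W z)) O := contDiffOn_bilinOf hW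
  have hdet : ∀ y ∈ U, 0 < gramDet (fun z => matForm (G z)) f ub y := fun y hy =>
    h.gramDet_pos ub.linearIndependent hy
  have hη := hI.contDiffOn_starFun hΩ ub hdet
  obtain ⟨c, hc, hinv, hHc⟩ := h.exists_frame_inverse ub hon hy
  have ev := hI.evolution hΩ hp hsk ub hdet hc hinv (fun y hy => (hH y hy).trans (hHc y hy))
    hy k he0 he1 (h₃ := h₃) (h₄ := h₄) 
    (fun i j => (hh₃ i j).trans (by congr 1)) (fun i j => (hh₄ i j).trans (by congr 1))
  have h1 := h.laplacianCoord_eq hy (hη.contDiffAt (h.open_U.mem_nhds hy)) hon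
  have h2 := (sum_frame_trace k.expand (fun X => curv (chrMap G) (f y) X (J (e 0)) (e 1))
      (fun c => curv_sum_left _ _ _ _ _)).trans (sum_ricciCoeff h.open_O h.smooth_G
      (fun z hz => h.isUnit_G hz) (h.mapsTo hy) (J (e 0)) (e 1)).symm
  rw [h1, ← h2]
  refine Eq.trans ?_ (ev.trans ?_)
  · congr 1
  · congr 1

end IsGramData

end LocalEvolution

/-! ### Independence of the Hodge star from the positive basis. -/

section Hodge

theorem bilin_two_expand (B : Rn 2 →L[ℝ] Rn 2 →L[ℝ] ℝ) (v w : Rn 2) :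
    B v w = v 0 * w 0 * B (bvec 2 0) (bvec 2 0) + v 0 * w 1 * B (bvec 2 0) (bvec 2 1)
      + v 1 * w 0 * B (bvec 2 1) (bvec 2 0) + v 1 * w 1 * B (bvec 2 1) (bvec 2 1) := by
  rw [bilin_expand B v w]
  simp only [Fin.sum_univ_two, smul_eq_mul]
  ring

theorem alternating_two_expand {B : Rn 2 →L[ℝ] Rn 2 →L[ℝ] ℝ} (hB : ∀ v, B v v = 0) (v w : Rn 2) :
    B v w = (v 0 * w 1 - v 1 * w 0) * B (bvec 2 0) (bvec 2 1) := by
  have h1 := hB (bvec 2 0 + bvec 2 1)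
  simp only [map_add, _root_.add_apply, hB] at h1
  rw [bilin_two_expand B v w, hB, hB]
  linear_combination v 1 * w 0 * h1

/-- A two-form divided by the area form does not depend on the basis. -/
theorem div_area_eq_of_pos {m h β : Rn 2 →L[ℝ] Rn 2 →L[ℝ] ℝ} (hm : ∀ v, m v v = 0)
    (hh : ∀ v w, h v w = h w v) (hβ : ∀ v, β v v = 0) {v w : Rn 2} (hpos : 0 < m v w) :
    β (bvec 2 0) (bvec 2 1) / (Real.sign (m (bvec 2 0) (bvec 2 1)) *
      √(h (bvec 2 0) (bvec 2 0) * h (bvec 2 1) (bvec 2 1) - h (bvec 2 0) (bvec 2 1) ^ 2)) =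
    β v w / √(h v v * h w w - h v w ^ 2) := by
  -- With D the determinant of (v, w), the form β scales by D and the Gram determinant by D². The
  -- square root yields |D|, and the sign of D is that of the orientation form on the standard
  -- basis.
  have hgram : h v v * h w w - h v w ^ 2 = (v 0 * w 1 - v 1 * w 0) ^ 2 *
      (h (bvec 2 0) (bvec 2 0) * h (bvec 2 1) (bvec 2 1) - h (bvec 2 0) (bvec 2 1) ^ 2) := by
    rw [bilin_two_expand h v v, bilin_two_expand h w w, bilin_two_expand h v w,
      hh (bvec 2 1) (bvec 2 0)]
    ring
  rw [alternating_two_expand hm] at hpos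
  rw [hgram, alternating_two_expand hβ v w, Real.sqrt_mul (sq_nonneg _), Real.sqrt_sq_eq_abs]
  generalize v 0 * w 1 - v 1 * w 0 = D at *
  generalize m (bvec 2 0) (bvec 2 1) = a at *
  rcases lt_or_ge 0 D with hD | hD
  · rw [Real.sign_of_pos ((pos_iff_pos_of_mul_pos hpos).1 hD), abs_of_pos hD, one_mul,
      mul_div_mul_left _ _ hD.ne']
  · have hD' : D < 0 := lt_of_le_of_ne hD (by rintro rfl; simp at hpos)
    rw [Real.sign_of_neg (neg_of_mul_pos_right hpos hD), abs_of_neg hD', neg_mul, neg_mul, one_mul,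
      div_neg, div_neg, mul_div_mul_left _ _ hD'.ne]

variable {S : Type*} [TopologicalSpace S] [ChartedSpace (Rn 2) S] [IsManifold (𝓡 2) ∞ S]

/-- The Hodge star can be computed on any positive basis. -/
theorem hodgeStar_eq_of_pos (μ : OrientationForm S) {h β : TwoTensor 2 S} {x : S}
    (Bh Bβ : TangentSpace (𝓡 2) x →L[ℝ] TangentSpace (𝓡 2) x →L[ℝ] ℝ)
    (hh : ∀ v w, h x v w = Bh v w) (hβ : ∀ v w, β x v w = Bβ v w)
    (hs : ∀ v w, Bh v w = Bh w v) (ha : ∀ v, Bβ v v = 0) {v w : TangentSpace (𝓡 2) x}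
    (hpos : 0 < μ.form x v w) :
    hodgeStar μ h β x = β x v w / √(h x v v * h x w w - h x v w ^ 2) := by
  have key := div_area_eq_of_pos (m := μ.form x) (h := Bh) (β := Bβ) (μ.alternating x) hs ha hpos
  have h1 : ∀ a b, β x a b / areaForm μ h x a b = Bβ a b / (Real.sign (μ.form x a b) *
      √(Bh a a * Bh b b - Bh a b ^ 2)) := by
    intro a b
    rw [areaForm, hβ, hh, hh, hh]
  rw [hβ, hh, hh, hh]
  exact (h1 _ _).trans key

end Hodge

/-! ### The coordinate second fundamental form as the normal part of the Hessian. -/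

section SecondForm

variable {k n : ℕ} {S : Type*} [TopologicalSpace S] [ChartedSpace (Rn k) S]
  {M : Type*} [TopologicalSpace M] [ChartedSpace (Rn n) M]
  {h : TwoTensor n M} {f : S → M} {ψ : OpenPartialHomeomorph S (Rn k)}
  {φ : OpenPartialHomeomorph M (Rn n)} {y : Rn k}

omit [ChartedSpace (Rn k) S] in
theorem covDerivCoord_eq (hf : ContDiffAt ℝ ∞ (localMap f ψ φ) y) (i j : Fin k) :
    covDerivCoord h f ψ φ i j y =
      hessAlong (chrMap (coeff h φ)) (localMap f ψ φ) y (bvec k i) (bvec k j) := by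
  ext a
  have h1 : pd i (pd j (localMap f ψ φ)) y
      = fderiv ℝ (fderiv ℝ (localMap f ψ φ)) y (bvec k i) (bvec k j) :=
    fderiv_fderiv_apply hf _ _
  rw [hessAlong, _root_.add_apply, _root_.add_apply, ContinuousLinearMap.bilinearComp_apply, ← h1,
    PiLp.add_apply, bilin_expand (chrMap (coeff h φ) (localMap f ψ φ y)), WithLp.ofLp_sum,
    Finset.sum_apply, covDerivCoord]
  refine congrArg₂ (· + ·) rfl (Finset.sum_congr rfl fun b _ => ?_)
  rw [WithLp.ofLp_sum, Finset.sum_apply]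
  refine Finset.sum_congr rfl fun c _ => ?_
  rw [PiLp.smul_apply, chrMap_bvec, smul_eq_mul]
  simp only [pd]
  ring

theorem secondFormCoord_eq (hf : ContDiffAt ℝ ∞ (localMap f ψ φ) y) (i j : Fin k) :
    secondFormCoord h f ψ φ i j y = normPart (chrMap (coeff h φ)) (localMap f ψ φ)
      (tanProj (coeff h φ) (coeff (pullback f h) ψ) (localMap f ψ φ)) (bvec k i) (bvec k j) y := by
  rw [normPart, IsGramData.fderiv_tanProj, secondFormCoord, covDerivCoord_eq hf]
  simp only [dotG_eq]

theorem meanCurvatureCoord_eq (hf : ContDiffAt ℝ ∞ (localMap f ψ φ) y) :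
    meanCurvatureCoord h f ψ φ y = ∑ i, ∑ j, (coeff (pullback f h) ψ y)⁻¹ i j •
      normPart (chrMap (coeff h φ)) (localMap f ψ φ)
        (tanProj (coeff h φ) (coeff (pullback f h) ψ) (localMap f ψ φ)) (bvec k i) (bvec k j) y := by
  simp only [meanCurvatureCoord, secondFormCoord_eq hf]

theorem secondForm_eq (x : S) (v w : TangentSpace (𝓡 k) x) (ν : TangentSpace (𝓡 n) (f x))
    (hψ : ψ = chartAt (Rn k) x) (hφ : φ = chartAt (Rn n) (f x))
    (hf : ContDiffAt ℝ ∞ (localMap f ψ φ) (ψ x)) :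
    secondForm h f x v w ν = matForm (coeff h φ (φ (f x)))
      (normPart (chrMap (coeff h φ)) (localMap f ψ φ)
        (tanProj (coeff h φ) (coeff (pullback f h) ψ) (localMap f ψ φ))
          (vecCoord ψ x v) (vecCoord ψ x w) (ψ x)) (vecCoord φ (f x) ν) := by
  subst hψ hφ
  simp only [secondForm, dotG_eq, secondFormCoord_eq hf]
  congr 2
  simp only [normPart]
  rw [bilin_expand _ (vecCoord _ x v) (vecCoord _ x w)]
  simp only [map_sum, map_smul, smul_sub, Finset.sum_sub_distrib]

end SecondForm

/-! ### The metric, the Kähler form and an immersion in charts. -/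

section LocalData

variable {k n : ℕ} {S : Type*} [TopologicalSpace S] [ChartedSpace (Rn k) S] [IsManifold (𝓡 k) ∞ S]
  {M : Type*} [TopologicalSpace M] [ChartedSpace (Rn n) M] [IsManifold (𝓡 n) ∞ M]
  {ψ : OpenPartialHomeomorph S (Rn k)} {φ : OpenPartialHomeomorph M (Rn n)}

theorem inner_eq_matForm (hφ : φ ∈ atlas (Rn n) M) (g : Metric n M) {x : M} (hx : x ∈ φ.source)
    (v w : TangentSpace (𝓡 n) x) :
    g.inner x v w = matForm (coeff g.tensor φ (φ x)) (vecCoord φ x v) (vecCoord φ x w) :=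
  tensor_eq_matForm hφ g.inner hx v w

theorem kaehlerForm_eq_matForm (hφ : φ ∈ atlas (Rn n) M) (g : Metric n M)
    (J : ∀ x : M, TangentSpace (𝓡 n) x →L[ℝ] TangentSpace (𝓡 n) x) {x : M} (hx : x ∈ φ.source)
    (v w : TangentSpace (𝓡 n) x) :
    kaehlerForm g J x v w
      = matForm (coeff (kaehlerForm g J) φ (φ x)) (vecCoord φ x v) (vecCoord φ x w) :=
  tensor_eq_matForm hφ (fun x => (g.inner x).comp (J x)) hx v w

theorem exists_vecCoord (hφ : φ ∈ atlas (Rn n) M) {z : Rn n} (hz : z ∈ φ.target) :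
    ∃ x ∈ φ.source, φ x = z ∧ ∀ v : Rn n, ∃ X : TangentSpace (𝓡 n) x, vecCoord φ x X = v :=
  ⟨φ.symm z, φ.map_target hz, φ.right_inv hz, fun v => ⟨_, vecCoord_mfderiv_symm hφ hz v⟩⟩

theorem matForm_pos (hφ : φ ∈ atlas (Rn n) M) (g : Metric n M) {z : Rn n} (hz : z ∈ φ.target)
    {v : Rn n} (hv : v ≠ 0) : 0 < matForm (coeff g.tensor φ z) v v := by
  obtain ⟨x, hx, rfl, hX⟩ := exists_vecCoord hφ hz
  obtain ⟨X, rfl⟩ := hX v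
  rw [← inner_eq_matForm hφ g hx]
  refine g.pos x X ?_
  rintro rfl
  exact hv (map_zero (mfderiv (𝓡 n) 𝓘(ℝ, Rn n) φ x))

theorem kaehlerForm_skew {g : Metric n M}
    {J : ∀ x : M, TangentSpace (𝓡 n) x →L[ℝ] TangentSpace (𝓡 n) x} (hJ : IsKaehler g J) (x : M)
    (v w : TangentSpace (𝓡 n) x) : kaehlerForm g J x v w = - kaehlerForm g J x w v := by
  have h1 := hJ.orthogonal x v (J x w)
  rw [hJ.sq, map_neg] at h1
  simp only [kaehlerForm]
  rw [g.symm x (J x w) v, ← h1, neg_neg]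

theorem matForm_kaehler_skew (hφ : φ ∈ atlas (Rn n) M) {g : Metric n M}
    {J : ∀ x : M, TangentSpace (𝓡 n) x →L[ℝ] TangentSpace (𝓡 n) x} (hJ : IsKaehler g J)
    {z : Rn n} (hz : z ∈ φ.target) (v w : Rn n) :
    matForm (coeff (kaehlerForm g J) φ z) v w = - matForm (coeff (kaehlerForm g J) φ z) w v := by
  obtain ⟨x, hx, rfl, hX⟩ := exists_vecCoord hφ hz
  obtain ⟨X, rfl⟩ := hX v
  obtain ⟨Y, rfl⟩ := hX w
  rw [← kaehlerForm_eq_matForm hφ g J hx, ← kaehlerForm_eq_matForm hφ g J hx, kaehlerForm_skew hJ]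

theorem isParallelOn_kaehlerForm (hφ : φ ∈ atlas (Rn n) M) {g : Metric n M}
    {J : ∀ x : M, TangentSpace (𝓡 n) x →L[ℝ] TangentSpace (𝓡 n) x} (hJ : IsKaehler g J) :
    IsParallelOn (chrMap (coeff g.tensor φ)) φ.target
      (fun z => matForm (coeff (kaehlerForm g J) φ z)) :=
  isParallelOn_of_coord φ.open_target (contDiffOn_coeff_kaehlerForm hφ g hJ) (hJ.parallel φ hφ)

/-- The bridge from the manifold to the local theory. Injectivity of the local differential and the
formula for the Gram matrix come from the chain rule in charts. -/
theorem isGramData_chart (hψ : ψ ∈ atlas (Rn k) S) (hφ : φ ∈ atlas (Rn n) M) (g : Metric n M)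
    {f : S → M} (hf : ContMDiff (𝓡 k) (𝓡 n) ∞ f)
    (himm : ∀ x, Function.Injective (mfderiv (𝓡 k) (𝓡 n) f x)) {U : Set (Rn k)} (hU : IsOpen U)
    (hUψ : U ⊆ ψ.target) (hUφ : ∀ y ∈ U, f (ψ.symm y) ∈ φ.source)
    (hs : ContDiffOn ℝ ∞ (localMap f ψ φ) U) :
    IsGramData (coeff g.tensor φ) φ.target (coeff (pullback f g.tensor) ψ) (localMap f ψ φ) U where
  open_O := φ.open_target
  smooth_G := contDiffOn_coeff_metric hφ g
  symm_G z _ i j := g.symm _ _ _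
  pos_G z hz v hv := matForm_pos hφ g hz hv
  open_U := hU
  smooth_f := hs
  mapsTo y hy := φ.map_source (hUφ y hy)
  injective y hy := by
    have hm : ∀ x, MDifferentiableAt (𝓡 k) (𝓡 n) f x := fun x =>
      (hf x).mdifferentiableAt (by simp)
    rw [injective_iff_map_eq_zero]
    intro v hv
    have h1 := vecCoord_mfderiv hψ hφ (ψ.map_target (hUψ hy)) (hUφ y hy) (hm _)
      (mfderiv 𝓘(ℝ, Rn k) (𝓡 k) ψ.symm y v)
    rw [vecCoord_mfderiv_symm hψ (hUψ hy), ψ.right_inv (hUψ hy), hv] at h1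
    have h2 := mfderiv_symm_vecCoord hφ (hUφ y hy)
      (mfderiv (𝓡 k) (𝓡 n) f (ψ.symm y) (mfderiv 𝓘(ℝ, Rn k) (𝓡 k) ψ.symm y v))
    have h3 := himm (ψ.symm y) ((h2.symm.trans
      ((congrArg (fun w : Rn n => (mfderiv 𝓘(ℝ, Rn n) (𝓡 n) φ.symm (φ (f (ψ.symm y))) w : Rn n))
        h1).trans (map_zero (mfderiv 𝓘(ℝ, Rn n) (𝓡 n) φ.symm (φ (f (ψ.symm y))))))).trans
      (map_zero (mfderiv (𝓡 k) (𝓡 n) f (ψ.symm y))).symm)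
    have h4 := vecCoord_mfderiv_symm hψ (hUψ hy) v
    rw [h3] at h4
    exact h4.symm.trans (map_zero (mfderiv (𝓡 k) 𝓘(ℝ, Rn k) ψ (ψ.symm y)))
  gram y hy i j := by
    have hm : ∀ x, MDifferentiableAt (𝓡 k) (𝓡 n) f x := fun x =>
      (hf x).mdifferentiableAt (by simp)
    have h1 : ∀ i, vecCoord φ (f (ψ.symm y)) (mfderiv (𝓡 k) (𝓡 n) f (ψ.symm y) (coordVec ψ i y))
        = pd i (localMap f ψ φ) y := by
      intro i
      have h1 := vecCoord_mfderiv hψ hφ (ψ.map_target (hUψ hy)) (hUφ y hy) (hm _)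
        (coordVec ψ i y)
      rw [ψ.right_inv (hUψ hy)] at h1
      exact h1.trans (congrArg _ (vecCoord_mfderiv_symm hψ (hUψ hy) _))
    have h2 := inner_eq_matForm hφ g (hUφ y hy)
      (mfderiv (𝓡 k) (𝓡 n) f (ψ.symm y) (coordVec ψ i y))
      (mfderiv (𝓡 k) (𝓡 n) f (ψ.symm y) (coordVec ψ j y))
    rw [h1, h1] at h2
    exact h2

end LocalData

/-! ### The evolution equation for a local mean curvature flow. -/

section LocalFlow

variable {G W : Rn 4 → Matrix (Fin 4) (Fin 4) ℝ} {O : Set (Rn 4)}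
  {A : Rn 2 → Matrix (Fin 2) (Fin 2) ℝ} {f : ℝ → Rn 2 → Rn 4} {U : Set (Rn 2)} {I : Set ℝ} {t : ℝ}

/-- The evolution of the Hodge star of the pulled back Kähler form under a local mean curvature
flow. -/
theorem IsGramData.hasDerivWithinAt_starFun (h : IsGramData G O A (f t) U)
    (hW : ∀ i j, ContDiffOn ℝ ∞ (fun z => W z i j) O)
    (hp : IsParallelOn (chrMap G) O (fun z => matForm (W z)))
    (hsk : ∀ z ∈ O, ∀ v w, matForm (W z) v w = - matForm (W z) w v)
    (hI : Convex ℝ I) (hI' : (interior I).Nonempty)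
    (hf : ContDiffOn ℝ ∞ (fun q : ℝ × Rn 2 => f q.1 q.2) (I ×ˢ U)) (ht : t ∈ I)
    (hH : ∀ y ∈ U, HasDerivWithinAt (fun s => f s y) (∑ i, ∑ j, (A y)⁻¹ i j •
      normPart (chrMap G) (f t) (tanProj G A (f t)) (bvec 2 i) (bvec 2 j) y) I t)
    {y : Rn 2} (hy : y ∈ U) {u : Fin 2 → Rn 2}
    {J : Rn 4 →L[ℝ] Rn 4} {e : Fin 4 → Rn 4}
    (k : IsKaehlerFrame (matForm (G (f t y))) (matForm (W (f t y))) J e)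
    (he0 : e 0 = fderiv ℝ (f t) y (u 0)) (he1 : e 1 = fderiv ℝ (f t) y (u 1))
    {h₃ h₄ : Fin 2 → Fin 2 → ℝ}
    (hh₃ : ∀ i j, h₃ i j = matForm (G (f t y))
      (normPart (chrMap G) (f t) (tanProj G A (f t)) (u i) (u j) y) (e 2))
    (hh₄ : ∀ i j, h₄ i j = matForm (G (f t y))
      (normPart (chrMap G) (f t) (tanProj G A (f t)) (u i) (u j) y) (e 3)) :
    HasDerivWithinAt (fun s => starFun (fun z => matForm (G z)) (fun z => matForm (W z)) (f s) u y)
      (laplacianCoord A (starFun (fun z => matForm (G z)) (fun z => matForm (W z)) (f t) u) y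
      + starFun (fun z => matForm (G z)) (fun z => matForm (W z)) (f t) u y
        * ∑ k, ((h₃ 0 k - h₄ 1 k) ^ 2 + (h₃ 1 k + h₄ 0 k) ^ 2)
      + (1 - starFun (fun z => matForm (G z)) (fun z => matForm (W z)) (f t) u y ^ 2)
        * ∑ j, ∑ k, ricciCoeff G j k (f t y) * J (e 0) j * e 1 k) I t := by
  have hon : ∀ a b, matForm (G (f t y)) (fderiv ℝ (f t) y (u a)) (fderiv ℝ (f t) y (u b))
      = if a = b then 1 else 0 := by
    have hh : ∀ a : Fin 2, fderiv ℝ (f t) y (u a) = e (Fin.castLE (by norm_num) a) := by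
      intro a; fin_cases a
      · exact he0.symm
      · exact he1.symm
    intro a b
    rw [hh, hh, k.orthonormal]
    simp [Fin.ext_iff]
  have hu := linearIndependent_of_orthonormal hon
  obtain ⟨ub, rfl⟩ : ∃ ub : Module.Basis (Fin 2) ℝ (Rn 2), ub = u :=
    ⟨basisOfLinearIndependentOfCardEqFinrank hu (by simp), by simp⟩
  set H : Rn 2 → Rn 4 := fun y => ∑ i, ∑ j, (A y)⁻¹ i j •
      normPart (chrMap G) (f t) (tanProj G A (f t)) (bvec 2 i) (bvec 2 j) y with hHdef
  have hfd := (hasDerivWithinAt_fderiv_of_family hI hI' h.open_U hf ht hH hy).2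
  have hIm := h.isImmersedIn
  have key := KaehlerMCF.hasDerivWithinAt_starFun hIm.open_O hIm.symm_Γ hIm.smooth_g
    hIm.parallel_g hIm.symm_g (contDiffOn_bilinOf hW) hp (hIm.mapsTo hy) (hH y hy) hfd ub hon
  have ev := h.evolution hW hp hsk (H := H) (fun _ _ => rfl) hy ub k he0 he1 hon hh₃ hh₄
  refine key.congr_deriv (Eq.trans ?_ ev)
  rw [he0, he1]

end LocalFlow

/-! ### Localizing a mean curvature flow in space and time. -/

section FlowCharts

variable {k n : ℕ} {S : Type*} [TopologicalSpace S] [ChartedSpace (Rn k) S] [IsManifold (𝓡 k) ∞ S]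
  {M : Type*} [TopologicalSpace M] [ChartedSpace (Rn n) M] [IsManifold (𝓡 n) ∞ M]
  {ψ : OpenPartialHomeomorph S (Rn k)} {φ : OpenPartialHomeomorph M (Rn n)}
  {h : TwoTensor n M} {T t : ℝ} {F : ℝ → S → M}

omit [IsManifold (𝓡 k) ∞ S] [IsManifold (𝓡 n) ∞ M] in
theorem IsMeanCurvatureFlow.contMDiff (hF : IsMeanCurvatureFlow (k := k) h T F) (ht : t ∈ Ico 0 T) :
    ContMDiff (𝓡 k) (𝓡 n) ∞ (F t) := by
  have h1 : ContMDiff (𝓡 k) (𝓘(ℝ, ℝ).prod (𝓡 k)) ∞ (fun x : S => (t, x)) :=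
    contMDiff_const.prodMk contMDiff_id
  have h2 := hF.smooth.comp h1.contMDiffOn (s := univ) (fun x _ => ⟨ht, mem_univ _⟩)
  exact contMDiffOn_univ.1 h2

/-- A mean curvature flow in charts, near a point of space-time. -/
theorem IsMeanCurvatureFlow.exists_chart_nhds (hF : IsMeanCurvatureFlow (k := k) h T F) (ht : t ∈ Ico 0 T)
    (hψ : ψ ∈ atlas (Rn k) S) (hφ : φ ∈ atlas (Rn n) M) {p : S} (hp : p ∈ ψ.source)
    (hFp : F t p ∈ φ.source) :
    ∃ I ⊆ Ico 0 T, t ∈ I ∧ Convex ℝ I ∧ (interior I).Nonempty ∧ I ∈ nhdsWithin t (Ico 0 T) ∧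
      ∃ U : Set (Rn k), IsOpen U ∧ ψ p ∈ U ∧ U ⊆ ψ.target ∧
        (∀ s ∈ I, ∀ y ∈ U, F s (ψ.symm y) ∈ φ.source) ∧
        ContDiffOn ℝ ∞ (fun q : ℝ × Rn k => localMap (F q.1) ψ φ q.2) (I ×ˢ U) := by
  have hψs : ContMDiffOn 𝓘(ℝ, Rn k) (𝓡 k) ∞ ψ.symm ψ.target :=
    contMDiffOn_symm_of_mem_maximalAtlas (IsManifold.subset_maximalAtlas hψ)
  have h1 : ContMDiffOn 𝓘(ℝ, ℝ × Rn k) (𝓘(ℝ, ℝ).prod (𝓡 k)) ∞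
      (fun q : ℝ × Rn k => (q.1, ψ.symm q.2)) (Ico 0 T ×ˢ ψ.target) := by
    refine ContMDiffOn.prodMk contDiff_fst.contMDiff.contMDiffOn ?_
    exact hψs.comp contDiff_snd.contMDiff.contMDiffOn fun q hq => hq.2
  have h2 : ContMDiffOn 𝓘(ℝ, ℝ × Rn k) (𝓡 n) ∞ (fun q : ℝ × Rn k => F q.1 (ψ.symm q.2))
      (Ico 0 T ×ˢ ψ.target) := hF.smooth.comp h1 fun q hq => ⟨hq.1, mem_univ _⟩
  have hpt : ψ p ∈ ψ.target := ψ.map_source hp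
  have h3 : (fun q : ℝ × Rn k => F q.1 (ψ.symm q.2)) ⁻¹' φ.source ∈
      nhdsWithin (t, ψ p) (Ico 0 T ×ˢ ψ.target) := by
    refine (h2.continuousOn (t, ψ p) ⟨ht, hpt⟩).preimage_mem_nhdsWithin ?_
    refine φ.open_source.mem_nhds ?_
    simpa [ψ.left_inv hp] using hFp
  rw [nhdsWithin_prod_eq, ψ.open_target.nhdsWithin_eq hpt, Filter.mem_prod_iff] at h3
  obtain ⟨Z, hZ, B, hB, hZB⟩ := h3
  -- A ball is chosen so that the time set is convex, as the exchange of derivatives requires.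
  obtain ⟨δ, hδ, hball⟩ := Metric.mem_nhdsWithin_iff.1 hZ
  have hsrc : ∀ s ∈ Metric.ball t δ ∩ Ico 0 T, ∀ y ∈ interior B ∩ ψ.target,
      F s (ψ.symm y) ∈ φ.source := fun s hs y hy =>
    hZB (mk_mem_prod (hball hs) (interior_subset hy.1))
  refine ⟨Metric.ball t δ ∩ Ico 0 T, inter_subset_right, ⟨Metric.mem_ball_self hδ, ht⟩,
    (convex_ball t δ).inter (convex_Ico 0 T), ?_, ?_, interior B ∩ ψ.target,
    isOpen_interior.inter ψ.open_target, ⟨mem_interior_iff_mem_nhds.2 hB, hpt⟩, inter_subset_right,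
    hsrc, ?_⟩
  -- Times just after t always belong to the set, even for t = 0.
  · have h4 : Ioo t (min T (t + δ)) ⊆ Metric.ball t δ ∩ Ico 0 T := by
      rintro s ⟨hs1, hs2⟩
      rw [lt_min_iff] at hs2
      refine ⟨?_, (ht.1.trans hs1.le), hs2.1⟩
      rw [Real.ball_eq_Ioo]
      exact ⟨by linarith, hs2.2⟩
    refine (nonempty_Ioo.2 ?_).mono (interior_maximal h4 isOpen_Ioo)
    exact lt_min ht.2 (by linarith)
  · rw [inter_comm]
    exact inter_mem_nhdsWithin _ (Metric.ball_mem_nhds t hδ)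
  · have h5 : ContMDiffOn (𝓡 n) 𝓘(ℝ, Rn n) ∞ φ φ.source :=
      contMDiffOn_of_mem_maximalAtlas (IsManifold.subset_maximalAtlas hφ)
    rw [← contMDiffOn_iff_contDiffOn]
    exact h5.comp (h2.mono (prod_mono inter_subset_right inter_subset_right))
      fun q hq => hsrc q.1 hq.1 q.2 hq.2

end FlowCharts

/-! ### Adapted frames in a chart. -/

section FrameChart

variable {M : Type*} [TopologicalSpace M] [ChartedSpace (Rn 4) M] [IsManifold (𝓡 4) ∞ M]
  {φ : OpenPartialHomeomorph M (Rn 4)}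

theorem vecCoord_surjective {n : ℕ} {M : Type*} [TopologicalSpace M] [ChartedSpace (Rn n) M]
    [IsManifold (𝓡 n) ∞ M] {φ : OpenPartialHomeomorph M (Rn n)} (hφ : φ ∈ atlas (Rn n) M) {x : M}
    (hx : x ∈ φ.source) : Function.Surjective (vecCoord φ x) := by
  obtain ⟨x', hx', h1, h2⟩ := exists_vecCoord hφ (φ.map_source hx)
  obtain rfl := φ.injOn hx' hx h1
  exact h2

/-- Orthonormal vectors, as many as the dimension, form a basis. -/
theorem expand_of_orthonormal {n : ℕ} {g : Rn n →L[ℝ] Rn n →L[ℝ] ℝ} {e : Fin n → Rn n}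
    (he : ∀ a b, g (e a) (e b) = if a = b then 1 else 0) (X : Rn n) :
    X = ∑ a, g X (e a) • e a := by
  have hsum : ∀ (c : Fin n → ℝ) b, g (∑ a, c a • e a) (e b) = c b := by
    intro c b
    simp [map_sum, map_smul, _root_.sum_apply, _root_.smul_apply, he]
  have hli : LinearIndependent ℝ e := by
    rw [Fintype.linearIndependent_iff]
    intro c hc b
    rw [← hsum c b, hc]; simp
  have hspan : ⊤ ≤ Submodule.span ℝ (range e) := by
    rw [hli.span_eq_top_of_card_eq_finrank' (by simp)]
  obtain ⟨c, rfl⟩ : ∃ c : Fin n → ℝ, ∑ a, c a • e a = X := by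
    have := hspan (Submodule.mem_top (x := X))
    exact (Submodule.mem_span_range_iff_exists_fun ℝ).1 this
  exact Finset.sum_congr rfl fun a _ => by rw [hsum]

/-- An orthonormal frame of a Kähler surface in a chart. -/
theorem exists_isKaehlerFrame (hφ : φ ∈ atlas (Rn 4) M) {g : Metric 4 M}
    {J : ∀ x : M, TangentSpace (𝓡 4) x →L[ℝ] TangentSpace (𝓡 4) x} (hJ : IsKaehler g J)
    {x : M} (hx : x ∈ φ.source) {e : Fin 4 → TangentSpace (𝓡 4) x}
    (he : ∀ a b, g.inner x (e a) (e b) = if a = b then 1 else 0)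
    (hc : 0 < kaehlerForm g J x (e 0) (e 1) * kaehlerForm g J x (e 2) (e 3)
      - kaehlerForm g J x (e 0) (e 2) * kaehlerForm g J x (e 1) (e 3)
      + kaehlerForm g J x (e 0) (e 3) * kaehlerForm g J x (e 1) (e 2)) :
    ∃ J' : Rn 4 →L[ℝ] Rn 4, (∀ v, J' (vecCoord φ x v) = vecCoord φ x (J x v)) ∧
      IsKaehlerFrame (matForm (coeff g.tensor φ (φ x))) (matForm (coeff (kaehlerForm g J) φ (φ x)))
        J' (fun a => vecCoord φ x (e a)) := by
  let D : Rn 4 →L[ℝ] Rn 4 := mfderiv (𝓡 4) 𝓘(ℝ, Rn 4) φ x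
  let D' : Rn 4 →L[ℝ] Rn 4 := mfderiv 𝓘(ℝ, Rn 4) (𝓡 4) φ.symm (φ x)
  let Jx : Rn 4 →L[ℝ] Rn 4 := J x
  have hJ' : ∀ v : TangentSpace (𝓡 4) x,
      (D.comp (Jx.comp D')) (vecCoord φ x v) = vecCoord φ x (J x v) := fun v =>
    congrArg (fun w : Rn 4 => D (Jx w)) (mfderiv_symm_vecCoord hφ hx v)
  have hs := vecCoord_surjective hφ hx
  have hg := inner_eq_matForm hφ g hx
  have hk := kaehlerForm_eq_matForm hφ g J hx
  have hon : ∀ a b, matForm (coeff g.tensor φ (φ x)) (vecCoord φ x (e a)) (vecCoord φ x (e b))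
      = if a = b then 1 else 0 := fun a b => (hg _ _).symm.trans (he a b)
  -- J conjugated by the differential of the chart. Each property descends from the manifold because
  -- `vecCoord` is surjective.
  refine ⟨D.comp (Jx.comp D'), hJ', ?_, ?_, ?_, ?_, hon, expand_of_orthonormal hon, ?_⟩
  · intro v w
    obtain ⟨v, rfl⟩ := hs v
    obtain ⟨w, rfl⟩ := hs w
    exact (hg v w).symm.trans ((g.symm x v w).trans (hg w v))
  · intro v w
    obtain ⟨v, rfl⟩ := hs v
    obtain ⟨w, rfl⟩ := hs w
    rw [hJ']
    exact (hk v w).symm.trans (hg (J x v) w)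
  · intro v
    obtain ⟨v, rfl⟩ := hs v
    rw [hJ', hJ', hJ.sq]
    exact map_neg (mfderiv (𝓡 4) 𝓘(ℝ, Rn 4) φ x) v
  · intro v w
    obtain ⟨v, rfl⟩ := hs v
    obtain ⟨w, rfl⟩ := hs w
    rw [hJ', hJ']
    exact (hg _ _).symm.trans ((hJ.orthogonal x v w).trans (hg v w))
  · simp only [hk] at hc
    exact hc

end FrameChart

/-! ### The Hodge star of the pulled back form in charts. -/

section HodgeChart

variable {n : ℕ} {S : Type*} [TopologicalSpace S] [ChartedSpace (Rn 2) S] [IsManifold (𝓡 2) ∞ S]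
  {M : Type*} [TopologicalSpace M] [ChartedSpace (Rn n) M] [IsManifold (𝓡 n) ∞ M]
  {ψ : OpenPartialHomeomorph S (Rn 2)} {φ : OpenPartialHomeomorph M (Rn n)}

/-- The Hodge star of the pulled back Kähler form in charts. -/
theorem hodgeStar_chart (hψ : ψ ∈ atlas (Rn 2) S) (hφ : φ ∈ atlas (Rn n) M) {g : Metric n M}
    {J : ∀ x : M, TangentSpace (𝓡 n) x →L[ℝ] TangentSpace (𝓡 n) x} (hJ : IsKaehler g J)
    (μ : OrientationForm S) {f : S → M} {x : S} (hx : x ∈ ψ.source) (hfx : f x ∈ φ.source)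
    (hf : MDifferentiableAt (𝓡 2) (𝓡 n) f x) (u : Fin 2 → TangentSpace (𝓡 2) x)
    (hpos : 0 < μ.form x (u 0) (u 1)) :
    hodgeStar μ (pullback f g.tensor) (pullback f (kaehlerForm g J)) x =
      starFun (fun z => matForm (coeff g.tensor φ z))
        (fun z => matForm (coeff (kaehlerForm g J) φ z)) (localMap f ψ φ)
        (fun a => vecCoord ψ x (u a)) (ψ x) := by
  have hl : localMap f ψ φ (ψ x) = φ (f x) := by simp [localMap, ψ.left_inv hx]
  have hv := vecCoord_mfderiv hψ hφ hx hfx hf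
  have hg : ∀ v w, pullback f g.tensor x v w = matForm (coeff g.tensor φ (localMap f ψ φ (ψ x)))
      (fderiv ℝ (localMap f ψ φ) (ψ x) (vecCoord ψ x v))
      (fderiv ℝ (localMap f ψ φ) (ψ x) (vecCoord ψ x w)) := by
    intro v w
    rw [← hv, ← hv, hl]
    exact inner_eq_matForm hφ g hfx _ _
  have hk : ∀ v w, pullback f (kaehlerForm g J) x v w =
      matForm (coeff (kaehlerForm g J) φ (localMap f ψ φ (ψ x)))
      (fderiv ℝ (localMap f ψ φ) (ψ x) (vecCoord ψ x v))
      (fderiv ℝ (localMap f ψ φ) (ψ x) (vecCoord ψ x w)) := by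
    intro v w
    rw [← hv, ← hv, hl]
    exact kaehlerForm_eq_matForm hφ g J hfx _ _
  let D : Rn 2 →L[ℝ] Rn n := mfderiv (𝓡 2) (𝓡 n) f x
  let gx : Rn n →L[ℝ] Rn n →L[ℝ] ℝ := g.inner (f x)
  let Jx : Rn n →L[ℝ] Rn n := J (f x)
  let Bh : Rn 2 →L[ℝ] Rn 2 →L[ℝ] ℝ := gx.bilinearComp D D
  let Bω : Rn 2 →L[ℝ] Rn 2 →L[ℝ] ℝ := (gx.comp Jx).bilinearComp D D
  have key := hodgeStar_eq_of_pos μ (h := pullback f g.tensor) (β := pullback f (kaehlerForm g J))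
    Bh Bω (fun _ _ => rfl) (fun _ _ => rfl)
    (fun v w => g.symm (f x) (mfderiv (𝓡 2) (𝓡 n) f x v) (mfderiv (𝓡 2) (𝓡 n) f x w))
    (fun v => self_eq_neg.1 (kaehlerForm_skew hJ (f x) (mfderiv (𝓡 2) (𝓡 n) f x v)
      (mfderiv (𝓡 2) (𝓡 n) f x v))) hpos
  rw [key, hg, hg, hg, hk]
  rfl

/-- A basis which is positive at a point is positive nearby. -/
theorem eventually_pos_orientation (hψ : ψ ∈ atlas (Rn 2) S) (μ : OrientationForm S) {p : S}
    (hp : p ∈ ψ.source) (u : Fin 2 → TangentSpace (𝓡 2) p) (hpos : 0 < μ.form p (u 0) (u 1)) :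
    ∀ᶠ y in nhds (ψ p), 0 < μ.form (ψ.symm y)
      (mfderiv 𝓘(ℝ, Rn 2) (𝓡 2) ψ.symm y (vecCoord ψ p (u 0)))
      (mfderiv 𝓘(ℝ, Rn 2) (𝓡 2) ψ.symm y (vecCoord ψ p (u 1))) := by
  have hpt := ψ.map_source hp
  have h1 := contDiffOn_bilin_fields hψ μ.smooth (contMDiffOn_coordField hψ (vecCoord ψ p (u 0)))
    (contMDiffOn_coordField hψ (vecCoord ψ p (u 1)))
  have h2 := h1.continuousOn.continuousAt (ψ.open_target.mem_nhds hpt)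
  refine h2.eventually (lt_mem_nhds ?_)
  have h3 : ∀ x', x' = p → ∀ v' w' : Rn 2, μ.form x' v' w' = μ.form p v' w' := by
    rintro _ rfl v' w'; rfl
  refine hpos.trans_eq (Eq.symm ?_)
  exact (h3 _ (ψ.left_inv hp) _ _).trans (congrArg₂ (fun a b : Rn 2 => μ.form p a b)
    (mfderiv_symm_vecCoord hψ hp (u 0)) (mfderiv_symm_vecCoord hψ hp (u 1)))

/-- The Laplacian needs the star function on a whole neighbourhood. The basis u at p is extended by
constant coordinate fields, which stay positive near p, and on a positive basis the star is
`starFun`. -/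
theorem eventually_hodgeStar_eq (hψ : ψ ∈ atlas (Rn 2) S) (hφ : φ ∈ atlas (Rn n) M)
    {g : Metric n M} {J : ∀ x : M, TangentSpace (𝓡 n) x →L[ℝ] TangentSpace (𝓡 n) x}
    (hJ : IsKaehler g J) (μ : OrientationForm S) {f : S → M} (hf : MDifferentiable (𝓡 2) (𝓡 n) f)
    {p : S} (hp : p ∈ ψ.source) {U : Set (Rn 2)} (hU : U ∈ nhds (ψ p)) (hUψ : U ⊆ ψ.target)
    (hUφ : ∀ y ∈ U, f (ψ.symm y) ∈ φ.source) (u : Fin 2 → TangentSpace (𝓡 2) p)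
    (hpos : 0 < μ.form p (u 0) (u 1)) :
    hodgeStar μ (pullback f g.tensor) (pullback f (kaehlerForm g J)) ∘ ψ.symm =ᶠ[nhds (ψ p)]
      starFun (fun z => matForm (coeff g.tensor φ z))
        (fun z => matForm (coeff (kaehlerForm g J) φ z)) (localMap f ψ φ)
        (fun a => vecCoord ψ p (u a)) := by
  filter_upwards [hU, eventually_pos_orientation hψ μ hp u hpos] with y hy hμ
  have h1 := hodgeStar_chart hψ hφ hJ μ (ψ.map_target (hUψ hy)) (hUφ y hy) (hf _)
    (fun a => mfderiv 𝓘(ℝ, Rn 2) (𝓡 2) ψ.symm y (vecCoord ψ p (u a))) hμ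
  rw [ψ.right_inv (hUψ hy)] at h1
  refine h1.trans (congrArg (fun w => starFun _ _ _ w y) (funext fun a => ?_))
  exact vecCoord_mfderiv_symm hψ (hUψ hy) _

theorem OrientationForm.exists_pos (μ : OrientationForm S) (p : S) :
    ∃ u : Fin 2 → TangentSpace (𝓡 2) p, 0 < μ.form p (u 0) (u 1) := by
  have h1 := μ.ne_zero p
  have h2 : ∃ v w, μ.form p v w ≠ 0 := by
    by_contra! h
    exact h1 (ContinuousLinearMap.ext fun v => ContinuousLinearMap.ext fun w => h v w)
  obtain ⟨v, w, hvw⟩ := h2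
  rcases hvw.lt_or_gt with h | h
  · refine ⟨![-v, w], ?_⟩
    simp only [Matrix.cons_val_zero, Matrix.cons_val_one, map_neg, _root_.neg_apply]
    linarith
  · exact ⟨![v, w], h⟩

theorem linearIndependent_vecCoord (hψ : ψ ∈ atlas (Rn 2) S) (μ : OrientationForm S) {p : S}
    (hp : p ∈ ψ.source) {u : Fin 2 → TangentSpace (𝓡 2) p} (hpos : 0 < μ.form p (u 0) (u 1)) :
    LinearIndependent ℝ (fun a => vecCoord ψ p (u a)) := by
  have hm := tensor_eq_matForm hψ μ.form hp
  generalize matForm (coeff (fun x v w => μ.form x v w) ψ (ψ p)) = m at hm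
  have h0 := (hm (u 0) (u 0)).symm.trans (μ.alternating p _)
  have h1 := (hm (u 1) (u 1)).symm.trans (μ.alternating p _)
  rw [hm] at hpos
  rw [Fintype.linearIndependent_iff]
  intro c hc
  rw [Fin.sum_univ_two] at hc
  have e0 : c 0 * m (vecCoord ψ p (u 0)) (vecCoord ψ p (u 1)) = 0 := by
    have := congrArg (fun X => m X (vecCoord ψ p (u 1))) hc
    simpa [h1] using this
  have e1 : c 1 * m (vecCoord ψ p (u 0)) (vecCoord ψ p (u 1)) = 0 := by
    have := congrArg (fun X => m (vecCoord ψ p (u 0)) X) hc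
    simpa [h0] using this
  intro i
  fin_cases i
  · exact (mul_eq_zero.1 e0).resolve_right hpos.ne'
  · exact (mul_eq_zero.1 e1).resolve_right hpos.ne'

end HodgeChart

/-! ### Smoothness and evolution of the Hodge star along the flow. -/

section Main

variable {S : Type*} [TopologicalSpace S] [ChartedSpace (Rn 2) S] [IsManifold (𝓡 2) ∞ S]

theorem laplacianCoord_congr {n : ℕ} {G : Rn n → Matrix (Fin n) (Fin n) ℝ} {u v : Rn n → ℝ}
    {y : Rn n} (h : u =ᶠ[nhds y] v) : laplacianCoord G u y = laplacianCoord G v y := by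
  have h1 : ∀ j, pd j u =ᶠ[nhds y] pd j v := fun j => by
    filter_upwards [h.eventuallyEq_nhds] with z hz
    simp only [pd, hz.fderiv_eq (𝕜 := ℝ)]
  simp only [laplacianCoord]
  refine Finset.sum_congr rfl fun i _ => Finset.sum_congr rfl fun j _ => ?_
  have h2 : pd i (pd j u) y = pd i (pd j v) y := by
    rw [pd, pd, (h1 j).fderiv_eq (𝕜 := ℝ)]
  rw [h2]
  simp only [(h1 _).eq_of_nhds]

variable {M : Type*} [TopologicalSpace M] [ChartedSpace (Rn 4) M] [IsManifold (𝓡 4) ∞ M]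

/-- The Hodge star of the pulled back Kähler form is smooth along a mean curvature flow. -/
theorem IsMeanCurvatureFlow.contMDiff_hodgeStar
    {g : Metric 4 M} {J : ∀ x : M, TangentSpace (𝓡 4) x →L[ℝ] TangentSpace (𝓡 4) x}
    (hJ : IsKaehler g J) (μ : OrientationForm S) {T t : ℝ} {F : ℝ → S → M}
    (hF : IsMeanCurvatureFlow (k := 2) g.tensor T F) (ht : t ∈ Ico 0 T) :
    ContMDiff (𝓡 2) 𝓘(ℝ, ℝ) ∞
      (hodgeStar μ (pullback (F t) g.tensor) (pullback (F t) (kaehlerForm g J))) := by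
  intro p
  have hψ := chart_mem_atlas (Rn 2) p
  have hφ := chart_mem_atlas (Rn 4) (F t p)
  have hp := mem_chart_source (Rn 2) p
  have hFp := mem_chart_source (Rn 4) (F t p)
  generalize chartAt (Rn 2) p = ψ at hψ hp
  generalize chartAt (Rn 4) (F t p) = φ at hφ hFp
  obtain ⟨I, -, htI, -, -, -, U, hU, hpU, hUψ, hUφ, hs⟩ := hF.exists_chart_nhds ht hψ hφ hp hFp
  have hft := hF.contMDiff ht
  have hst : ContDiffOn ℝ ∞ (localMap (F t) ψ φ) U :=
    hs.comp (contDiff_const.prodMk contDiff_id).contDiffOn fun y hy => ⟨htI, hy⟩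
  have hGD := isGramData_chart hψ hφ g hft (hF.immersion t ht) hU hUψ (hUφ t htI) hst
  obtain ⟨u, hpos⟩ := μ.exists_pos p
  have hη := eventually_hodgeStar_eq hψ hφ hJ μ (hft.mdifferentiable (by simp)) hp
    (hU.mem_nhds hpU) hUψ (hUφ t htI) u hpos
  have hIm := hGD.isImmersedIn
  have hli := linearIndependent_vecCoord hψ μ hp hpos
  have hdet : ∀ y ∈ U, 0 < gramDet (fun z => matForm (coeff g.tensor φ z)) (localMap (F t) ψ φ)
      (fun a => vecCoord ψ p (u a)) y := fun y hy => hGD.gramDet_pos hli hy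
  have hst := hIm.contDiffOn_starFun
    (contDiffOn_bilinOf (contDiffOn_coeff_kaehlerForm hφ g hJ)) _ hdet
  have h1 := (hst.contDiffAt (hU.mem_nhds hpU)).congr_of_eventuallyEq hη
  have h2 : ContMDiffAt (𝓡 2) 𝓘(ℝ, Rn 2) ∞ ψ p :=
    contMDiffAt_of_mem_maximalAtlas (IsManifold.subset_maximalAtlas hψ) hp
  refine (h1.contMDiffAt.comp p h2).congr_of_eventuallyEq ?_
  filter_upwards [ψ.open_source.mem_nhds hp] with x hx
  simp [ψ.left_inv hx]

/-- The evolution of the Hodge star of the pulled back Kähler form. -/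
theorem IsMeanCurvatureFlow.hasDerivWithinAt_hodgeStar
    {g : Metric 4 M} {J : ∀ x : M, TangentSpace (𝓡 4) x →L[ℝ] TangentSpace (𝓡 4) x}
    (hJ : IsKaehler g J) (μ : OrientationForm S) {T t : ℝ} {F : ℝ → S → M}
    (hF : IsMeanCurvatureFlow (k := 2) g.tensor T F) {η : ℝ → S → ℝ}
    (hη : ∀ t, η t = hodgeStar μ (pullback (F t) g.tensor) (pullback (F t) (kaehlerForm g J)))
    (ht : t ∈ Ico 0 T) {p : S} {u : Fin 2 → TangentSpace (𝓡 2) p}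
    {e : Fin 4 → TangentSpace (𝓡 4) (F t p)} (he : IsAdaptedFrame g J μ (F t) p u e)
    {h₃ h₄ : Fin 2 → Fin 2 → ℝ}
    (hh₃ : ∀ i j, h₃ i j = secondForm (k := 2) g.tensor (F t) p (u i) (u j) (e 2))
    (hh₄ : ∀ i j, h₄ i j = secondForm (k := 2) g.tensor (F t) p (u i) (u j) (e 3)) :
    HasDerivWithinAt (fun s => η s p)
      (laplaceBeltrami (n := 2) (pullback (F t) g.tensor) (η t) p
        + η t p * ∑ k, ((h₃ 0 k - h₄ 1 k) ^ 2 + (h₃ 1 k + h₄ 0 k) ^ 2)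
        + (1 - η t p ^ 2) * ricci g.tensor (F t p) (J (F t p) (e 0)) (e 1)) (Ico 0 T) t := by
  rw [laplaceBeltrami, ricci]
  have hψ := chart_mem_atlas (Rn 2) p
  have hφ := chart_mem_atlas (Rn 4) (F t p)
  have hp := mem_chart_source (Rn 2) p
  have hFp := mem_chart_source (Rn 4) (F t p)
  have hsf := fun v w ν => secondForm_eq (k := 2) (h := g.tensor) (f := F t) p v w ν rfl rfl
  generalize chartAt (Rn 2) p = ψ at *
  generalize chartAt (Rn 4) (F t p) = φ at *
  obtain ⟨I, hIT, htI, hIc, hIi, hIn, U, hU, hpU, hUψ, hUφ, hs⟩ :=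
    hF.exists_chart_nhds ht hψ hφ hp hFp
  have hft := hF.contMDiff ht
  have hslice : ∀ s ∈ I, ContDiffOn ℝ ∞ (localMap (F s) ψ φ) U := fun s hsI =>
    hs.comp (contDiff_const.prodMk contDiff_id).contDiffOn fun y hy => ⟨hsI, hy⟩
  have hcd : ∀ y ∈ U, ContDiffAt ℝ ∞ (localMap (F t) ψ φ) y := fun y hy =>
    (hslice t htI).contDiffAt (hU.mem_nhds hy)
  have hGD := isGramData_chart hψ hφ g hft (hF.immersion t ht) hU hUψ (hUφ t htI) (hslice t htI)
  have hl : localMap (F t) ψ φ (ψ p) = φ (F t p) := by simp [localMap, ψ.left_inv hp]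
  -- At the fixed point p the basis u is positive at every time, since orientation does not involve
  -- the metric. Equality at nearby points is needed only at time t, in `hηt`.
  have hηs : ∀ s ∈ I, η s p = starFun (fun z => matForm (coeff g.tensor φ z))
      (fun z => matForm (coeff (kaehlerForm g J) φ z)) (localMap (F s) ψ φ)
      (fun a => vecCoord ψ p (u a)) (ψ p) := by
    intro s hsI
    have h1 := hUφ s hsI _ hpU
    rw [ψ.left_inv hp] at h1
    rw [hη]
    exact hodgeStar_chart hψ hφ hJ μ hp h1
      ((hF.contMDiff (hIT hsI)).mdifferentiable (by simp) p) u he.oriented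
  have hηt : η t ∘ ψ.symm =ᶠ[nhds (ψ p)] starFun (fun z => matForm (coeff g.tensor φ z))
      (fun z => matForm (coeff (kaehlerForm g J) φ z)) (localMap (F t) ψ φ)
      (fun a => vecCoord ψ p (u a)) := by
    rw [hη]
    exact eventually_hodgeStar_eq hψ hφ hJ μ (hft.mdifferentiable (by simp)) hp
      (hU.mem_nhds hpU) hUψ (hUφ t htI) u he.oriented
  obtain ⟨J', hJ', hK⟩ := exists_isKaehlerFrame hφ hJ hFp he.orthonormal he.compatible
  have hv := vecCoord_mfderiv hψ hφ hp hFp (hft.mdifferentiable (by simp) p)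
  rw [← hl] at hK
  have hH : ∀ y ∈ U, HasDerivWithinAt (fun s => localMap (F s) ψ φ y)
      (∑ i, ∑ j, (coeff (pullback (F t) g.tensor) ψ y)⁻¹ i j •
        normPart (chrMap (coeff g.tensor φ)) (localMap (F t) ψ φ)
          (tanProj (coeff g.tensor φ) (coeff (pullback (F t) g.tensor) ψ) (localMap (F t) ψ φ))
          (bvec 2 i) (bvec 2 j) y) I t := by
    intro y hy
    have h1 := hF.equation ψ hψ φ hφ t ht (ψ.symm y) (ψ.map_target (hUψ hy)) (hUφ t htI y hy)
    rw [ψ.right_inv (hUψ hy), meanCurvatureCoord_eq (hcd y hy)] at h1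
    exact h1.mono hIT
  have hsf' : ∀ i j n, secondForm g.tensor (F t) p (u i) (u j) (e n) =
      matForm (coeff g.tensor φ (localMap (F t) ψ φ (ψ p)))
      (normPart (chrMap (coeff g.tensor φ)) (localMap (F t) ψ φ)
        (tanProj (coeff g.tensor φ) (coeff (pullback (F t) g.tensor) ψ) (localMap (F t) ψ φ))
          (vecCoord ψ p (u i)) (vecCoord ψ p (u j)) (ψ p)) (vecCoord φ (F t p) (e n)) := by
    intro i j n
    rw [hl]
    exact hsf _ _ _ (hcd _ hpU)
  have key := hGD.hasDerivWithinAt_starFun (f := fun s => localMap (F s) ψ φ) (h₃ := h₃) (h₄ := h₄)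
    (contDiffOn_coeff_kaehlerForm hφ g hJ) (isParallelOn_kaehlerForm hφ hJ)
    (fun z hz => matForm_kaehler_skew hφ hJ hz) hIc hIi hs htI hH hpU
    (u := fun a => vecCoord ψ p (u a)) hK
    ((congrArg _ he.tangent_one).trans (hv (u 0))) ((congrArg _ he.tangent_two).trans (hv (u 1)))
    (fun i j => (hh₃ i j).trans (hsf' i j 2)) (fun i j => (hh₄ i j).trans (hsf' i j 3))
  -- I is a neighbourhood of t within [0, T), so the derivative within I is the derivative within
  -- [0, T), one-sided at t = 0.
  have key' := (key.mono_of_mem_nhdsWithin hIn).congr_of_eventuallyEq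
    (f₁ := fun s => η s p) (by filter_upwards [hIn] with s hsI using hηs s hsI) (hηs t htI)
  refine key'.congr_deriv ?_
  rw [laplacianCoord_congr hηt, hηs t htI, hl]
  simp only [hJ']

end Main

end KaehlerMCF

end

theorem mainTheorem9
    {M : Type*} [TopologicalSpace M] [ChartedSpace (KaehlerMCF.Rn 4) M] [IsManifold (𝓡 4) ∞ M]
    {S : Type*} [TopologicalSpace S] [ChartedSpace (KaehlerMCF.Rn 2) S] [IsManifold (𝓡 2) ∞ S]
    (g : KaehlerMCF.Metric 4 M)
    (J : ∀ x : M, TangentSpace (𝓡 4) x →L[ℝ] TangentSpace (𝓡 4) x)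
    (hJ : KaehlerMCF.IsKaehler g J)
    (μ : KaehlerMCF.OrientationForm S)
    (T : ℝ) (F : ℝ → S → M) (hF : KaehlerMCF.IsMeanCurvatureFlow (k := 2) g.tensor T F)
    (η : ℝ → S → ℝ)
    (hη : ∀ t, η t = KaehlerMCF.hodgeStar μ (KaehlerMCF.pullback (F t) g.tensor)
      (KaehlerMCF.pullback (F t) (KaehlerMCF.kaehlerForm g J)))
    (t : ℝ) (ht : t ∈ Set.Ico 0 T) :
    ContMDiff (𝓡 2) 𝓘(ℝ, ℝ) ∞ (η t) ∧
    ∀ (p : S) (u : Fin 2 → TangentSpace (𝓡 2) p) (e : Fin 4 → TangentSpace (𝓡 4) (F t p)),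
      KaehlerMCF.IsAdaptedFrame g J μ (F t) p u e →
      ∀ h₃ h₄ : Fin 2 → Fin 2 → ℝ,
        (∀ i j, h₃ i j = KaehlerMCF.secondForm (k := 2) g.tensor (F t) p (u i) (u j) (e 2)) →
        (∀ i j, h₄ i j = KaehlerMCF.secondForm (k := 2) g.tensor (F t) p (u i) (u j) (e 3)) →
        HasDerivWithinAt (fun s => η s p)
          (KaehlerMCF.laplaceBeltrami (n := 2) (KaehlerMCF.pullback (F t) g.tensor) (η t) p
            + η t p * ∑ k, ((h₃ 0 k - h₄ 1 k) ^ 2 + (h₃ 1 k + h₄ 0 k) ^ 2)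
            + (1 - η t p ^ 2) * KaehlerMCF.ricci g.tensor (F t p) (J (F t p) (e 0)) (e 1))
          (Set.Ico 0 T) t := by
  refine ⟨by rw [hη]; exact hF.contMDiff_hodgeStar hJ μ ht, ?_⟩
  intro p u e he h₃ h₄ hh₃ hh₄
  exact hF.hasDerivWithinAt_hodgeStar hJ μ hη ht he hh₃ hh₄
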